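/- Let $N$ and $\ell$ be integers with $1<|N|<\ell$, and assume that either $N>0$ and $\ell-N$ is even, or $N<0$ and $N$ is even. Let $q\in\mathbb C$ with $q^2=e^{\pm 2\pi i/\ell}$ (for instance $q=e^{\pi i/\ell}$), and write $[n]=(q^n-q^{-n})/(q-q^{-1})$ for $n\in\mathbb Z$. For a Young diagram $\lambda$ with $\lambda_i$ boxes in the $i$-th row and $\lambda'_j$ boxes in the $j$-th column, let $h(i,j)$ be the hook length of the box $(i,j)$ and put $$d(i,j)=\begin{cases}\lambda_i+\lambda_j-i-j & \text{if } i\le j,\\ -\lambda_i'-\lambda_j'+i+j-2 & \text{if } i>j,\end{cases}\qquad d_\lambda=\prod_{(i,j)\in\lambda}\frac{[N+d(i,j)]}{[h(i,j)]}.$$ Let $\Lambda(N,\ell)$ be the set of Young diagrams $\lambda$ with $\lambda_1'+\lambda_2'\le N$ and $\lambda_1\le(\ell-N)/2$ if $N>0$, and with $\lambda_1\le|N|/2$ and $\lambda_1'+\lambda_2'\le\ell-|N|$ if $N<0$. Let $\Lambda(N,\ell)_{ev}$ be the subset of the diagrams with an even number of boxes; it is finite. Let $k=\lfloor |N|/2\rfloor$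 and $\check\rho=\big((|N|+1)/2-i\big)_{1\le i\le k}\in\mathbb R^k$. Then $$\sum_{\lambda\in\Lambda(N,\ell)_{ev}}d_\lambda^2=\frac{\ell^k}{b(N)}\prod_{\alpha>0}\frac{1}{4\sin^2\big((\alpha,\check\rho)\pi/\ell\big)}.$$ Here $(\cdot,\cdot)$ is the usual scalar product of $\mathbb R^k$, and $\alpha$ runs through the positive roots of $\mathfrak{so}_N$ if $N>0$ and of $\mathfrak{sp}_{|N|}$ if $N<0$. In terms of the standard basis $\phi_1,\dots,\phi_k$ of $\mathbb R^k$ these are the vectors $\phi_i\pm\phi_j$ $(i<j)$, together with all $\phi_i$ if $N=2k+1>0$, and together with all $2\phi_i$ if $N=-2k<0$. Finally $b(N)=2$ if $N>0$ is even, and $b(N)=1$ otherwise. -/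

import Mathlib

namespace SquareSum

/-- The `q`-number `[n] = (q^n - q^{-n}) / (q - q^{-1})`. -/
noncomputable def qNum (q : ℂ) (n : ℤ) : ℂ :=
  (q ^ n - q ^ (-n)) / (q - q⁻¹)

/-- The hook length of the box `c = (i, j)`. Boxes are indexed from `0`, so the arm has
`rowLen i - j - 1` boxes and the leg has `colLen j - i - 1` boxes. -/
def hook (μ : YoungDiagram) (c : ℕ × ℕ) : ℤ :=
  ((μ.rowLen c.1 : ℤ) - c.2 - 1) + ((μ.colLen c.2 : ℤ) - c.1 - 1) + 1

/-- The quantity which in terms of `1`-based indices `i, j` is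
`λ_i + λ_j - i - j` if `i ≤ j`, and `-λ'_i - λ'_j + i + j - 2` if `i > j`.
Here the box `c` is `0`-based, so `i = c.1 + 1` and `j = c.2 + 1`. -/
def dExp (μ : YoungDiagram) (c : ℕ × ℕ) : ℤ :=
  if c.1 ≤ c.2 then
    (μ.rowLen c.1 : ℤ) + μ.rowLen c.2 - (c.1 + 1) - (c.2 + 1)
  else
    -(μ.colLen c.1 : ℤ) - μ.colLen c.2 + (c.1 + 1) + (c.2 + 1) - 2

/-- `d_λ = ∏_{(i,j) ∈ λ} [N + d(i,j)] / [h(i,j)]`. -/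
noncomputable def dWeight (N : ℤ) (q : ℂ) (μ : YoungDiagram) : ℂ :=
  ∏ c ∈ μ.cells, qNum q (N + dExp μ c) / qNum q (hook μ c)

/-- The labelling set `Λ(N, ℓ)`; `rowLen 0`, `rowLen 1` are `λ_1`, `λ_2` and
`colLen 0`, `colLen 1` are `λ'_1`, `λ'_2`. The bounds `λ_1 ≤ (ℓ - N) / 2` and
`λ_1 ≤ |N| / 2` are written without division. -/
def diagrams (N : ℤ) (ℓ : ℕ) : Set YoungDiagram :=
  {μ |
    if 0 < N then
      (μ.colLen 0 : ℤ) + μ.colLen 1 ≤ N ∧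
        (if Even ((ℓ : ℤ) - N) then 2 * (μ.rowLen 0 : ℤ) ≤ ℓ - N
          else (μ.rowLen 0 : ℤ) + μ.rowLen 1 ≤ ℓ - N)
    else
      (if Even N then 2 * (μ.rowLen 0 : ℤ) ≤ |N|
        else (μ.rowLen 0 : ℤ) + μ.rowLen 1 ≤ |N|) ∧
        (μ.colLen 0 : ℤ) + μ.colLen 1 ≤ ℓ - |N|}

/-- `Λ(N, ℓ)_ev`: the diagrams in `Λ(N, ℓ)` with an even number of boxes. -/
def evenDiagrams (N : ℤ) (ℓ : ℕ) : Set YoungDiagram :=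
  {μ | μ ∈ diagrams N ℓ ∧ Even μ.card}

/-- The rank `k`, where `|N| = 2k` or `|N| = 2k + 1`. -/
def rk (N : ℤ) : ℕ := N.natAbs / 2

/-- `b(N) = 2` if `N > 0` is even, and `b(N) = 1` otherwise. -/
def bConst (N : ℤ) : ℕ := if 0 < N ∧ Even N then 2 else 1

/-- The vector `((|N| + 1) / 2 - i)_{1 ≤ i ≤ k}`, with `i` shifted to start from `0`. -/
noncomputable def rhoCheck (N : ℤ) : Fin (rk N) → ℝ :=
  fun i => (|(N : ℝ)| + 1) / 2 - ((i : ℝ) + 1)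

/-- The standard basis vector `φ_i` of `ℝ^k`. -/
def phi {k : ℕ} (i : Fin k) : Fin k → ℝ := Pi.single i 1

/-- The positive roots, in the standard coordinates on `ℝ^k`, of `so_N` if `N > 0` and of
`sp_{|N|}` if `N < 0` is even:
* `φ_i ± φ_j` with `i < j` (type `D_k`) for `so_{2k}`;
* these together with the `φ_i` (type `B_k`) for `so_{2k+1}`;
* these together with the `2 φ_i` (type `C_k`) for `sp_{2k}`. -/
def posRoots (N : ℤ) : Set (Fin (rk N) → ℝ) :=
  {α | (∃ i j, i < j ∧ (α = phi i - phi j ∨ α = phi i + phi j)) ∨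
    (0 < N ∧ Odd N ∧ ∃ i, α = phi i) ∨
    (N < 0 ∧ Even N ∧ ∃ i, α = (2 : ℝ) • phi i)}

end SquareSum

namespace SquareSum

/-! Squaring removes `q`: since `(q^n - q^(-n))² = -4 sin²(nπ/ℓ)`, the number `d_λ²` is the product
defining `d_λ` with `[n]` replaced by `g n = sinSq ℓ n` (`dWeight_sq`).

The exponents `d(i,j)` are sums of two row beads or of two column holes, the hook lengths are
differences of a bead and a hole, and beads and holes are complementary. Numerator and denominator
therefore rearrange: up to a constant `Z`, the weight becomes the product over `i < j` of `g(x_i -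
x_j) g(x_i + x_j + δ)` times one factor for each shifted row `x_i` (shifted column if `N < 0`). This
is Weyl's dimension formula in another form: `gWeight_odd`, `gWeight_even_of_lt`,
`gWeight_even_of_eq`, `gWeight_neg`. The pair product is a squared Vandermonde determinant in `2
cos((2x + δ)π/ℓ)`.

Let `T = N` if `N > 0` and `T = ℓ - |N|` if `N < 0`. Replacing a first column of length `m` by one
of length `T - m` preserves the weight (`gWeight_flipCol`, `gWeight_neg_flipCol`) and changes the
parity of the number of boxes exactly when `T` is odd. The sum over even diagrams thus becomes one
over the diagrams in a box, that is, over strictly decreasing sequences of nodes. For even `T` the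
parity condition survives, but the alternating sum vanishes, so the even diagrams contribute half of
the total.

Andréief's identity (`sum_strictAnti_det_sq`) turns the sum over sequences into the Gram determinant
of Chebyshev-type functions. These are orthogonal on the nodes with squared norm `ℓ`, provided one
end node has weight `1/2` when `ℓ` is even; so the determinant is `ℓ^k`. Finally `Z` is the product
of the `4 sin²((α, ρ̌)π/ℓ)` over the positive roots (`pairFactor_mul_short`, `pairFactor_mul_long`,
`pairFactor_succ`). -/

open Finset

/-! ### Beads, holes and hook lengths -/

/-- The bead `λ_i - i` of a row; the argument `i` is `0`-based. -/
def rowBead (μ : YoungDiagram) (i : ℕ) : ℤ := μ.rowLen i - i - 1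

/-- The hole `j - 1 - λ'_j` of a column; the argument `j` is `0`-based. -/
def colBead (μ : YoungDiagram) (j : ℕ) : ℤ := j - μ.colLen j

theorem lt_rowLen_iff_lt_colLen (μ : YoungDiagram) (i j : ℕ) :
    j < μ.rowLen i ↔ i < μ.colLen j := by
  rw [← YoungDiagram.mem_iff_lt_rowLen, YoungDiagram.mem_iff_lt_colLen]

theorem rowLen_eq_zero_iff (μ : YoungDiagram) (i : ℕ) : μ.rowLen i = 0 ↔ μ.colLen 0 ≤ i := by
  have := lt_rowLen_iff_lt_colLen μ i 0
  omega

theorem rowLen_eq_of_forall {μ : YoungDiagram} {i n : ℕ} (h : ∀ j, (i, j) ∈ μ ↔ j < n) :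
    μ.rowLen i = n := by
  have h1 := h n
  have h2 := h (μ.rowLen i)
  rw [YoungDiagram.mem_iff_lt_rowLen] at h1 h2
  omega

theorem colLen_eq_of_forall {μ : YoungDiagram} {j n : ℕ} (h : ∀ i, (i, j) ∈ μ ↔ i < n) :
    μ.colLen j = n := by
  have h1 := h n
  have h2 := h (μ.colLen j)
  rw [YoungDiagram.mem_iff_lt_colLen] at h1 h2
  omega

theorem rowBead_ne_colBead (μ : YoungDiagram) (i j : ℕ) : rowBead μ i ≠ colBead μ j := by
  have := lt_rowLen_iff_lt_colLen μ i j
  unfold rowBead colBead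
  omega

theorem rowBead_strictAnti (μ : YoungDiagram) : StrictAnti (rowBead μ) := by
  intro i j hij
  have := μ.rowLen_anti i j hij.le
  unfold rowBead
  omega

theorem colBead_strictMono (μ : YoungDiagram) : StrictMono (colBead μ) := by
  intro i j hij
  have := μ.colLen_anti i j hij.le
  unfold colBead
  omega

/-- The beads of the rows below, and the holes of the columns left of, a point `(r, s)` of the
boundary of a Young diagram fill an interval. -/
theorem sum_rowBead_add_sum_colBead (μ : YoungDiagram) {r s M : ℕ} (hrM : r ≤ M)
    (hM : μ.colLen 0 ≤ M) (hcol : ∀ j < s, r ≤ μ.colLen j) (hrow : μ.rowLen r ≤ s) (f : ℤ → ℤ) :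
    ∑ i ∈ Ico r M, f (rowBead μ i) + ∑ j ∈ range s, f (colBead μ j) =
      ∑ u ∈ Ico (-(M : ℤ)) (s - r), f u := by
  have hdisj : Disjoint ((Ico r M).image (rowBead μ)) ((range s).image (colBead μ)) := by
    rw [Finset.disjoint_left]
    intro u hu hu'
    obtain ⟨i, -, rfl⟩ := mem_image.1 hu
    obtain ⟨j, -, h⟩ := mem_image.1 hu'
    exact rowBead_ne_colBead μ i j h.symm
  -- Beads and holes are distinct and lie in the interval, and their number `(M - r) + s` is its
  -- length.
  have hunion : (Ico r M).image (rowBead μ) ∪ (range s).image (colBead μ) =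
      Ico (-(M : ℤ)) (s - r) := by
    apply Finset.eq_of_subset_of_card_le
    · intro u hu
      rw [mem_union, mem_image, mem_image] at hu
      rw [mem_Ico]
      obtain ⟨i, hi, rfl⟩ | ⟨j, hj, rfl⟩ := hu
      · rw [mem_Ico] at hi
        have := μ.rowLen_anti r i hi.1
        unfold rowBead
        omega
      · rw [mem_range] at hj
        have h1 := hcol j hj
        have h2 := μ.colLen_anti 0 j (Nat.zero_le _)
        unfold colBead
        omega
    · rw [card_union_of_disjoint hdisj, card_image_of_injective _ (rowBead_strictAnti μ).injective,
        card_image_of_injective _ (colBead_strictMono μ).injective]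
      simp
      omega
  rw [← hunion, sum_union hdisj, sum_image (rowBead_strictAnti μ).injective.injOn,
    sum_image (colBead_strictMono μ).injective.injOn]

theorem sum_Ico_int_sub (F : ℤ → ℤ) {a b : ℤ} (h : a ≤ b) :
    ∑ u ∈ Ico a b, (F (u + 1) - F u) = F b - F a := by
  induction b, h using Int.leInduction with
  | base => simp
  | succ n hn ih =>
    rw [← Finset.insert_Ico_right_eq_Ico_add_one hn, sum_insert (by simp), ih]
    ring

theorem dExp_eq (μ : YoungDiagram) (i j : ℕ) :
    dExp μ (i, j) =
      if i ≤ j then rowBead μ i + rowBead μ j else colBead μ i + colBead μ j := by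
  unfold dExp rowBead colBead
  split_ifs <;> ring

theorem hook_eq (μ : YoungDiagram) (i j : ℕ) :
    hook μ (i, j) = rowBead μ i - colBead μ j := by
  unfold hook rowBead colBead
  ring

theorem sum_cells (μ : YoungDiagram) {M : ℕ} (hM : μ.colLen 0 ≤ M) (F : ℕ × ℕ → ℤ) :
    ∑ c ∈ μ.cells, F c = ∑ i ∈ range M, ∑ j ∈ range (μ.rowLen i), F (i, j) := by
  rw [Finset.sum_finset_product μ.cells (range M) (fun i => range (μ.rowLen i))]
  rintro ⟨i, j⟩
  rw [YoungDiagram.mem_cells, YoungDiagram.mem_iff_lt_rowLen, mem_range, mem_range]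
  dsimp only
  have := lt_rowLen_iff_lt_colLen μ i j
  have := μ.colLen_anti 0 j (Nat.zero_le _)
  omega

/-- The hook lengths of a diagram with at most `M` rows. -/
theorem sum_hook (μ : YoungDiagram) {M : ℕ} (hM : μ.colLen 0 ≤ M) (f : ℤ → ℤ) :
    ∑ c ∈ μ.cells, f (hook μ c) + ∑ i ∈ range M, ∑ l ∈ Ico (i + 1) M, f (rowBead μ i - rowBead μ l) =
      ∑ i ∈ range M, ∑ u ∈ Ico (1 : ℤ) (μ.rowLen i + M - i), f u := by
  rw [sum_cells μ hM, ← sum_add_distrib]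
  refine sum_congr rfl fun i hi => ?_
  rw [mem_range] at hi
  -- The boundary is cut at the end of row `i`. The holes to the left give the hooks of the row, the
  -- beads below give the differences, and `u ↦ rowBead μ i - u` carries the interval to `1, …, λ_i
  -- + M - i - 1`.
  have h := sum_rowBead_add_sum_colBead μ (r := i + 1) (s := μ.rowLen i) (M := M) hi hM
    (fun j hj => (lt_rowLen_iff_lt_colLen μ i j).1 hj) (μ.rowLen_anti i (i + 1) (Nat.le_succ i))
    (fun u => f (rowBead μ i - u))
  simp only [hook_eq]
  rw [add_comm, h]
  refine sum_nbij' (fun u => rowBead μ i - u) (fun u => rowBead μ i - u) ?_ ?_ ?_ ?_ ?_ <;>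
    simp only [mem_Ico, rowBead] <;> intros <;> first | trivial | omega

/-! ### Adding a box -/

/-- `ν` arises from `μ` by adding the box `(a, b)`. -/
structure AddBox (μ ν : YoungDiagram) (a b : ℕ) : Prop where
  mem_iff : ∀ i j, (i, j) ∈ ν ↔ (i = a ∧ j = b) ∨ (i, j) ∈ μ
  notMem : (a, b) ∉ μ

namespace AddBox

variable {μ ν : YoungDiagram} {a b : ℕ}

theorem rowLen_left (h : AddBox μ ν a b) : μ.rowLen a = b := by
  have h1 := h.notMem
  rw [YoungDiagram.mem_iff_lt_rowLen] at h1
  by_contra hne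
  have h2 : (a, μ.rowLen a) ∈ ν :=
    ν.up_left_mem le_rfl (by omega) ((h.mem_iff a b).2 (Or.inl ⟨rfl, rfl⟩))
  rw [h.mem_iff, YoungDiagram.mem_iff_lt_rowLen] at h2
  omega

theorem colLen_left (h : AddBox μ ν a b) : μ.colLen b = a := by
  have h1 := h.notMem
  rw [YoungDiagram.mem_iff_lt_colLen] at h1
  by_contra hne
  have h2 : (μ.colLen b, b) ∈ ν :=
    ν.up_left_mem (by omega) le_rfl ((h.mem_iff a b).2 (Or.inl ⟨rfl, rfl⟩))
  rw [h.mem_iff, YoungDiagram.mem_iff_lt_colLen] at h2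
  omega

theorem rowLen_right (h : AddBox μ ν a b) (i : ℕ) :
    ν.rowLen i = μ.rowLen i + if i = a then 1 else 0 := by
  apply rowLen_eq_of_forall
  intro j
  rw [h.mem_iff, YoungDiagram.mem_iff_lt_rowLen]
  have := h.rowLen_left
  split_ifs with hi
  · subst hi
    omega
  · omega

theorem colLen_right (h : AddBox μ ν a b) (j : ℕ) :
    ν.colLen j = μ.colLen j + if j = b then 1 else 0 := by
  apply colLen_eq_of_forall
  intro i
  rw [h.mem_iff, YoungDiagram.mem_iff_lt_colLen]
  have := h.colLen_left
  split_ifs with hj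
  · subst hj
    omega
  · omega

theorem rowBead_left (h : AddBox μ ν a b) : rowBead μ a = b - a - 1 := by
  rw [rowBead, h.rowLen_left]

theorem colBead_left (h : AddBox μ ν a b) : colBead μ b = b - a := by
  rw [colBead, h.colLen_left]

theorem rowBead_self (h : AddBox μ ν a b) : rowBead ν a = b - a := by
  rw [rowBead, h.rowLen_right, h.rowLen_left, if_pos rfl]
  push_cast
  ring

theorem colBead_self (h : AddBox μ ν a b) : colBead ν b = b - a - 1 := by
  rw [colBead, h.colLen_right, h.colLen_left, if_pos rfl]
  push_cast
  ring

theorem rowBead_of_ne (h : AddBox μ ν a b) {i : ℕ} (hi : i ≠ a) : rowBead ν i = rowBead μ i := by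
  rw [rowBead, h.rowLen_right, if_neg hi, rowBead, add_zero]

theorem colBead_of_ne (h : AddBox μ ν a b) {j : ℕ} (hj : j ≠ b) : colBead ν j = colBead μ j := by
  rw [colBead, h.colLen_right, if_neg hj, colBead, add_zero]

theorem sum_cells_right (h : AddBox μ ν a b) (F : ℕ × ℕ → ℤ) :
    ∑ c ∈ ν.cells, F c = F (a, b) + ∑ c ∈ μ.cells, F c := by
  have : ν.cells = insert (a, b) μ.cells := by
    ext ⟨i, j⟩
    rw [YoungDiagram.mem_cells, h.mem_iff, mem_insert, YoungDiagram.mem_cells, Prod.mk.injEq]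
  rw [this, sum_insert]
  rw [YoungDiagram.mem_cells]
  exact h.notMem

theorem card_right (h : AddBox μ ν a b) : ν.card = μ.card + 1 := by
  have := h.sum_cells_right (fun _ => 1)
  simp only [sum_const, nsmul_eq_mul, mul_one] at this
  unfold YoungDiagram.card
  omega

/-- Only the bead of row `a` and the hole of column `b` move. On or above the diagonal that bead is
used by the boxes `(min a i, max a i)` with `i < b`. Column `b` has only `a ≤ b` boxes, so below the
diagonal the hole is used in row `b` alone. -/
theorem sum_dExp_sub_of_le (h : AddBox μ ν a b) (hab : a ≤ b) (f : ℤ → ℤ) :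
    ∑ c ∈ μ.cells, (f (dExp ν c) - f (dExp μ c)) =
      ∑ i ∈ range b, (f (rowBead ν a + rowBead ν i) - f (rowBead μ a + rowBead μ i)) +
      ∑ j ∈ range (μ.rowLen b),
        (f (colBead ν b + colBead ν j) - f (colBead μ b + colBead μ j)) := by
  have hr := h.rowLen_left
  have hc := h.colLen_left
  have hbb : μ.rowLen b ≤ b := by
    have := μ.rowLen_anti a b hab
    omega
  set A : Finset (ℕ × ℕ) := (range b).image (fun i => (min a i, max a i)) with hA
  set B : Finset (ℕ × ℕ) := (range (μ.rowLen b)).image (fun j => (b, j)) with hB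
  have hdisj : Disjoint A B := by
    rw [Finset.disjoint_left]
    intro c hcA hcB
    obtain ⟨i, hi, rfl⟩ := mem_image.1 hcA
    obtain ⟨j, hj, h'⟩ := mem_image.1 hcB
    rw [Prod.mk.injEq] at h'
    rw [mem_range] at hi hj
    omega
  have hsub : A ∪ B ⊆ μ.cells := by
    intro c hc'
    rw [YoungDiagram.mem_cells]
    rcases mem_union.1 hc' with hc' | hc'
    · obtain ⟨i, hi, rfl⟩ := mem_image.1 hc'
      rw [mem_range] at hi
      rcases lt_or_ge i a with hia | hia
      · rw [min_eq_right hia.le, max_eq_left hia.le]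
        exact μ.up_left_mem le_rfl hab (YoungDiagram.mem_iff_lt_colLen.2 (by omega))
      · rw [min_eq_left hia, max_eq_right hia]
        exact YoungDiagram.mem_iff_lt_rowLen.2 (by omega)
    · obtain ⟨j, hj, rfl⟩ := mem_image.1 hc'
      exact YoungDiagram.mem_iff_lt_rowLen.2 (mem_range.1 hj)
  rw [← sum_subset hsub, sum_union hdisj, sum_image, sum_image]
  · congr 1
    · refine sum_congr rfl fun i _ => ?_
      rw [dExp_eq, dExp_eq, if_pos (by omega), if_pos (by omega)]
      rcases le_total a i with hia | hia
      · rw [min_eq_left hia, max_eq_right hia]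
      · rw [min_eq_right hia, max_eq_left hia, add_comm, add_comm (rowBead μ i)]
    · refine sum_congr rfl fun j hj => ?_
      rw [mem_range] at hj
      rw [dExp_eq, dExp_eq, if_neg (by omega), if_neg (by omega)]
  · intro x _ y _ hxy
    exact (Prod.mk.inj hxy).2
  · intro x _ y _ hxy
    have := Prod.mk.inj hxy
    omega
  · rintro ⟨i, j⟩ hij hnot
    rw [YoungDiagram.mem_cells] at hij
    have hij1 := YoungDiagram.mem_iff_lt_rowLen.1 hij
    have hij2 := YoungDiagram.mem_iff_lt_colLen.1 hij
    rw [mem_union, not_or] at hnot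
    obtain ⟨hnA, hnB⟩ := hnot
    rw [sub_eq_zero, dExp_eq, dExp_eq]
    split_ifs with hle
    · have hia : i ≠ a := by
        rintro rfl
        exact hnA (mem_image.2 ⟨j, mem_range.2 (by omega), by
          rw [min_eq_left hle, max_eq_right hle]⟩)
      have hja : j ≠ a := by
        rintro rfl
        exact hnA (mem_image.2 ⟨i, mem_range.2 (by omega), by
          rw [min_eq_right hle, max_eq_left hle]⟩)
      rw [h.rowBead_of_ne hia, h.rowBead_of_ne hja]
    · have hib : i ≠ b := by
        rintro rfl
        exact hnB (mem_image.2 ⟨j, mem_range.2 hij1, rfl⟩)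
      have hjb : j ≠ b := by
        rintro rfl
        omega
      rw [h.colBead_of_ne hib, h.colBead_of_ne hjb]

/-- Row `a` ends to the left of the diagonal, so its bead is used in column `a` alone. The hole of
column `b` is used by the boxes `(max b i, min b i)`; `i = b` is left out because a diagonal box
uses beads. -/
theorem sum_dExp_sub_of_lt (h : AddBox μ ν a b) (hab : b < a) (f : ℤ → ℤ) :
    ∑ c ∈ μ.cells, (f (dExp ν c) - f (dExp μ c)) =
      ∑ i ∈ range (μ.colLen a),
        (f (rowBead ν a + rowBead ν i) - f (rowBead μ a + rowBead μ i)) +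
      ∑ j ∈ (range a).erase b,
        (f (colBead ν b + colBead ν j) - f (colBead μ b + colBead μ j)) := by
  have hr := h.rowLen_left
  have hc := h.colLen_left
  have hbb : μ.colLen a ≤ a := by
    have := μ.colLen_anti b a hab.le
    omega
  set A : Finset (ℕ × ℕ) := (range (μ.colLen a)).image (fun i => (i, a)) with hA
  set B : Finset (ℕ × ℕ) := ((range a).erase b).image (fun i => (max b i, min b i)) with hB
  have hdisj : Disjoint A B := by
    rw [Finset.disjoint_left]
    intro c hcA hcB
    obtain ⟨i, hi, rfl⟩ := mem_image.1 hcA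
    obtain ⟨j, hj, h'⟩ := mem_image.1 hcB
    rw [Prod.mk.injEq] at h'
    rw [mem_erase, mem_range] at hj
    rw [mem_range] at hi
    omega
  have hsub : A ∪ B ⊆ μ.cells := by
    intro c hc'
    rw [YoungDiagram.mem_cells]
    rcases mem_union.1 hc' with hc' | hc'
    · obtain ⟨j, hj, rfl⟩ := mem_image.1 hc'
      exact YoungDiagram.mem_iff_lt_colLen.2 (mem_range.1 hj)
    · obtain ⟨i, hi, rfl⟩ := mem_image.1 hc'
      rw [mem_erase, mem_range] at hi
      rcases lt_or_ge i b with hia | hia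
      · rw [min_eq_right hia.le, max_eq_left hia.le]
        exact μ.up_left_mem le_rfl hia.le (YoungDiagram.mem_iff_lt_colLen.2 (by omega))
      · rw [min_eq_left hia, max_eq_right hia]
        exact YoungDiagram.mem_iff_lt_colLen.2 (by omega)
  rw [← sum_subset hsub, sum_union hdisj, sum_image, sum_image]
  · congr 1
    · refine sum_congr rfl fun i hi => ?_
      rw [mem_range] at hi
      rw [dExp_eq, dExp_eq, if_pos (by omega), if_pos (by omega), add_comm,
        add_comm (rowBead μ i)]
    · refine sum_congr rfl fun i hi => ?_
      rw [mem_erase, mem_range] at hi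
      rw [dExp_eq, dExp_eq, if_neg (by omega), if_neg (by omega)]
      rcases le_total b i with hia | hia
      · rw [min_eq_left hia, max_eq_right hia, add_comm, add_comm (colBead μ i)]
      · rw [min_eq_right hia, max_eq_left hia]
  · intro x _ y _ hxy
    have := Prod.mk.inj hxy
    omega
  · intro x _ y _ hxy
    exact (Prod.mk.inj hxy).1
  · rintro ⟨i, j⟩ hij hnot
    rw [YoungDiagram.mem_cells] at hij
    have hij1 := YoungDiagram.mem_iff_lt_rowLen.1 hij
    have hij2 := YoungDiagram.mem_iff_lt_colLen.1 hij
    rw [mem_union, not_or] at hnot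
    obtain ⟨hnA, hnB⟩ := hnot
    rw [sub_eq_zero, dExp_eq, dExp_eq]
    split_ifs with hle
    · have hja : j ≠ a := by
        rintro rfl
        exact hnA (mem_image.2 ⟨i, mem_range.2 hij2, rfl⟩)
      have hia : i ≠ a := by
        rintro rfl
        omega
      rw [h.rowBead_of_ne hia, h.rowBead_of_ne hja]
    · have hib : i ≠ b := by
        rintro rfl
        exact hnB (mem_image.2 ⟨j, mem_erase.2 ⟨by omega, mem_range.2 (by omega)⟩, by
          rw [max_eq_left (by omega), min_eq_right (by omega)]⟩)
      have hjb : j ≠ b := by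
        rintro rfl
        exact hnB (mem_image.2 ⟨i, mem_erase.2 ⟨by omega, mem_range.2 (by omega)⟩, by
          rw [max_eq_right (by omega), min_eq_left (by omega)]⟩)
      rw [h.colBead_of_ne hib, h.colBead_of_ne hjb]

end AddBox

namespace AddBox

variable {μ ν : YoungDiagram} {a b : ℕ}

/-- The hole terms of the two preceding lemmas are traded for the beads below a boundary point by
`sum_rowBead_add_sum_colBead`, at the cost of a telescoping sum. Both sides of the diagonal then
give the same formula. -/
theorem sum_dExp_right_of_large (h : AddBox μ ν a b) {M : ℕ} (hM : ν.colLen 0 ≤ M) (hbM : b ≤ M)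
    (f : ℤ → ℤ) :
    ∑ c ∈ ν.cells, f (dExp ν c) = ∑ c ∈ μ.cells, f (dExp μ c) + f (b - a - 1 - M) +
      (f (2 * (b - a)) - f (2 * (b - a) - 1)) +
      ∑ i ∈ range M, (f (b - a + rowBead μ i) - f (b - a - 1 + rowBead μ i)) := by
  have hr := h.rowLen_left
  have hcl := h.colLen_left
  have haM : a < M := by
    refine lt_of_lt_of_le ?_ hM
    rw [← lt_rowLen_iff_lt_colLen, h.rowLen_right, if_pos rfl]
    omega
  have hMμ : μ.colLen 0 ≤ M := by
    have := h.colLen_right 0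
    omega
  set c : ℤ := b - a with hc
  set G : ℤ → ℤ := fun u => f (c + u) - f (c - 1 + u) with hG
  have hinterval : ∀ r s : ℕ, r ≤ M → ∑ u ∈ Ico (-(M : ℤ)) (s - r), G u =
      f (c - 1 + s - r) - f (c - 1 - M) := by
    intro r s hrs
    have := sum_Ico_int_sub (fun u => f (c - 1 + u)) (a := -(M : ℤ)) (b := s - r) (by omega)
    rw [show c - 1 + s - r = c - 1 + ((s : ℤ) - r) by ring,
      show c - 1 - (M : ℤ) = c - 1 + -(M : ℤ) by ring, ← this]
    refine sum_congr rfl fun u _ => ?_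
    rw [hG]
    simp only
    rw [show c + u = c - 1 + (u + 1) by ring]
  have hX : ∀ i, f (rowBead ν a + rowBead ν i) - f (rowBead μ a + rowBead μ i) =
      G (rowBead μ i) + if a = i then f (2 * c) - f (2 * c - 1) else 0 := by
    intro i
    rw [h.rowBead_self, h.rowBead_left, hG]
    split_ifs with hi
    · subst hi
      simp only
      rw [h.rowBead_self, h.rowBead_left, ← hc, show c + c = 2 * c by ring,
        show c + (c - 1) = 2 * c - 1 by ring]
      ring
    · rw [h.rowBead_of_ne (Ne.symm hi)]
      simp [hc]
  have hY : ∀ j, j ≠ b → f (colBead ν b + colBead ν j) - f (colBead μ b + colBead μ j) =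
      - G (colBead μ j) := by
    intro j hj
    rw [h.colBead_self, h.colBead_left, hG, h.colBead_of_ne hj]
    simp [hc]
  have hsplit : ∀ r ≤ M, ∑ i ∈ range M, G (rowBead μ i) =
      ∑ i ∈ range r, G (rowBead μ i) + ∑ i ∈ Ico r M, G (rowBead μ i) := fun r hr =>
    (sum_range_add_sum_Ico _ hr).symm
  have hdiff : ∑ c ∈ μ.cells, f (dExp ν c) = ∑ c ∈ μ.cells, f (dExp μ c) +
      ∑ c ∈ μ.cells, (f (dExp ν c) - f (dExp μ c)) := by
    rw [sum_sub_distrib]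
    ring
  rw [h.sum_cells_right, hdiff, dExp_eq]
  change _ = _ + ∑ i ∈ range M, G (rowBead μ i)
  rcases le_or_gt a b with hab | hab
  · have hbb : μ.rowLen b ≤ b := by
      have := μ.rowLen_anti a b hab
      omega
    rw [h.sum_dExp_sub_of_le hab, if_pos hab, hsplit b hbM]
    -- The cut is at the end of row `b`, which requires `b ≤ M`.
    have h1 := sum_rowBead_add_sum_colBead μ (r := b) (s := μ.rowLen b) hbM hMμ
      (fun j hj => ((lt_rowLen_iff_lt_colLen μ b j).1 hj).le) le_rfl G
    rw [hinterval b _ hbM] at h1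
    rw [sum_congr rfl (fun i _ => hX i), sum_add_distrib, sum_ite_eq,
      sum_congr rfl (fun j hj => hY j (by rw [mem_range] at hj; omega)), sum_neg_distrib,
      h.rowBead_self]
    rcases hab.lt_or_eq with hlt | heq
    · rw [if_pos (mem_range.2 hlt), h.rowBead_of_ne hlt.ne', ← hc,
        show c + rowBead μ b = c - 1 + μ.rowLen b - b by rw [rowBead]; ring]
      linarith
    · subst heq
      have hc0 : c = 0 := by rw [hc]; ring
      rw [if_neg (by simp), h.rowBead_self, ← hc, hc0, hr]
      rw [hc0, hr, show (0 : ℤ) - 1 + a - a = -1 by ring] at h1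
      simp only [mul_zero, zero_sub, add_zero] at h1 ⊢
      linarith
  · have hbb : μ.colLen a ≤ a := by
      have := μ.colLen_anti b a hab.le
      omega
    rw [h.sum_dExp_sub_of_lt hab, if_neg (by omega),
      hsplit (μ.colLen a) (by omega)]
    have h1 := sum_rowBead_add_sum_colBead μ (r := μ.colLen a) (s := a) (by omega) hMμ
      (fun j hj => μ.colLen_anti j a hj.le)
      (by have := lt_rowLen_iff_lt_colLen μ (μ.colLen a) a; omega) G
    rw [hinterval _ a (by omega), ← add_sum_erase _ _ (mem_range.2 hab), h.colBead_left] at h1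
    have hGc : G c = f (2 * c) - f (2 * c - 1) := by
      rw [hG]
      simp only
      rw [show c + c = 2 * c by ring, show c - 1 + c = 2 * c - 1 by ring]
    rw [← hc, hGc] at h1
    have hX' : ∀ i ∈ range (μ.colLen a),
        f (rowBead ν a + rowBead ν i) - f (rowBead μ a + rowBead μ i) = G (rowBead μ i) := by
      intro i hi
      rw [mem_range] at hi
      rw [hX, if_neg (by omega), add_zero]
    rw [sum_congr rfl hX', sum_congr rfl (fun j hj => hY j (mem_erase.1 hj).1), sum_neg_distrib,
      h.colBead_self, h.colBead_of_ne (by omega), ← hc,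
      show colBead μ a + (c - 1) = c - 1 + a - μ.colLen a by rw [colBead]; ring]
    linarith

/-- The effect of adding a box on the exponents `d(i, j)`, in terms of the rows. -/
theorem sum_dExp_right (h : AddBox μ ν a b) {M : ℕ} (hM : ν.colLen 0 ≤ M) (f : ℤ → ℤ) :
    ∑ c ∈ ν.cells, f (dExp ν c) = ∑ c ∈ μ.cells, f (dExp μ c) + f (b - a - 1 - M) +
      (f (2 * (b - a)) - f (2 * (b - a) - 1)) +
      ∑ i ∈ range M, (f (b - a + rowBead μ i) - f (b - a - 1 + rowBead μ i)) := by
  -- Taking `M + b` rows secures the bound on `b`; the surplus rows are empty, with beads `-(i +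
  -- 1)`, and their terms telescope.
  rw [h.sum_dExp_right_of_large (M := M + b) (by omega) (by omega)]
  have key : ∀ n : ℕ, f (b - a - 1 - (M + n : ℕ)) +
      ∑ i ∈ range (M + n), (f (b - a + rowBead μ i) - f (b - a - 1 + rowBead μ i)) =
      f (b - a - 1 - M) +
      ∑ i ∈ range M, (f (b - a + rowBead μ i) - f (b - a - 1 + rowBead μ i)) := by
    intro n
    induction n with
    | zero => simp
    | succ n ih =>
      rw [← ih, ← add_assoc, sum_range_succ]
      have h0 : μ.rowLen (M + n) = 0 := by
        rw [rowLen_eq_zero_iff]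
        have := h.colLen_right 0
        omega
      rw [rowBead, h0]
      push_cast
      rw [show (b - a + (0 - (M + n : ℤ) - 1) : ℤ) = b - a - 1 - (M + n) by ring,
        show (b - a - 1 + (0 - (M + n : ℤ) - 1) : ℤ) = b - a - 1 - (M + n + 1) by ring]
      ring
  have := key b
  linarith

/-- The effect of adding a box on the exponents `d(i, j)`, in terms of the columns. -/
theorem sum_dExp_right' (h : AddBox μ ν a b) {L : ℕ} (hL : ν.rowLen 0 ≤ L) (f : ℤ → ℤ) :
    ∑ c ∈ ν.cells, f (dExp ν c) = ∑ c ∈ μ.cells, f (dExp μ c) + f (b - a - 1 + L) +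
      (f (2 * (b - a)) - f (2 * (b - a) - 1)) -
      ∑ j ∈ range L, (f (b - a + colBead μ j) - f (b - a - 1 + colBead μ j)) := by
  rw [h.sum_dExp_right le_rfl]
  set c : ℤ := b - a with hc
  set M := ν.colLen 0 with hM
  have hMμ : μ.colLen 0 ≤ M := by
    have := h.colLen_right 0
    omega
  have h1 := sum_rowBead_add_sum_colBead μ (r := 0) (s := L) (M := M) (Nat.zero_le _) hMμ
    (fun j _ => Nat.zero_le _) (by have := h.rowLen_right 0; omega)
    (fun u => f (c + u) - f (c - 1 + u))
  have h2 := sum_Ico_int_sub (fun u => f (c - 1 + u)) (a := -(M : ℤ)) (b := L - (0 : ℕ)) (by omega)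
  have h3 : ∑ u ∈ Ico (-(M : ℤ)) (L - (0 : ℕ)), (f (c + u) - f (c - 1 + u)) =
      f (c - 1 + L) - f (c - 1 - M) := by
    rw [show c - 1 + (L : ℤ) = c - 1 + (L - (0 : ℕ)) by simp,
      show c - 1 - (M : ℤ) = c - 1 + -(M : ℤ) by ring, ← h2]
    refine sum_congr rfl fun u _ => ?_
    rw [show c + u = c - 1 + (u + 1) by ring]
  rw [h3, Nat.Ico_zero_eq_range] at h1
  linarith

end AddBox

/-! ### The multiset of the exponents `d(i,j)` -/

/-- Induction on the number of boxes. -/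
theorem addBox_induction {P : YoungDiagram → Prop} (h0 : P ⊥)
    (hadd : ∀ μ ν a b, AddBox μ ν a b → P μ → P ν) (ν : YoungDiagram) : P ν := by
  induction hn : ν.card generalizing ν with
  | zero =>
    have : ν = ⊥ := by
      ext c
      have : ν.cells = ∅ := card_eq_zero.1 hn
      rw [this]
      simp
    rwa [this]
  | succ n ih =>
    have hne : ν.colLen 0 ≠ 0 := by
      intro h
      have hemp : ν.cells = ∅ := by
        ext ⟨i, j⟩
        rw [YoungDiagram.mem_cells, YoungDiagram.mem_iff_lt_colLen]
        have := ν.colLen_anti 0 j (Nat.zero_le _)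
        simp
        omega
      rw [YoungDiagram.card, hemp] at hn
      simp at hn
    -- The end of the last row is always a removable corner.
    set a := ν.colLen 0 - 1 with ha
    have ha0 : ν.rowLen a ≠ 0 := by
      rw [Ne, rowLen_eq_zero_iff]
      omega
    set b := ν.rowLen a - 1 with hb
    have hmax : ∀ i j, (i, j) ∈ ν → a ≤ i → b ≤ j → i = a ∧ j = b := by
      intro i j hij hi hj
      have h1 := YoungDiagram.mem_iff_lt_colLen.1 hij
      have h2 := ν.colLen_anti 0 j (Nat.zero_le _)
      have hia : i = a := by omega
      subst hia
      have h3 := YoungDiagram.mem_iff_lt_rowLen.1 hij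
      omega
    let μ : YoungDiagram := ⟨ν.cells.erase (a, b), by
      rintro ⟨i, j⟩ ⟨i', j'⟩ hle hmem
      rw [Prod.mk_le_mk] at hle
      rw [mem_coe, mem_erase, YoungDiagram.mem_cells] at hmem ⊢
      refine ⟨fun heq => hmem.1 ?_, ν.up_left_mem hle.1 hle.2 hmem.2⟩
      rw [Prod.mk.injEq] at heq ⊢
      exact hmax i j hmem.2 (heq.1 ▸ hle.1) (heq.2 ▸ hle.2)⟩
    have hmemν : (a, b) ∈ ν := YoungDiagram.mem_iff_lt_rowLen.2 (by omega)
    have hmemμ : ∀ i j, (i, j) ∈ μ ↔ (i, j) ≠ (a, b) ∧ (i, j) ∈ ν := by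
      intro i j
      rw [← YoungDiagram.mem_cells, mem_erase, YoungDiagram.mem_cells]
    have hadd' : AddBox μ ν a b := by
      refine ⟨fun i j => ?_, fun h => ((hmemμ a b).1 h).1 rfl⟩
      rw [hmemμ, Ne, Prod.mk.injEq]
      refine ⟨fun h => ?_, ?_⟩
      · by_cases h' : i = a ∧ j = b
        · exact Or.inl h'
        · exact Or.inr ⟨h', h⟩
      · rintro (⟨rfl, rfl⟩ | h)
        · exact hmemν
        · exact h.2
    refine hadd μ ν a b hadd' (ih μ ?_)
    have := hadd'.card_right
    omega

theorem rowLen_bot (i : ℕ) : (⊥ : YoungDiagram).rowLen i = 0 :=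
  rowLen_eq_of_forall fun j => by simp

theorem colLen_bot (i : ℕ) : (⊥ : YoungDiagram).colLen i = 0 :=
  colLen_eq_of_forall fun j => by simp

theorem sum_range_eq_of_update {M a : ℕ} (ha : a < M) {x y : ℕ → ℤ}
    (hxy : ∀ i, i ≠ a → y i = x i) (F : ℤ → ℤ) :
    ∑ i ∈ range M, F (y i) = ∑ i ∈ range M, F (x i) + F (y a) - F (x a) := by
  rw [← add_sum_erase _ _ (mem_range.2 ha), ← add_sum_erase (range M) (fun i => F (x i))
    (mem_range.2 ha), sum_congr rfl (fun i hi => by rw [hxy i (mem_erase.1 hi).1])]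
  ring

theorem sum_sum_range_eq_of_update {M a : ℕ} (ha : a < M) {x y : ℕ → ℤ}
    (hxy : ∀ i, i ≠ a → y i = x i) (f : ℤ → ℤ) :
    ∑ i ∈ range M, ∑ j ∈ range M, f (y i + y j) = ∑ i ∈ range M, ∑ j ∈ range M, f (x i + x j) +
      2 * ∑ i ∈ range M, (f (y a + x i) - f (x a + x i)) +
      (f (2 * y a) - 2 * f (y a + x a) + f (2 * x a)) := by
  rw [sum_congr rfl (fun i _ => sum_range_eq_of_update ha hxy (fun u => f (y i + u))),
    sum_range_eq_of_update ha hxy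
      (fun v => ∑ j ∈ range M, f (v + x j) + f (v + y a) - f (v + x a))]
  simp only [sum_sub_distrib, sum_add_distrib, two_mul (y a), two_mul (x a),
    add_comm (x a) (y a)]
  simp only [fun i => add_comm (x i) (y a), fun i => add_comm (x i) (x a)]
  ring

/-- Doubling leads to a sum over all pairs of indices, in which the change of one bead is easy to
follow (`sum_sum_range_eq_of_update`). -/
theorem two_mul_sum_le (M : ℕ) (x : ℕ → ℤ) (f : ℤ → ℤ) :
    2 * ∑ i ∈ range M, ∑ j ∈ Ico i M, f (x i + x j) =
      ∑ i ∈ range M, ∑ j ∈ range M, f (x i + x j) + ∑ i ∈ range M, f (2 * x i) := by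
  induction M with
  | zero => simp
  | succ M ih =>
    have h1 : ∑ i ∈ range (M + 1), ∑ j ∈ Ico i (M + 1), f (x i + x j) =
        ∑ i ∈ range M, ∑ j ∈ Ico i M, f (x i + x j) + ∑ i ∈ range (M + 1), f (x i + x M) := by
      rw [sum_range_succ, sum_range_succ (fun i => f (x i + x M)), ← add_assoc,
        ← sum_add_distrib]
      congr 1
      · refine sum_congr rfl fun i hi => ?_
        rw [sum_Ico_succ_top (mem_range.1 hi).le]
      · simp
    rw [h1, mul_add, ih]
    simp only [sum_range_succ, sum_add_distrib]
    simp only [fun i => add_comm (x M) (x i), two_mul (x M)]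
    ring

theorem two_mul_sum_lt (M : ℕ) (x : ℕ → ℤ) (f : ℤ → ℤ) :
    2 * ∑ i ∈ range M, ∑ j ∈ Ico (i + 1) M, f (x i + x j) =
      ∑ i ∈ range M, ∑ j ∈ range M, f (x i + x j) - ∑ i ∈ range M, f (2 * x i) := by
  have h := two_mul_sum_le M x f
  have : ∑ i ∈ range M, ∑ j ∈ Ico i M, f (x i + x j) =
      ∑ i ∈ range M, f (2 * x i) + ∑ i ∈ range M, ∑ j ∈ Ico (i + 1) M, f (x i + x j) := by
    rw [← sum_add_distrib]
    refine sum_congr rfl fun i hi => ?_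
    rw [sum_eq_sum_Ico_succ_bot (mem_range.1 hi), two_mul]
  linarith

/-- The exponents `d(i, j)` of a diagram with at most `M` rows. -/
theorem sum_dExp (ν : YoungDiagram) {M : ℕ} (hM : ν.colLen 0 ≤ M) (f : ℤ → ℤ) :
    ∑ c ∈ ν.cells, f (dExp ν c) +
        ∑ i ∈ range M, ∑ j ∈ Ico i M, f (-(i + 1) + -(j + 1)) =
      ∑ i ∈ range M, ∑ j ∈ Ico i M, f (rowBead ν i + rowBead ν j) +
        ∑ i ∈ range M, ∑ t ∈ range (ν.rowLen i), f (t - i - 1 - M) := by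
  induction ν using addBox_induction with
  | h0 =>
    simp only [rowBead, rowLen_bot, YoungDiagram.cells_bot, sum_empty, range_zero, zero_add,
      sum_const_zero, add_zero]
    refine sum_congr rfl fun i _ => sum_congr rfl fun j _ => congrArg f ?_
    push_cast
    ring
  | hadd μ ν a b h ih =>
    have haM : a < M := by
      refine lt_of_lt_of_le ?_ hM
      rw [← lt_rowLen_iff_lt_colLen, h.rowLen_right, if_pos rfl]
      omega
    have ih' := ih (by have := h.colLen_right 0; omega)
    -- The bead of row `a` rises from `b - a - 1` to `b - a`. Both sides change by the same terms,
    -- and `f (b - a - 1 - M)` is the new last term of row `a` in the sum over `t`.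
    rw [h.sum_dExp_right hM]
    have h1 := two_mul_sum_le M (rowBead μ) f
    have h2 := two_mul_sum_le M (rowBead ν) f
    have h3 := sum_sum_range_eq_of_update haM (fun i hi => h.rowBead_of_ne hi) f
    have h4 := sum_range_eq_of_update haM (fun i hi => h.rowBead_of_ne hi) (fun u => f (2 * u))
    have h5 : ∑ i ∈ range M, ∑ t ∈ range (ν.rowLen i), f (t - i - 1 - M) =
        ∑ i ∈ range M, ∑ t ∈ range (μ.rowLen i), f (t - i - 1 - M) + f (b - a - 1 - M) := by
      rw [← add_sum_erase _ _ (mem_range.2 haM), ← add_sum_erase (range M)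
        (fun i => ∑ t ∈ range (μ.rowLen i), f (t - i - 1 - M)) (mem_range.2 haM),
        h.rowLen_right a, if_pos rfl, sum_range_succ, h.rowLen_left]
      have : ∀ i ∈ (range M).erase a, ∑ t ∈ range (ν.rowLen i), f (t - i - 1 - M) =
          ∑ t ∈ range (μ.rowLen i), f (t - i - 1 - M) := by
        intro i hi
        rw [h.rowLen_right i, if_neg (mem_erase.1 hi).1, add_zero]
      rw [sum_congr rfl this]
      ring
    rw [h.rowBead_self, h.rowBead_left] at h3 h4
    rw [show ((b : ℤ) - a + (b - a - 1)) = 2 * (b - a) - 1 by ring] at h3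
    linarith

/-- The exponents `d(i, j)` of a diagram with at most `L` columns. -/
theorem sum_dExp' (ν : YoungDiagram) {L : ℕ} (hL : ν.rowLen 0 ≤ L) (f : ℤ → ℤ) :
    ∑ c ∈ ν.cells, f (dExp ν c) + ∑ i ∈ range L, ∑ j ∈ Ico (i + 1) L, f (i + j) =
      ∑ i ∈ range L, ∑ j ∈ Ico (i + 1) L, f (colBead ν i + colBead ν j) +
        ∑ j ∈ range L, ∑ t ∈ range (ν.colLen j), f (j - t - 1 + L) := by
  induction ν using addBox_induction with
  | h0 =>
    simp [colBead, colLen_bot]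
  | hadd μ ν a b h ih =>
    have hbL : b < L := by
      refine lt_of_lt_of_le ?_ hL
      rw [lt_rowLen_iff_lt_colLen, h.colLen_right, if_pos rfl]
      omega
    have ih' := ih (by have := h.rowLen_right 0; omega)
    rw [h.sum_dExp_right' hL]
    have h1 := two_mul_sum_lt L (colBead μ) f
    have h2 := two_mul_sum_lt L (colBead ν) f
    have h3 := sum_sum_range_eq_of_update hbL (fun i hi => h.colBead_of_ne hi) f
    have h4 := sum_range_eq_of_update hbL (fun i hi => h.colBead_of_ne hi) (fun u => f (2 * u))
    have h5 : ∑ j ∈ range L, ∑ t ∈ range (ν.colLen j), f (j - t - 1 + L) =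
        ∑ j ∈ range L, ∑ t ∈ range (μ.colLen j), f (j - t - 1 + L) + f (b - a - 1 + L) := by
      rw [← add_sum_erase _ _ (mem_range.2 hbL), ← add_sum_erase (range L)
        (fun j => ∑ t ∈ range (μ.colLen j), f (j - t - 1 + L)) (mem_range.2 hbL),
        h.colLen_right b, if_pos rfl, sum_range_succ, h.colLen_left]
      have : ∀ j ∈ (range L).erase b, ∑ t ∈ range (ν.colLen j), f (j - t - 1 + L) =
          ∑ t ∈ range (μ.colLen j), f (j - t - 1 + L) := by
        intro j hj
        rw [h.colLen_right j, if_neg (mem_erase.1 hj).1, add_zero]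
      rw [sum_congr rfl this]
      ring
    rw [h.colBead_self, h.colBead_left] at h3 h4
    rw [show ((b : ℤ) - a - 1 + (b - a)) = 2 * (b - a) - 1 by ring] at h3
    simp only [sum_sub_distrib] at h3 ⊢
    linarith

/-! ### From identities of sums to identities of products -/

/-- Indicator functions `f` show that both families are the same multiset of integers. This is why
the identities above are proved for all `f`; they transfer to any `g`, also where it vanishes. -/
theorem prod_eq_of_forall_sum_eq {ι κ R : Type*} [CommMonoid R] (s : Finset ι) (t : Finset κ)
    (d : ι → ℤ) (e : κ → ℤ) (h : ∀ f : ℤ → ℤ, ∑ i ∈ s, f (d i) = ∑ j ∈ t, f (e j)) (g : ℤ → R) :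
    ∏ i ∈ s, g (d i) = ∏ j ∈ t, g (e j) := by
  have key : s.val.map d = t.val.map e := by
    ext x
    have := h (fun n => if x = n then 1 else 0)
    rw [sum_boole, sum_boole] at this
    rw [Multiset.count_map, Multiset.count_map]
    exact_mod_cast this
  have := congrArg (fun m => (m.map g).prod) key
  simp only [Multiset.map_map] at this
  exact this

theorem prod_mul_prod_eq_of_forall_sum_eq {ι₁ ι₂ ι₃ ι₄ R : Type*} [CommMonoid R]
    {s₁ : Finset ι₁} {s₂ : Finset ι₂} {s₃ : Finset ι₃} {s₄ : Finset ι₄}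
    {d₁ : ι₁ → ℤ} {d₂ : ι₂ → ℤ} {d₃ : ι₃ → ℤ} {d₄ : ι₄ → ℤ}
    (h : ∀ f : ℤ → ℤ, ∑ i ∈ s₁, f (d₁ i) + ∑ i ∈ s₂, f (d₂ i) =
      ∑ i ∈ s₃, f (d₃ i) + ∑ i ∈ s₄, f (d₄ i)) (g : ℤ → R) :
    (∏ i ∈ s₁, g (d₁ i)) * ∏ i ∈ s₂, g (d₂ i) =
      (∏ i ∈ s₃, g (d₃ i)) * ∏ i ∈ s₄, g (d₄ i) := by
  have := prod_eq_of_forall_sum_eq (s₁.disjSum s₂) (s₃.disjSum s₄) (Sum.elim d₁ d₂)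
    (Sum.elim d₃ d₄) (fun f => by simpa [sum_disjSum] using h f) g
  simpa [prod_disjSum] using this

theorem prod_mul_prod_eq_of_forall_sum_eq₃ {ι₁ ι₂ ι₃ ι₄ ι₅ R : Type*} [CommMonoid R]
    {s₁ : Finset ι₁} {s₂ : Finset ι₂} {s₃ : Finset ι₃} {s₄ : Finset ι₄} {s₅ : Finset ι₅}
    {d₁ : ι₁ → ℤ} {d₂ : ι₂ → ℤ} {d₃ : ι₃ → ℤ} {d₄ : ι₄ → ℤ} {d₅ : ι₅ → ℤ}
    (h : ∀ f : ℤ → ℤ, ∑ i ∈ s₁, f (d₁ i) + ∑ i ∈ s₂, f (d₂ i) =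
      ∑ i ∈ s₃, f (d₃ i) + ∑ i ∈ s₄, f (d₄ i) + ∑ i ∈ s₅, f (d₅ i)) (g : ℤ → R) :
    (∏ i ∈ s₁, g (d₁ i)) * ∏ i ∈ s₂, g (d₂ i) =
      (∏ i ∈ s₃, g (d₃ i)) * (∏ i ∈ s₄, g (d₄ i)) * ∏ i ∈ s₅, g (d₅ i) := by
  have := prod_mul_prod_eq_of_forall_sum_eq (s₁ := s₁) (s₂ := s₂) (s₃ := s₃.disjSum s₄) (s₄ := s₅)
    (d₁ := d₁) (d₂ := d₂) (d₃ := Sum.elim d₃ d₄) (d₄ := d₅)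
    (fun f => by simpa [sum_disjSum] using h f) g
  simpa [prod_disjSum] using this

theorem sum_Ico_one_eq_sum_range (n : ℕ) (f : ℤ → ℤ) :
    ∑ u ∈ Ico (1 : ℤ) (n + 1), f u = ∑ u ∈ range n, f (u + 1) := by
  refine (sum_nbij (fun u : ℕ => (u : ℤ) + 1) ?_ ?_ ?_ ?_).symm
  · intro u hu
    rw [mem_range] at hu
    rw [mem_Ico]
    omega
  · intro x _ y _ hxy
    simpa using hxy
  · intro u hu
    rw [mem_coe, mem_Ico] at hu
    refine ⟨(u - 1).toNat, ?_, ?_⟩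
    · rw [mem_coe, mem_range]
      omega
    · simp only
      omega
  · intro u _
    rfl

theorem sum_hook_range (μ : YoungDiagram) {M : ℕ} (hM : μ.colLen 0 ≤ M) (f : ℤ → ℤ) :
    ∑ c ∈ μ.cells, f (hook μ c) +
        ∑ i ∈ range M, ∑ l ∈ Ico (i + 1) M, f (rowBead μ i - rowBead μ l) =
      ∑ i ∈ range M, ∑ u ∈ range (μ.rowLen i + (M - 1 - i)), f (u + 1) := by
  rw [sum_hook μ hM]
  refine sum_congr rfl fun i hi => ?_
  rw [mem_range] at hi
  rw [← sum_Ico_one_eq_sum_range]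
  congr 2
  push_cast [Nat.cast_sub (show i ≤ M - 1 by omega), Nat.cast_sub (show 1 ≤ M by omega)]
  ring

theorem hook_transpose (μ : YoungDiagram) (i j : ℕ) :
    hook μ.transpose (j, i) = hook μ (i, j) := by
  simp only [hook, YoungDiagram.rowLen_transpose, YoungDiagram.colLen_transpose]
  ring

theorem sum_hook_transpose (μ : YoungDiagram) (f : ℤ → ℤ) :
    ∑ c ∈ μ.transpose.cells, f (hook μ.transpose c) = ∑ c ∈ μ.cells, f (hook μ c) := by
  refine sum_nbij' Prod.swap Prod.swap ?_ ?_ ?_ ?_ ?_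
  · intro c hc
    simpa using hc
  · intro c hc
    simpa using hc
  · simp
  · simp
  · rintro ⟨i, j⟩ _
    rw [hook_transpose]
    rfl

/-! ### Closed formulas for the weights -/

section

variable (g : ℤ → ℝ)

/-- The product `g(1) ⋯ g(n)`. -/
def gFactorial (n : ℕ) : ℝ := ∏ u ∈ range n, g (u + 1)

/-- The product of the quotients `g(N + d(i, j)) / g(h(i, j))`. -/
noncomputable def gWeight (N : ℤ) (μ : YoungDiagram) : ℝ :=
  ∏ c ∈ μ.cells, g (N + dExp μ c) / g (hook μ c)

/-- The product of the `g(p_i - p_j) g(p_i + p_j + δ)`. -/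
def pairProd (k : ℕ) (δ : ℤ) (p : ℕ → ℤ) : ℝ :=
  ∏ i ∈ range k, ∏ j ∈ Ico (i + 1) k, (g (p i - p j) * g (p i + p j + δ))

theorem prod_range_mul_gFactorial (a n : ℕ) :
    (∏ t ∈ range n, g (t + a + 1)) * gFactorial g a = gFactorial g (n + a) := by
  rw [gFactorial, gFactorial, add_comm n a, prod_range_add, mul_comm]
  congr 1
  refine prod_congr rfl fun t _ => ?_
  push_cast
  ring_nf

theorem gFactorial_succ (n : ℕ) : gFactorial g (n + 1) = gFactorial g n * g (n + 1) := by
  rw [gFactorial, prod_range_succ, gFactorial]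

theorem prod_hook_mul (μ : YoungDiagram) {M : ℕ} (hM : μ.colLen 0 ≤ M) :
    (∏ c ∈ μ.cells, g (hook μ c)) *
        ∏ i ∈ range M, ∏ l ∈ Ico (i + 1) M, g (rowBead μ i - rowBead μ l) =
      ∏ i ∈ range M, gFactorial g (μ.rowLen i + (M - 1 - i)) := by
  have := prod_mul_prod_eq_of_forall_sum_eq (R := ℝ)
    (s₁ := μ.cells) (d₁ := hook μ)
    (s₂ := (range M).sigma fun i => Ico (i + 1) M) (d₂ := fun x => rowBead μ x.1 - rowBead μ x.2)
    (s₃ := (range M).sigma fun i => range (μ.rowLen i + (M - 1 - i)))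
    (d₃ := fun x => (x.2 : ℤ) + 1) (s₄ := (∅ : Finset ℕ)) (d₄ := fun _ => 0)
    (fun f => by
      have := sum_hook_range μ hM f
      rw [sum_sigma', sum_sigma'] at this
      simpa using this) g
  rw [prod_sigma, prod_sigma] at this
  simpa [gFactorial] using this

theorem prod_dExp_mul (μ : YoungDiagram) {M : ℕ} (hM : μ.colLen 0 ≤ M) (N : ℤ) :
    (∏ c ∈ μ.cells, g (N + dExp μ c)) *
        ∏ i ∈ range M, ∏ j ∈ Ico i M, g (N + (-(i + 1) + -(j + 1))) =
      (∏ i ∈ range M, ∏ j ∈ Ico i M, g (N + (rowBead μ i + rowBead μ j))) *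
        ∏ i ∈ range M, ∏ t ∈ range (μ.rowLen i), g (N + (t - i - 1 - M)) := by
  have := prod_mul_prod_eq_of_forall_sum_eq (R := ℝ)
    (s₁ := μ.cells) (d₁ := dExp μ)
    (s₂ := (range M).sigma fun i => Ico i M)
    (d₂ := fun x => (-((x.1 : ℤ) + 1) + -((x.2 : ℤ) + 1)))
    (s₃ := (range M).sigma fun i => Ico i M)
    (d₃ := fun x => rowBead μ x.1 + rowBead μ x.2)
    (s₄ := (range M).sigma fun i => range (μ.rowLen i))
    (d₄ := fun x => (x.2 : ℤ) - x.1 - 1 - M)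
    (fun f => by
      have := sum_dExp μ hM f
      rw [sum_sigma', sum_sigma', sum_sigma'] at this
      exact this) (fun n => g (N + n))
  rw [prod_sigma, prod_sigma, prod_sigma] at this
  exact this

theorem prod_dExp_mul' (μ : YoungDiagram) {L : ℕ} (hL : μ.rowLen 0 ≤ L) (N : ℤ) :
    (∏ c ∈ μ.cells, g (N + dExp μ c)) *
        ∏ i ∈ range L, ∏ j ∈ Ico (i + 1) L, g (N + (i + j)) =
      (∏ i ∈ range L, ∏ j ∈ Ico (i + 1) L, g (N + (colBead μ i + colBead μ j))) *
        ∏ j ∈ range L, ∏ t ∈ range (μ.colLen j), g (N + (j - t - 1 + L)) := by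
  have := prod_mul_prod_eq_of_forall_sum_eq (R := ℝ)
    (s₁ := μ.cells) (d₁ := dExp μ)
    (s₂ := (range L).sigma fun i => Ico (i + 1) L)
    (d₂ := fun x => (x.1 : ℤ) + x.2)
    (s₃ := (range L).sigma fun i => Ico (i + 1) L)
    (d₃ := fun x => colBead μ x.1 + colBead μ x.2)
    (s₄ := (range L).sigma fun j => range (μ.colLen j))
    (d₄ := fun x => (x.1 : ℤ) - x.2 - 1 + L)
    (fun f => by
      have := sum_dExp' μ hL f
      rw [sum_sigma', sum_sigma', sum_sigma'] at this
      exact this) (fun n => g (N + n))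
  rw [prod_sigma, prod_sigma, prod_sigma] at this
  exact this

theorem gFactorial_ne_zero {ℓ n : ℕ} (hg : ∀ m : ℤ, 0 < m → m < ℓ → g m ≠ 0) (hn : n < ℓ) :
    gFactorial g n ≠ 0 := by
  refine prod_ne_zero_iff.2 fun u hu => hg _ (by omega) ?_
  rw [mem_range] at hu
  omega

/-- The weights for `N = 2k + 1` of the diagrams with at most `k` rows. -/
theorem gWeight_odd {ℓ k : ℕ} (hg : ∀ m : ℤ, 0 < m → m < ℓ → g m ≠ 0) (μ : YoungDiagram)
    (hk : μ.colLen 0 ≤ k) (hℓ : μ.rowLen 0 + k ≤ ℓ) :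
    gWeight g (2 * k + 1) μ * ((∏ i ∈ range k, ∏ j ∈ Ico i k, g (2 * k - 1 - i - j)) *
        ∏ i ∈ range k, gFactorial g (k - 1 - i)) =
      pairProd g k 1 (fun i => rowBead μ i + k) * ∏ i ∈ range k, g (2 * (rowBead μ i + k) + 1) := by
  have h1 := prod_dExp_mul g μ hk (2 * k + 1)
  have h2 := prod_hook_mul g μ hk
  -- With `N = 2k + 1` and `M = k` the row factors are the `g (t + (k - 1 - i) + 1)`. They extend
  -- `gFactorial g (k - 1 - i)` to the factorial of row `i` in `prod_hook_mul`.
  have h3 : (∏ i ∈ range k, ∏ t ∈ range (μ.rowLen i), g (2 * k + 1 + (t - i - 1 - k))) *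
      ∏ i ∈ range k, gFactorial g (k - 1 - i) =
      ∏ i ∈ range k, gFactorial g (μ.rowLen i + (k - 1 - i)) := by
    rw [← prod_mul_distrib]
    refine prod_congr rfl fun i hi => ?_
    rw [mem_range] at hi
    rw [← prod_range_mul_gFactorial]
    congr 1
    refine prod_congr rfl fun t _ => congrArg g ?_
    omega
  have h4 : ∏ i ∈ range k, ∏ j ∈ Ico i k, g (2 * k + 1 + (-(i + 1) + -(j + 1))) =
      ∏ i ∈ range k, ∏ j ∈ Ico i k, g (2 * k - 1 - i - j) :=
    prod_congr rfl fun i _ => prod_congr rfl fun j _ => congrArg g (by ring)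
  have h5 : ∏ i ∈ range k, ∏ j ∈ Ico i k, g (2 * k + 1 + (rowBead μ i + rowBead μ j)) =
      (∏ i ∈ range k, g (2 * (rowBead μ i + k) + 1)) * ∏ i ∈ range k, ∏ j ∈ Ico (i + 1) k,
        g (rowBead μ i + k + (rowBead μ j + k) + 1) := by
    rw [← prod_mul_distrib]
    refine prod_congr rfl fun i hi => ?_
    rw [prod_eq_prod_Ico_succ_bot (mem_range.1 hi)]
    congr 1
    · exact congrArg g (by ring)
    · exact prod_congr rfl fun j _ => congrArg g (by ring)
  have h6 : ∏ i ∈ range k, gFactorial g (μ.rowLen i + (k - 1 - i)) ≠ 0 := by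
    refine prod_ne_zero_iff.2 fun i hi => gFactorial_ne_zero g hg ?_
    have := μ.rowLen_anti 0 i (Nat.zero_le _)
    rw [mem_range] at hi
    omega
  have h7 : pairProd g k 1 (fun i => rowBead μ i + k) =
      (∏ i ∈ range k, ∏ l ∈ Ico (i + 1) k, g (rowBead μ i - rowBead μ l)) *
      ∏ i ∈ range k, ∏ j ∈ Ico (i + 1) k, g (rowBead μ i + k + (rowBead μ j + k) + 1) := by
    simp only [pairProd, prod_mul_distrib]
    congr 1
    exact prod_congr rfl fun i _ => prod_congr rfl fun j _ => congrArg g (by ring)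
  rw [h4, h5] at h1
  rw [h7, gWeight, prod_div_distrib]
  have h8 : ∏ c ∈ μ.cells, g (hook μ c) ≠ 0 := by
    intro h0
    rw [h0, zero_mul] at h2
    exact h6 h2.symm
  rw [div_mul_eq_mul_div, div_eq_iff h8, ← mul_assoc, h1, mul_assoc, h3, ← h2]
  ring

/-- The weights for `N = -2k` of the diagrams with at most `k` columns. -/
theorem gWeight_neg {ℓ k : ℕ} (hg : ∀ m : ℤ, 0 < m → m < ℓ → g m ≠ 0)
    (heven : ∀ m, g (-m) = g m) (μ : YoungDiagram)
    (hk : μ.rowLen 0 ≤ k) (hℓ : μ.colLen 0 + k ≤ ℓ) :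
    gWeight g (-(2 * k)) μ * ((∏ i ∈ range k, ∏ j ∈ Ico (i + 1) k, g (2 * k - i - j)) *
        ∏ j ∈ range k, gFactorial g (k - j)) =
      pairProd g k 2 (fun i => rowBead μ.transpose i + k) *
        ∏ i ∈ range k, g (rowBead μ.transpose i + k + 1) := by
  have hbead : ∀ j, colBead μ j = - rowBead μ.transpose j - 1 := by
    intro j
    rw [colBead, rowBead, YoungDiagram.rowLen_transpose]
    ring
  have h1 := prod_dExp_mul' g μ hk (-(2 * k))
  have h2 := prod_hook_mul g μ.transpose (M := k) (by rwa [YoungDiagram.colLen_transpose])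
  rw [prod_eq_of_forall_sum_eq _ _ _ _ (sum_hook_transpose μ) g] at h2
  simp only [YoungDiagram.rowLen_transpose] at h2
  -- Up to sign, which `g` ignores, the arguments run from `k - j + 1` to `k - j + λ'_j`. The hook
  -- factorial stops one earlier, and the last factor is left over.
  have h3 : (∏ j ∈ range k, ∏ t ∈ range (μ.colLen j), g (-(2 * k) + (j - t - 1 + k))) *
      ∏ j ∈ range k, gFactorial g (k - j) =
      (∏ j ∈ range k, gFactorial g (μ.colLen j + (k - 1 - j))) *
        ∏ i ∈ range k, g (rowBead μ.transpose i + k + 1) := by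
    rw [← prod_mul_distrib, ← prod_mul_distrib]
    refine prod_congr rfl fun j hj => ?_
    rw [mem_range] at hj
    have : g (rowBead μ.transpose j + k + 1) = g ((μ.colLen j + (k - 1 - j) : ℕ) + 1) := by
      rw [rowBead, YoungDiagram.rowLen_transpose]
      refine congrArg g ?_
      omega
    rw [this, ← gFactorial_succ, show μ.colLen j + (k - 1 - j) + 1 = μ.colLen j + (k - j) by omega,
      ← prod_range_mul_gFactorial]
    congr 1
    refine prod_congr rfl fun t _ => ?_
    rw [← heven]
    refine congrArg g ?_
    omega
  have h4 : ∏ i ∈ range k, ∏ j ∈ Ico (i + 1) k, g (-(2 * k) + (i + j)) =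
      ∏ i ∈ range k, ∏ j ∈ Ico (i + 1) k, g (2 * k - i - j) :=
    prod_congr rfl fun i _ => prod_congr rfl fun j _ => by
      rw [← heven]
      exact congrArg g (by ring)
  have h5 : ∏ i ∈ range k, ∏ j ∈ Ico (i + 1) k, g (-(2 * k) + (colBead μ i + colBead μ j)) =
      ∏ i ∈ range k, ∏ j ∈ Ico (i + 1) k,
        g (rowBead μ.transpose i + k + (rowBead μ.transpose j + k) + 2) :=
    prod_congr rfl fun i _ => prod_congr rfl fun j _ => by
      rw [← heven, hbead, hbead]
      exact congrArg g (by ring)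
  have h6 : ∏ i ∈ range k, gFactorial g (μ.colLen i + (k - 1 - i)) ≠ 0 := by
    refine prod_ne_zero_iff.2 fun i hi => gFactorial_ne_zero g hg ?_
    have := μ.colLen_anti 0 i (Nat.zero_le _)
    rw [mem_range] at hi
    omega
  have h7 : pairProd g k 2 (fun i => rowBead μ.transpose i + k) =
      (∏ i ∈ range k, ∏ l ∈ Ico (i + 1) k,
        g (rowBead μ.transpose i - rowBead μ.transpose l)) *
      ∏ i ∈ range k, ∏ j ∈ Ico (i + 1) k,
        g (rowBead μ.transpose i + k + (rowBead μ.transpose j + k) + 2) := by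
    simp only [pairProd, prod_mul_distrib]
    congr 1
    exact prod_congr rfl fun i _ => prod_congr rfl fun j _ => congrArg g (by ring)
  rw [h4, h5] at h1
  rw [h7, gWeight, prod_div_distrib]
  have h8 : ∏ c ∈ μ.cells, g (hook μ c) ≠ 0 := by
    intro h0
    rw [h0, zero_mul] at h2
    exact h6 h2.symm
  rw [div_mul_eq_mul_div, div_eq_iff h8, ← mul_assoc, h1, mul_assoc, h3, ← h2]
  ring

end

/-- For `N = 2k + 2` and `M = k + 1` the pair `i = j = k` in `sum_dExp` yields `g 0`, which is zero
for `sinSq`, so it must be cancelled before passing to products. With at most `k` rows the same pair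
has the same value on the right. -/
theorem sum_dExp_of_lt (ν : YoungDiagram) {k : ℕ} (hk : ν.colLen 0 ≤ k) (f : ℤ → ℤ) :
    ∑ c ∈ ν.cells, f (dExp ν c) +
        ∑ i ∈ range k, ∑ j ∈ Ico i (k + 1), f (-(i + 1) + -(j + 1)) =
      ∑ i ∈ range k, ∑ j ∈ Ico i (k + 1), f (rowBead ν i + rowBead ν j) +
        ∑ i ∈ range k, ∑ t ∈ range (ν.rowLen i), f (t - i - 1 - (k + 1)) := by
  have h := sum_dExp ν (M := k + 1) (by omega) f
  have h0 : ν.rowLen k = 0 := (rowLen_eq_zero_iff ν k).2 hk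
  rw [sum_range_succ, sum_range_succ _ k, sum_range_succ _ k, Nat.Ico_succ_singleton,
    sum_singleton, sum_singleton, h0, range_zero, sum_empty,
    show rowBead ν k = -(k + 1) by rw [rowBead, h0]; push_cast; ring] at h
  push_cast at h
  linarith

/-- Here row `k` is nonempty, and the value `-2(k + 1)` to be cancelled is that of its first box;
hence the shift `t + 1` in the last sum. -/
theorem sum_dExp_of_eq (ν : YoungDiagram) {k : ℕ} (hk : ν.colLen 0 = k + 1) (f : ℤ → ℤ) :
    ∑ c ∈ ν.cells, f (dExp ν c) +
        ∑ i ∈ range k, ∑ j ∈ Ico i (k + 1), f (-(i + 1) + -(j + 1)) =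
      ∑ i ∈ range (k + 1), ∑ j ∈ Ico i (k + 1), f (rowBead ν i + rowBead ν j) +
        ∑ i ∈ range k, ∑ t ∈ range (ν.rowLen i), f (t - i - 1 - (k + 1)) +
        ∑ t ∈ range (ν.rowLen k - 1), f (t + 1 - k - 1 - (k + 1)) := by
  have h := sum_dExp ν (M := k + 1) hk.le f
  have h0 : ν.rowLen k ≠ 0 := by
    rw [Ne, rowLen_eq_zero_iff]
    omega
  rw [sum_range_succ, sum_range_succ (fun i => ∑ t ∈ range (ν.rowLen i), _) k,
    Nat.Ico_succ_singleton, sum_singleton,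
    show range (ν.rowLen k) = range (ν.rowLen k - 1 + 1) by congr 1; omega,
    sum_range_succ' _ (ν.rowLen k - 1)] at h
  push_cast at h
  rw [show (0 : ℤ) - k - 1 - (k + 1) = -(k + 1) + -(k + 1) by ring] at h
  linarith

section

variable (g : ℤ → ℝ)

/-- The weights for `N = 2k + 2` of the diagrams with at most `k` rows. -/
theorem gWeight_even_of_lt {ℓ k : ℕ} (hg : ∀ m : ℤ, 0 < m → m < ℓ → g m ≠ 0) (μ : YoungDiagram)
    (hk : μ.colLen 0 ≤ k) (hℓ : μ.rowLen 0 + (k + 1) ≤ ℓ) :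
    gWeight g (2 * (k + 1)) μ *
        ((∏ i ∈ range k, ∏ j ∈ Ico i (k + 1), g (2 * k - i - j)) *
          ∏ i ∈ range k, gFactorial g (k - 1 - i)) * ∏ i ∈ range k, g (rowBead μ i + (k + 1)) =
      pairProd g (k + 1) 0 (fun i => rowBead μ i + (k + 1)) *
        ∏ i ∈ range k, g (2 * (rowBead μ i + (k + 1))) := by
  have h1 := prod_mul_prod_eq_of_forall_sum_eq (R := ℝ)
    (s₁ := μ.cells) (d₁ := dExp μ)
    (s₂ := (range k).sigma fun i => Ico i (k + 1))
    (d₂ := fun x => (-((x.1 : ℤ) + 1) + -((x.2 : ℤ) + 1)))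
    (s₃ := (range k).sigma fun i => Ico i (k + 1))
    (d₃ := fun x => rowBead μ x.1 + rowBead μ x.2)
    (s₄ := (range k).sigma fun i => range (μ.rowLen i))
    (d₄ := fun x => (x.2 : ℤ) - x.1 - 1 - (k + 1))
    (fun f => by
      have := sum_dExp_of_lt μ hk f
      rw [sum_sigma', sum_sigma', sum_sigma'] at this
      exact this) (fun n => g (2 * (k + 1) + n))
  rw [prod_sigma, prod_sigma, prod_sigma] at h1
  have h2 := prod_hook_mul g μ (M := k + 1) (by omega)
  have h0 : μ.rowLen k = 0 := (rowLen_eq_zero_iff μ k).2 hk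
  -- The row factors stop one short of the hook factorials for `k + 1` rows; the missing factors are
  -- the `g (rowBead μ i + (k + 1))`.
  have h3 : (∏ i ∈ range k, ∏ t ∈ range (μ.rowLen i), g (2 * (k + 1) + (t - i - 1 - (k + 1)))) *
      (∏ i ∈ range k, gFactorial g (k - 1 - i)) * ∏ i ∈ range k, g (rowBead μ i + (k + 1)) =
      ∏ i ∈ range (k + 1), gFactorial g (μ.rowLen i + (k + 1 - 1 - i)) := by
    rw [← prod_mul_distrib, ← prod_mul_distrib, prod_range_succ _ k, h0]
    rw [show 0 + (k + 1 - 1 - k) = 0 by omega, gFactorial, range_zero, prod_empty, mul_one]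
    refine prod_congr rfl fun i hi => ?_
    rw [mem_range] at hi
    rw [show μ.rowLen i + (k + 1 - 1 - i) = μ.rowLen i + (k - 1 - i) + 1 by omega,
      gFactorial_succ, ← prod_range_mul_gFactorial]
    congr 1
    · congr 1
      refine prod_congr rfl fun t _ => congrArg g ?_
      omega
    · rw [rowBead]
      refine congrArg g ?_
      omega
  have h4 : ∏ i ∈ range k, ∏ j ∈ Ico i (k + 1), g (2 * (k + 1) + (-(i + 1) + -(j + 1))) =
      ∏ i ∈ range k, ∏ j ∈ Ico i (k + 1), g (2 * k - i - j) :=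
    prod_congr rfl fun i _ => prod_congr rfl fun j _ => congrArg g (by ring)
  have h5 : ∏ i ∈ range k, ∏ j ∈ Ico i (k + 1), g (2 * (k + 1) + (rowBead μ i + rowBead μ j)) =
      (∏ i ∈ range k, g (2 * (rowBead μ i + (k + 1)))) *
        ∏ i ∈ range (k + 1), ∏ j ∈ Ico (i + 1) (k + 1),
        g (rowBead μ i + (k + 1) + (rowBead μ j + (k + 1)) + 0) := by
    rw [prod_range_succ _ k, Ico_self, prod_empty, mul_one, ← prod_mul_distrib]
    refine prod_congr rfl fun i hi => ?_
    rw [mem_range] at hi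
    rw [prod_eq_prod_Ico_succ_bot (by omega)]
    congr 1
    · exact congrArg g (by ring)
    · exact prod_congr rfl fun j _ => congrArg g (by ring)
  have h6 : ∏ i ∈ range (k + 1), gFactorial g (μ.rowLen i + (k + 1 - 1 - i)) ≠ 0 := by
    refine prod_ne_zero_iff.2 fun i hi => gFactorial_ne_zero g hg ?_
    have := μ.rowLen_anti 0 i (Nat.zero_le _)
    rw [mem_range] at hi
    omega
  have h7 : pairProd g (k + 1) 0 (fun i => rowBead μ i + (k + 1)) =
      (∏ i ∈ range (k + 1), ∏ l ∈ Ico (i + 1) (k + 1), g (rowBead μ i - rowBead μ l)) *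
      ∏ i ∈ range (k + 1), ∏ j ∈ Ico (i + 1) (k + 1),
        g (rowBead μ i + (k + 1) + (rowBead μ j + (k + 1)) + 0) := by
    simp only [pairProd, prod_mul_distrib]
    congr 1
    exact prod_congr rfl fun i _ => prod_congr rfl fun j _ => congrArg g (by ring)
  rw [h4, h5] at h1
  rw [h7, gWeight, prod_div_distrib]
  have h8 : ∏ c ∈ μ.cells, g (hook μ c) ≠ 0 := by
    intro h0
    rw [h0, zero_mul] at h2
    exact h6 h2.symm
  rw [div_mul_eq_mul_div, div_mul_eq_mul_div, div_eq_iff h8, ← mul_assoc, h1, mul_assoc,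
    mul_assoc, ← mul_assoc _ _ (∏ i ∈ range k, g (rowBead μ i + (k + 1))), h3, ← h2]
  ring

/-- The weights for `N = 2k + 2` of the diagrams with `k + 1` rows. -/
theorem gWeight_even_of_eq {ℓ k : ℕ} (hg : ∀ m : ℤ, 0 < m → m < ℓ → g m ≠ 0) (μ : YoungDiagram)
    (hk : μ.colLen 0 = k + 1) (hℓ : μ.rowLen 0 + (k + 1) ≤ ℓ) :
    gWeight g (2 * (k + 1)) μ *
        ((∏ i ∈ range k, ∏ j ∈ Ico i (k + 1), g (2 * k - i - j)) *
          ∏ i ∈ range k, gFactorial g (k - 1 - i)) *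
        ∏ i ∈ range (k + 1), g (rowBead μ i + (k + 1)) =
      pairProd g (k + 1) 0 (fun i => rowBead μ i + (k + 1)) *
        ∏ i ∈ range (k + 1), g (2 * (rowBead μ i + (k + 1))) := by
  have h1 := prod_mul_prod_eq_of_forall_sum_eq₃ (R := ℝ)
    (s₁ := μ.cells) (d₁ := dExp μ)
    (s₂ := (range k).sigma fun i => Ico i (k + 1))
    (d₂ := fun x => (-((x.1 : ℤ) + 1) + -((x.2 : ℤ) + 1)))
    (s₃ := (range (k + 1)).sigma fun i => Ico i (k + 1))
    (d₃ := fun x => rowBead μ x.1 + rowBead μ x.2)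
    (s₄ := (range k).sigma fun i => range (μ.rowLen i))
    (d₄ := fun x => (x.2 : ℤ) - x.1 - 1 - (k + 1))
    (s₅ := range (μ.rowLen k - 1))
    (d₅ := fun t => (t : ℤ) + 1 - k - 1 - (k + 1))
    (fun f => by
      have := sum_dExp_of_eq μ hk f
      rw [sum_sigma', sum_sigma', sum_sigma'] at this
      exact this) (fun n => g (2 * (k + 1) + n))
  rw [prod_sigma, prod_sigma, prod_sigma] at h1
  have h2 := prod_hook_mul g μ (M := k + 1) (by omega)
  have h0 : μ.rowLen k ≠ 0 := by
    rw [Ne, rowLen_eq_zero_iff]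
    omega
  have h3 : (∏ i ∈ range k, ∏ t ∈ range (μ.rowLen i), g (2 * (k + 1) + (t - i - 1 - (k + 1)))) *
      (∏ t ∈ range (μ.rowLen k - 1), g (2 * (k + 1) + (t + 1 - k - 1 - (k + 1)))) *
      (∏ i ∈ range k, gFactorial g (k - 1 - i)) * ∏ i ∈ range (k + 1), g (rowBead μ i + (k + 1)) =
      ∏ i ∈ range (k + 1), gFactorial g (μ.rowLen i + (k + 1 - 1 - i)) := by
    have h31 : ∀ i ∈ range k,
        (∏ t ∈ range (μ.rowLen i), g (2 * (k + 1) + (t - i - 1 - (k + 1)))) *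
        gFactorial g (k - 1 - i) * g (rowBead μ i + (k + 1)) =
        gFactorial g (μ.rowLen i + (k + 1 - 1 - i)) := by
      intro i hi
      rw [mem_range] at hi
      rw [show μ.rowLen i + (k + 1 - 1 - i) = μ.rowLen i + (k - 1 - i) + 1 by omega,
        gFactorial_succ, ← prod_range_mul_gFactorial]
      congr 1
      · congr 1
        refine prod_congr rfl fun t _ => congrArg g ?_
        omega
      · rw [rowBead]
        refine congrArg g ?_
        omega
    have h32 : (∏ t ∈ range (μ.rowLen k - 1), g (2 * (k + 1) + (t + 1 - k - 1 - (k + 1)))) *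
        g (rowBead μ k + (k + 1)) = gFactorial g (μ.rowLen k + (k + 1 - 1 - k)) := by
      rw [show μ.rowLen k + (k + 1 - 1 - k) = μ.rowLen k - 1 + 1 by omega, gFactorial_succ,
        gFactorial]
      congr 1
      · refine prod_congr rfl fun t _ => congrArg g ?_
        ring
      · rw [rowBead]
        refine congrArg g ?_
        omega
    rw [prod_range_succ _ k, prod_range_succ _ k, ← h32, ← prod_congr rfl h31, prod_mul_distrib,
      prod_mul_distrib]
    ring
  have h4 : ∏ i ∈ range k, ∏ j ∈ Ico i (k + 1), g (2 * (k + 1) + (-(i + 1) + -(j + 1))) =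
      ∏ i ∈ range k, ∏ j ∈ Ico i (k + 1), g (2 * k - i - j) :=
    prod_congr rfl fun i _ => prod_congr rfl fun j _ => congrArg g (by ring)
  have h5 : ∏ i ∈ range (k + 1), ∏ j ∈ Ico i (k + 1),
        g (2 * (k + 1) + (rowBead μ i + rowBead μ j)) =
      (∏ i ∈ range (k + 1), g (2 * (rowBead μ i + (k + 1)))) *
        ∏ i ∈ range (k + 1), ∏ j ∈ Ico (i + 1) (k + 1),
        g (rowBead μ i + (k + 1) + (rowBead μ j + (k + 1)) + 0) := by
    rw [← prod_mul_distrib]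
    refine prod_congr rfl fun i hi => ?_
    rw [prod_eq_prod_Ico_succ_bot (mem_range.1 hi)]
    congr 1
    · exact congrArg g (by ring)
    · exact prod_congr rfl fun j _ => congrArg g (by ring)
  have h6 : ∏ i ∈ range (k + 1), gFactorial g (μ.rowLen i + (k + 1 - 1 - i)) ≠ 0 := by
    refine prod_ne_zero_iff.2 fun i hi => gFactorial_ne_zero g hg ?_
    have := μ.rowLen_anti 0 i (Nat.zero_le _)
    rw [mem_range] at hi
    omega
  have h7 : pairProd g (k + 1) 0 (fun i => rowBead μ i + (k + 1)) =
      (∏ i ∈ range (k + 1), ∏ l ∈ Ico (i + 1) (k + 1), g (rowBead μ i - rowBead μ l)) *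
      ∏ i ∈ range (k + 1), ∏ j ∈ Ico (i + 1) (k + 1),
        g (rowBead μ i + (k + 1) + (rowBead μ j + (k + 1)) + 0) := by
    simp only [pairProd, prod_mul_distrib]
    congr 1
    exact prod_congr rfl fun i _ => prod_congr rfl fun j _ => congrArg g (by ring)
  rw [h4, h5] at h1
  rw [h7, gWeight, prod_div_distrib]
  have h8 : ∏ c ∈ μ.cells, g (hook μ c) ≠ 0 := by
    intro h0
    rw [h0, zero_mul] at h2
    exact h6 h2.symm
  rw [div_mul_eq_mul_div, div_mul_eq_mul_div, div_eq_iff h8, ← mul_assoc, h1]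
  rw [← h2] at h3
  linear_combination (∏ i ∈ range (k + 1), g (2 * (rowBead μ i + (k + 1)))) *
    (∏ i ∈ range (k + 1), ∏ j ∈ Ico (i + 1) (k + 1),
        g (rowBead μ i + (k + 1) + (rowBead μ j + (k + 1)) + 0)) * h3

end

/-! ### Changing the first column -/

/-- The diagram `μ` with its first column replaced by one with `n` boxes, where `n` is at least
the length of the second column. -/
def setCol (μ : YoungDiagram) (n : ℕ) : YoungDiagram where
  -- The `max` only serves to give a diagram for every `n`.
  cells := (range (max n (μ.colLen 1))).image (fun i => (i, 0)) ∪ μ.cells.filter (fun c => 0 < c.2)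
  isLowerSet := by
    rintro ⟨i, j⟩ ⟨i', j'⟩ hle hmem
    rw [Prod.mk_le_mk] at hle
    simp only [coe_union, coe_image, Set.mem_union, Set.mem_image, mem_coe, mem_range, mem_filter,
      Prod.mk.injEq, YoungDiagram.mem_cells, YoungDiagram.mem_iff_lt_colLen] at hmem ⊢
    have h1 : 0 < j → μ.colLen j ≤ μ.colLen 1 := fun h => μ.colLen_anti 1 j h
    have h2 := μ.colLen_anti j' j hle.2
    rcases Nat.eq_zero_or_pos j' with h0 | h0
    · left
      refine ⟨i', ?_, rfl, h0.symm⟩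
      rcases hmem with ⟨x, hx, rfl, h⟩ | ⟨h, hpos⟩
      · omega
      · have := h1 hpos
        omega
    · right
      rcases hmem with ⟨x, hx, rfl, h⟩ | ⟨h, hpos⟩ <;> omega

section

variable {μ : YoungDiagram} {n : ℕ}

theorem mem_setCol (hn : μ.colLen 1 ≤ n) (i j : ℕ) :
    (i, j) ∈ setCol μ n ↔ (j = 0 ∧ i < n) ∨ (0 < j ∧ (i, j) ∈ μ) := by
  rw [← YoungDiagram.mem_cells, setCol]
  simp only [mem_union, mem_image, mem_range, mem_filter, Prod.mk.injEq, YoungDiagram.mem_cells,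
    max_eq_left hn]
  constructor
  · rintro (⟨x, hx, rfl, h⟩ | h)
    · exact Or.inl ⟨h.symm, hx⟩
    · exact Or.inr h.symm
  · rintro (h | h)
    · exact Or.inl ⟨i, h.2, rfl, h.1.symm⟩
    · exact Or.inr h.symm

theorem colLen_setCol_zero (hn : μ.colLen 1 ≤ n) : (setCol μ n).colLen 0 = n :=
  colLen_eq_of_forall fun i => by
    rw [mem_setCol hn]
    simp

theorem colLen_setCol_of_pos (hn : μ.colLen 1 ≤ n) {j : ℕ} (hj : 0 < j) :
    (setCol μ n).colLen j = μ.colLen j :=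
  colLen_eq_of_forall fun i => by
    rw [mem_setCol hn, YoungDiagram.mem_iff_lt_colLen]
    omega

theorem rowLen_setCol (hn : μ.colLen 1 ≤ n) (i : ℕ) :
    (setCol μ n).rowLen i = if i < n then max 1 (μ.rowLen i) else 0 :=
  rowLen_eq_of_forall fun j => by
    have := lt_rowLen_iff_lt_colLen μ i 1
    rw [mem_setCol hn, YoungDiagram.mem_iff_lt_rowLen]
    split_ifs with hi <;> omega

theorem setCol_setCol (hn : μ.colLen 1 ≤ n) {m : ℕ} (hm : μ.colLen 1 ≤ m) :
    setCol (setCol μ n) m = setCol μ m := by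
  ext ⟨i, j⟩
  rw [YoungDiagram.mem_cells, YoungDiagram.mem_cells,
    mem_setCol (by rwa [colLen_setCol_of_pos hn one_pos]), mem_setCol hm, mem_setCol hn,
    YoungDiagram.mem_iff_lt_colLen]
  omega

theorem setCol_colLen (μ : YoungDiagram) : setCol μ (μ.colLen 0) = μ := by
  ext ⟨i, j⟩
  rw [YoungDiagram.mem_cells, YoungDiagram.mem_cells, mem_setCol (μ.colLen_anti 0 1 zero_le_one),
    YoungDiagram.mem_iff_lt_colLen]
  rcases Nat.eq_zero_or_pos j with rfl | h
  · simp
  · omega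

theorem addBox_setCol (hn : μ.colLen 1 ≤ n) : AddBox (setCol μ n) (setCol μ (n + 1)) n 0 := by
  refine ⟨fun i j => ?_, ?_⟩
  · rw [mem_setCol hn, mem_setCol (by omega), YoungDiagram.mem_iff_lt_colLen]
    omega
  · rw [mem_setCol hn]
    omega

theorem card_setCol (hn : μ.colLen 1 ≤ n) (d : ℕ) :
    (setCol μ (n + d)).card = (setCol μ n).card + d := by
  induction d with
  | zero => rfl
  | succ d ih =>
    have := (addBox_setCol (μ := μ) (n := n + d) (by omega)).card_right
    rw [← add_assoc, this, ih]
    ring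

theorem rowBead_setCol_of_lt {m i : ℕ} (hn : μ.colLen 1 ≤ n) (hm : n ≤ m) (hi : i < n) :
    rowBead (setCol μ m) i = rowBead (setCol μ n) i := by
  rw [rowBead, rowBead, rowLen_setCol hn, rowLen_setCol (by omega), if_pos hi, if_pos (by omega)]

theorem rowBead_setCol_of_ge {m i : ℕ} (hi : μ.colLen 1 ≤ i) (him : i < m) :
    rowBead (setCol μ m) i = - i := by
  have := lt_rowLen_iff_lt_colLen μ i 1
  rw [rowBead, rowLen_setCol (by omega), if_pos him, max_eq_left (by omega)]
  push_cast
  ring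

/-- The effect on the exponents `d(i, j)` of a change of the first column. -/
theorem sum_dExp_setCol (hn : μ.colLen 1 ≤ n) (d : ℕ) (f : ℤ → ℤ) :
    ∑ c ∈ (setCol μ (n + d)).cells, f (dExp (setCol μ (n + d)) c) +
        ∑ i ∈ range n, f (rowBead (setCol μ n) i - (n + d)) =
      ∑ c ∈ (setCol μ n).cells, f (dExp (setCol μ n) c) +
        ∑ i ∈ range n, f (rowBead (setCol μ n) i - n) +
        ∑ t ∈ range d, f (-n - (n + t)) := by
  induction d with
  | zero => simp
  | succ d ih =>
    have hd : μ.colLen 1 ≤ n + d := by omega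
    have h := addBox_setCol hd
    have h1 := h.sum_dExp_right (M := n + d + 1) (colLen_setCol_zero (by omega)).le f
    rw [sum_range_succ, ← sum_range_add_sum_Ico _ (show n ≤ n + d by omega), h.rowBead_left] at h1
    have h2 : ∑ i ∈ Ico n (n + d), (f ((0 : ℕ) - (n + d : ℕ) + rowBead (setCol μ (n + d)) i) -
        f ((0 : ℕ) - (n + d : ℕ) - 1 + rowBead (setCol μ (n + d)) i)) =
        f (-n - (n + d)) - f (2 * (-(n + d))) := by
      have h3 := sum_range_sub' (fun i : ℕ => f (-(n + d) - (n + i))) d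
      rw [sum_Ico_eq_sum_range, show n + d - n = d by omega]
      rw [show 2 * (-((n : ℤ) + d)) = -(n + d) - (n + d) by ring]
      rw [Nat.cast_zero, add_zero, show -((n : ℤ) + d) - n = -n - (n + d) by ring] at h3
      rw [← h3]
      refine sum_congr rfl fun i hi => ?_
      rw [mem_range] at hi
      rw [rowBead_setCol_of_ge (by omega) (by omega)]
      congr 2 <;> push_cast <;> ring
    have h4 : ∑ i ∈ range n, (f ((0 : ℕ) - (n + d : ℕ) + rowBead (setCol μ (n + d)) i) -
        f ((0 : ℕ) - (n + d : ℕ) - 1 + rowBead (setCol μ (n + d)) i)) =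
        ∑ i ∈ range n, f (rowBead (setCol μ n) i - (n + d)) -
        ∑ i ∈ range n, f (rowBead (setCol μ n) i - (n + (d + 1 : ℕ))) := by
      rw [← sum_sub_distrib]
      refine sum_congr rfl fun i hi => ?_
      rw [rowBead_setCol_of_lt hn (by omega) (mem_range.1 hi)]
      congr 2 <;> push_cast <;> ring
    rw [h2, h4] at h1
    rw [sum_range_succ _ d, ← add_assoc n d 1]
    push_cast at h1 ⊢
    rw [show (0 : ℤ) - (n + d) - 1 - (n + d + 1) = 0 - (n + d) - 1 + (0 - (n + d) - 1) by ring,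
      show (0 : ℤ) - (n + d) + (0 - (n + d) - 1) = 2 * (0 - (n + d)) - 1 by ring,
      show 2 * (-((n : ℤ) + d)) = 2 * (0 - (n + d)) by ring] at h1
    linarith

/-- The effect on the hook lengths of a change of the first column. -/
theorem sum_hook_setCol (hn : μ.colLen 1 ≤ n) (d : ℕ) (f : ℤ → ℤ) :
    ∑ c ∈ (setCol μ (n + d)).cells, f (hook (setCol μ (n + d)) c) +
        ∑ i ∈ range n, f (rowBead (setCol μ n) i + n) =
      ∑ c ∈ (setCol μ n).cells, f (hook (setCol μ n) c) +
        ∑ i ∈ range n, f (rowBead (setCol μ n) i + (n + d)) +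
        ∑ t ∈ range d, f (d - t) := by
  have key : ∀ m, μ.colLen 1 ≤ m → ∑ c ∈ (setCol μ m).cells, f (hook (setCol μ m) c) =
      ∑ i ∈ range m, f (rowBead (setCol μ m) i + m) +
      ∑ c ∈ μ.cells.filter (fun c => 0 < c.2), f (hook μ c) := by
    intro m hm
    have hcells : (setCol μ m).cells =
      (range m).image (fun i => (i, 0)) ∪ μ.cells.filter (fun c => 0 < c.2) := by
      change image _ (range (max m (μ.colLen 1))) ∪ _ = _
      rw [max_eq_left hm]
    conv_lhs => rw [hcells]
    rw [sum_union, sum_image]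
    · congr 1
      · refine sum_congr rfl fun i _ => ?_
        rw [hook_eq, colBead, colLen_setCol_zero hm]
        congr 1
        push_cast
        ring
      · refine sum_congr rfl ?_
        rintro ⟨i, j⟩ hij
        rw [mem_filter, YoungDiagram.mem_cells, YoungDiagram.mem_iff_lt_rowLen] at hij
        have hlt := (lt_rowLen_iff_lt_colLen μ i j).1 hij.1
        have hanti := μ.colLen_anti 1 j hij.2
        simp only at hij
        rw [hook_eq, hook_eq, rowBead, colBead, rowLen_setCol hm, colLen_setCol_of_pos hm hij.2,
          if_pos (by omega), max_eq_right (by omega), rowBead, colBead]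
    · intro x _ y _ hxy
      exact (Prod.mk.inj hxy).1
    · rw [Finset.disjoint_left]
      intro c hc hc'
      obtain ⟨i, -, rfl⟩ := mem_image.1 hc
      simp at hc'
  rw [key n hn, key (n + d) (by omega), sum_range_add]
  have h1 : ∑ i ∈ range n, f (rowBead (setCol μ (n + d)) i + (n + d : ℕ)) =
      ∑ i ∈ range n, f (rowBead (setCol μ n) i + (n + d)) := by
    refine sum_congr rfl fun i hi => ?_
    rw [rowBead_setCol_of_lt hn (by omega) (mem_range.1 hi)]
    push_cast
    rfl
  have h2 : ∑ t ∈ range d, f (rowBead (setCol μ (n + d)) (n + t) + (n + d : ℕ)) =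
      ∑ t ∈ range d, f (d - t) := by
    refine sum_congr rfl fun t ht => ?_
    rw [mem_range] at ht
    rw [rowBead_setCol_of_ge (by omega) (by omega)]
    congr 1
    push_cast
    ring
  rw [h1, h2]
  ring

/-- The first columns have lengths `n` and `N - n` for `N = 2n + d`. The values by which the
numerators differ are those by which the hooks of the first columns differ (`e1`, `e2`, `e3`), so
the quotients agree for every `g` that is nonzero on the hooks. -/
theorem gWeight_setCol_aux {g : ℤ → ℝ} (hn : μ.colLen 1 ≤ n) (d : ℕ)
    (hg : ∀ c ∈ (setCol μ (n + d)).cells, g (hook (setCol μ (n + d)) c) ≠ 0)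
    (hg' : ∀ c ∈ (setCol μ n).cells, g (hook (setCol μ n) c) ≠ 0) :
    gWeight g (2 * n + d) (setCol μ (n + d)) = gWeight g (2 * n + d) (setCol μ n) := by
  have h1 := prod_mul_prod_eq_of_forall_sum_eq₃ (sum_dExp_setCol hn d)
    (fun m => g (2 * n + d + m))
  have h2 := prod_mul_prod_eq_of_forall_sum_eq₃ (sum_hook_setCol hn d) g
  have e1 : ∀ i, g (2 * n + d + (rowBead (setCol μ n) i - (n + d))) =
      g (rowBead (setCol μ n) i + n) := fun i => congrArg g (by ring)
  have e2 : ∀ i, g (2 * n + d + (rowBead (setCol μ n) i - n)) =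
      g (rowBead (setCol μ n) i + (n + d)) := fun i => congrArg g (by ring)
  have e3 : ∀ t : ℕ, g (2 * n + d + (-n - (n + t))) = g (d - t) := fun t =>
    congrArg g (by ring)
  simp only [e1, e2, e3] at h1
  have hA : ∏ i ∈ range n, g (rowBead (setCol μ n) i + n) ≠ 0 := by
    refine prod_ne_zero_iff.2 fun i hi => ?_
    have := hg' (i, 0) (by
      rw [YoungDiagram.mem_cells, YoungDiagram.mem_iff_lt_colLen, colLen_setCol_zero hn]
      exact mem_range.1 hi)
    rw [hook_eq, colBead, colLen_setCol_zero hn] at this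
    convert this using 2
    push_cast
    ring
  have hP : ∏ c ∈ (setCol μ (n + d)).cells, g (hook (setCol μ (n + d)) c) ≠ 0 :=
    prod_ne_zero_iff.2 hg
  have hQ : ∏ c ∈ (setCol μ n).cells, g (hook (setCol μ n) c) ≠ 0 := prod_ne_zero_iff.2 hg'
  rw [gWeight, gWeight, prod_div_distrib, prod_div_distrib, div_eq_div_iff hP hQ]
  apply mul_right_cancel₀ hA
  linear_combination (∏ c ∈ (setCol μ n).cells, g (hook (setCol μ n) c)) * h1 -
    (∏ c ∈ (setCol μ n).cells, g (2 * n + d + dExp (setCol μ n) c)) * h2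

end

/-! ### Flipping the first column, and reduction to diagrams in a box -/

theorem finite_box (h w : ℕ) : {μ : YoungDiagram | μ.colLen 0 ≤ h ∧ μ.rowLen 0 ≤ w}.Finite := by
  apply Set.Finite.of_finite_image (f := YoungDiagram.cells)
  · refine ((range h ×ˢ range w).powerset.finite_toSet).subset ?_
    rintro _ ⟨μ, hμ, rfl⟩
    rw [mem_coe, mem_powerset]
    rintro ⟨i, j⟩ hij
    rw [YoungDiagram.mem_cells] at hij
    have h1 := YoungDiagram.mem_iff_lt_rowLen.1 hij
    have h2 := YoungDiagram.mem_iff_lt_colLen.1 hij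
    have h3 := μ.rowLen_anti 0 i (Nat.zero_le _)
    have h4 := μ.colLen_anti 0 j (Nat.zero_le _)
    have h5 := hμ.1
    have h6 := hμ.2
    rw [mem_product, mem_range, mem_range]
    omega
  · intro μ _ ν _ h
    exact YoungDiagram.ext h

/-- The diagrams with at most `h` rows and at most `w` columns. -/
noncomputable def boxDiagrams (h w : ℕ) : Finset YoungDiagram := (finite_box h w).toFinset

theorem mem_boxDiagrams {h w : ℕ} {μ : YoungDiagram} :
    μ ∈ boxDiagrams h w ↔ μ.colLen 0 ≤ h ∧ μ.rowLen 0 ≤ w := by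
  simp [boxDiagrams]

theorem finite_colDiagrams (T w : ℕ) :
    {μ : YoungDiagram | μ.colLen 0 + μ.colLen 1 ≤ T ∧ μ.rowLen 0 ≤ w}.Finite :=
  (finite_box T w).subset fun μ hμ => ⟨by have := hμ.1; omega, hμ.2⟩

/-- The diagrams with at most `T` boxes in the first two columns and at most `w` columns. -/
noncomputable def colDiagrams (T w : ℕ) : Finset YoungDiagram := (finite_colDiagrams T w).toFinset

theorem mem_colDiagrams {T w : ℕ} {μ : YoungDiagram} :
    μ ∈ colDiagrams T w ↔ μ.colLen 0 + μ.colLen 1 ≤ T ∧ μ.rowLen 0 ≤ w := by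
  simp [colDiagrams]

/-- Replaces the first column of `μ`, of length `m`, by one of length `T - m`. -/
def flipCol (T : ℕ) (μ : YoungDiagram) : YoungDiagram := setCol μ (T - μ.colLen 0)

section

variable {T w : ℕ} {μ : YoungDiagram}

theorem colLen_flipCol (h : μ ∈ colDiagrams T w) : (flipCol T μ).colLen 0 = T - μ.colLen 0 :=
  colLen_setCol_zero (by have := (mem_colDiagrams.1 h).1; omega)

theorem flipCol_flipCol (h : μ ∈ colDiagrams T w) : flipCol T (flipCol T μ) = μ := by
  have h1 := (mem_colDiagrams.1 h).1
  have h2 := μ.colLen_anti 0 1 zero_le_one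
  conv_lhs => rw [flipCol, colLen_flipCol h, flipCol]
  rw [setCol_setCol (by omega) (by omega), show T - (T - μ.colLen 0) = μ.colLen 0 by omega,
    setCol_colLen]

/-- The flip of the empty diagram may be a column, hence `0 < w`. -/
theorem flipCol_mem (hw : 0 < w) (h : μ ∈ colDiagrams T w) : flipCol T μ ∈ colDiagrams T w := by
  have h1 := mem_colDiagrams.1 h
  have h2 := μ.colLen_anti 0 1 zero_le_one
  rw [mem_colDiagrams, colLen_flipCol h, flipCol, colLen_setCol_of_pos (by omega) one_pos,
    rowLen_setCol (by omega)]
  refine ⟨by omega, ?_⟩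
  split_ifs <;> omega

theorem card_flipCol (h : μ ∈ colDiagrams T w) :
    (flipCol T μ).card + 2 * μ.colLen 0 = μ.card + T := by
  have h1 := (mem_colDiagrams.1 h).1
  have h2 := μ.colLen_anti 0 1 zero_le_one
  have h3 : μ.card = (setCol μ (μ.colLen 0)).card := by rw [setCol_colLen]
  rw [h3, flipCol]
  rcases le_total (μ.colLen 0) (T - μ.colLen 0) with h4 | h4
  · have := card_setCol (μ := μ) h2 (T - μ.colLen 0 - μ.colLen 0)
    rw [Nat.add_sub_cancel' h4] at this
    omega
  · have := card_setCol (μ := μ) (n := T - μ.colLen 0) (by omega)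
      (μ.colLen 0 - (T - μ.colLen 0))
    rw [Nat.add_sub_cancel' h4] at this
    omega

theorem gWeight_flipCol {g : ℤ → ℝ} {N : ℤ} (hN : N = T) (h : μ ∈ colDiagrams T w)
    (hg : ∀ c ∈ μ.cells, g (hook μ c) ≠ 0)
    (hg' : ∀ c ∈ (flipCol T μ).cells, g (hook (flipCol T μ) c) ≠ 0) :
    gWeight g N (flipCol T μ) = gWeight g N μ := by
  have h1 := (mem_colDiagrams.1 h).1
  have h2 := μ.colLen_anti 0 1 zero_le_one
  have h3 := setCol_colLen μ
  rcases le_total (μ.colLen 0) (T - μ.colLen 0) with h4 | h4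
  · obtain ⟨d, hd⟩ := Nat.exists_eq_add_of_le h4
    have hflip : flipCol T μ = setCol μ (μ.colLen 0 + d) := by rw [flipCol, hd]
    have := gWeight_setCol_aux (μ := μ) (g := g) h2 d (by rwa [← hflip]) (by rwa [h3])
    rwa [← hflip, h3, show (2 * (μ.colLen 0 : ℤ) + d) = N by omega] at this
  · obtain ⟨d, hd⟩ := Nat.exists_eq_add_of_le h4
    have h5 : setCol μ (T - μ.colLen 0 + d) = μ := by rw [← hd, h3]
    have := gWeight_setCol_aux (μ := μ) (g := g) (n := T - μ.colLen 0) (by omega) d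
      (by rwa [h5]) hg'
    rw [h5, show (2 * ((T - μ.colLen 0 : ℕ) : ℤ) + d) = N by omega] at this
    exact this.symm

end

section

variable {h w : ℕ} (F : YoungDiagram → ℝ)

/-- For an odd total the flip changes the parity of the number of boxes and exchanges the diagrams
with at most `h` rows and those with more. Each orbit thus has one even member and one member in the
box. -/
theorem sum_colDiagrams_odd (hw : 0 < w)
    (hF : ∀ μ ∈ colDiagrams (2 * h + 1) w, F (flipCol (2 * h + 1) μ) = F μ) :
    ∑ μ ∈ colDiagrams (2 * h + 1) w with Even μ.card, F μ = ∑ μ ∈ boxDiagrams h w, F μ := by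
  have hbox : ∀ μ ∈ boxDiagrams h w, μ ∈ colDiagrams (2 * h + 1) w := by
    intro μ hμ
    rw [mem_boxDiagrams] at hμ
    have := μ.colLen_anti 0 1 zero_le_one
    rw [mem_colDiagrams]
    omega
  refine sum_nbij' (fun μ => if μ.colLen 0 ≤ h then μ else flipCol (2 * h + 1) μ)
    (fun μ => if Even μ.card then μ else flipCol (2 * h + 1) μ) ?_ ?_ ?_ ?_ ?_
  · intro μ hμ
    rw [mem_filter] at hμ
    have h1 := mem_colDiagrams.1 hμ.1
    split_ifs with hle
    · exact mem_boxDiagrams.2 ⟨hle, h1.2⟩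
    · rw [mem_boxDiagrams, colLen_flipCol hμ.1]
      exact ⟨by omega, (mem_colDiagrams.1 (flipCol_mem hw hμ.1)).2⟩
  · intro μ hμ
    have h1 := hbox μ hμ
    split_ifs with hev
    · exact mem_filter.2 ⟨h1, hev⟩
    · refine mem_filter.2 ⟨flipCol_mem hw h1, ?_⟩
      have := card_flipCol h1
      rw [Nat.even_iff] at hev ⊢
      omega
  · intro μ hμ
    rw [mem_filter] at hμ
    have h1 := mem_colDiagrams.1 hμ.1
    split_ifs with hle hev hev
    · rfl
    · exact absurd hμ.2 hev
    · exfalso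
      have h2 := card_flipCol hμ.1
      have h3 := hμ.2
      rw [Nat.even_iff] at hev h3
      omega
    · exact flipCol_flipCol hμ.1
  · intro μ hμ
    have h1 := hbox μ hμ
    rw [mem_boxDiagrams] at hμ
    split_ifs with hev hle hle
    · rfl
    · exact absurd hμ.1 hle
    · rw [colLen_flipCol h1] at hle
      omega
    · exact flipCol_flipCol h1
  · intro μ hμ
    rw [mem_filter] at hμ
    split_ifs
    · rfl
    · exact (hF μ hμ.1).symm

/-- For an even total the flip preserves parity. It matches the diagrams with more than `h` rows
with those with fewer, which therefore count twice; it fixes those with exactly `h` rows. -/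
theorem sum_colDiagrams_even (hw : 0 < w)
    (hF : ∀ μ ∈ colDiagrams (2 * h) w, F (flipCol (2 * h) μ) = F μ) :
    ∑ μ ∈ colDiagrams (2 * h) w with Even μ.card, F μ =
      ∑ μ ∈ boxDiagrams h w with Even μ.card, (if μ.colLen 0 < h then 2 else 1) * F μ := by
  have hbox : (colDiagrams (2 * h) w).filter (fun μ => μ.colLen 0 ≤ h) = boxDiagrams h w := by
    ext μ
    have := μ.colLen_anti 0 1 zero_le_one
    rw [mem_filter, mem_colDiagrams, mem_boxDiagrams]
    omega
  have hsplit : ∀ μ, (if μ.colLen 0 < h then 2 else 1) * F μ =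
      F μ + if μ.colLen 0 < h then F μ else 0 := by
    intro μ
    split_ifs <;> ring
  simp only [hsplit]
  rw [sum_add_distrib, ← sum_filter,
    ← sum_filter_add_sum_filter_not _ (fun μ : YoungDiagram => μ.colLen 0 ≤ h)]
  congr 1
  · rw [← hbox, filter_filter, filter_filter]
    refine sum_congr ?_ fun _ _ => rfl
    ext μ
    simp only [mem_filter]
    tauto
  · refine sum_nbij' (flipCol (2 * h)) (flipCol (2 * h)) ?_ ?_ ?_ ?_ ?_
    · intro μ hμ
      simp only [mem_filter] at hμ ⊢
      have h1 := card_flipCol hμ.1.1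
      have h2 := hμ.1.2
      have h3 := mem_colDiagrams.1 (flipCol_mem hw hμ.1.1)
      have h4 := mem_colDiagrams.1 hμ.1.1
      rw [mem_boxDiagrams, Nat.even_iff]
      rw [Nat.even_iff] at h2
      have h5 := colLen_flipCol hμ.1.1
      refine ⟨⟨⟨?_, h3.2⟩, ?_⟩, ?_⟩ <;> omega
    · intro μ hμ
      simp only [mem_filter] at hμ ⊢
      have h0 : μ ∈ colDiagrams (2 * h) w := by
        have := hμ.1.1
        rw [← hbox] at this
        exact (mem_filter.1 this).1
      have h1 := card_flipCol h0
      have h2 := hμ.1.2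
      rw [Nat.even_iff] at h2 ⊢
      have h5 := colLen_flipCol h0
      refine ⟨⟨flipCol_mem hw h0, ?_⟩, ?_⟩ <;> omega
    · intro μ hμ
      simp only [mem_filter] at hμ
      exact flipCol_flipCol hμ.1.1
    · intro μ hμ
      simp only [mem_filter] at hμ
      have := hμ.1.1
      rw [← hbox] at this
      exact flipCol_flipCol (mem_filter.1 this).1
    · intro μ hμ
      simp only [mem_filter] at hμ
      exact (hF μ hμ.1.1).symm

end

/-! ### Diagrams in a box as strictly decreasing sequences -/

/-- The diagram whose rows have the lengths `a 0 ≥ a 1 ≥ ⋯`, where `a k = 0`. -/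
def ofRowLen (a : ℕ → ℕ) (ha : Antitone a) (k : ℕ) : YoungDiagram where
  cells := (range k ×ˢ range (a 0)).filter fun c => c.2 < a c.1
  isLowerSet := by
    rintro ⟨i, j⟩ ⟨i', j'⟩ hle hmem
    rw [Prod.mk_le_mk] at hle
    simp only [coe_filter, mem_product, mem_range, Set.mem_ofPred_eq] at hmem ⊢
    have := ha hle.1
    omega

theorem rowLen_ofRowLen {a : ℕ → ℕ} (ha : Antitone a) {k : ℕ} (hk : a k = 0) (i : ℕ) :
    (ofRowLen a ha k).rowLen i = a i :=
  rowLen_eq_of_forall fun j => by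
    rw [← YoungDiagram.mem_cells, ofRowLen]
    simp only [mem_filter, mem_product, mem_range]
    have h1 := ha (Nat.zero_le i)
    have h2 : k ≤ i → a i ≤ a k := fun h => ha h
    omega

theorem add_le_of_strictAnti {k R : ℕ} {p : Fin k → Fin R} (hp : StrictAnti p) (i d : ℕ)
    (h : i + d < k) : (p ⟨i + d, h⟩ : ℕ) + d ≤ p ⟨i, by omega⟩ := by
  induction d with
  | zero => simp
  | succ d ih =>
    have h1 := ih (by omega)
    have h2 : p ⟨i + (d + 1), h⟩ < p ⟨i + d, by omega⟩ := hp (by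
      rw [Fin.mk_lt_mk]
      omega)
    rw [Fin.lt_def] at h2
    omega

/-- The `i`-th entry of the strictly decreasing sequence `λ + (k - 1, …, 1, 0)`. -/
def shiftedRow (k : ℕ) (μ : YoungDiagram) (i : ℕ) : ℕ := μ.rowLen i + (k - 1 - i)

theorem rowBead_add_eq_shiftedRow {k i : ℕ} (μ : YoungDiagram) (hi : i < k) :
    rowBead μ i + k = shiftedRow k μ i := by
  rw [rowBead, shiftedRow]
  omega

/-- A sum over the diagrams in a `k × n`-box is a sum over strictly decreasing sequences. -/
theorem sum_boxDiagrams (k n : ℕ) (Φ : (Fin k → ℕ) → ℝ) :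
    ∑ μ ∈ boxDiagrams k n, Φ (fun i => shiftedRow k μ i) =
      ∑ p : Fin k → Fin (n + k) with StrictAnti p, Φ (fun i => p i) := by
  classical
  refine sum_bij (fun μ hμ => fun i : Fin k => ⟨shiftedRow k μ i, ?_⟩) ?_ ?_ ?_ ?_
  · have h1 := (mem_boxDiagrams.1 hμ).2
    have h2 := μ.rowLen_anti 0 i (Nat.zero_le _)
    have := i.2
    rw [shiftedRow]
    omega
  · intro μ hμ
    rw [mem_filter]
    refine ⟨mem_univ _, fun i j hij => ?_⟩
    rw [Fin.mk_lt_mk, shiftedRow, shiftedRow]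
    have h1 := μ.rowLen_anti i j hij.le
    rw [Fin.lt_def] at hij
    have := j.2
    omega
  · intro μ hμ ν hν heq
    have hrow : ∀ i, μ.rowLen i = ν.rowLen i := by
      intro i
      by_cases hi : i < k
      · have := congrFun heq ⟨i, hi⟩
        rw [Fin.mk.injEq, shiftedRow, shiftedRow] at this
        simp only at this
        omega
      · have h1 := (mem_boxDiagrams.1 hμ).1
        have h2 := (mem_boxDiagrams.1 hν).1
        rw [(rowLen_eq_zero_iff μ i).2 (by omega), (rowLen_eq_zero_iff ν i).2 (by omega)]
    ext ⟨i, j⟩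
    rw [YoungDiagram.mem_cells, YoungDiagram.mem_cells, YoungDiagram.mem_iff_lt_rowLen,
      YoungDiagram.mem_iff_lt_rowLen, hrow]
  · intro p hp
    rw [mem_filter] at hp
    -- The staircase is subtracted again; by `hge` the subtraction does not truncate.
    let a : ℕ → ℕ := fun i => if hi : i < k then (p ⟨i, hi⟩ : ℕ) - (k - 1 - i) else 0
    have haval : ∀ i (hi : i < k), a i = (p ⟨i, hi⟩ : ℕ) - (k - 1 - i) := fun i hi => dif_pos hi
    have ha : Antitone a := by
      intro i j hij
      by_cases hj : j < k
      · rw [haval i (by omega), haval j hj]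
        have := add_le_of_strictAnti hp.2 i (j - i) (by omega)
        simp only [Nat.add_sub_cancel' hij] at this
        omega
      · have : a j = 0 := dif_neg hj
        omega
    have hk : a k = 0 := dif_neg (lt_irrefl k)
    have hge : ∀ i (hi : i < k), k - 1 - i ≤ (p ⟨i, hi⟩ : ℕ) := by
      intro i hi
      have := add_le_of_strictAnti hp.2 i (k - 1 - i) (by omega)
      omega
    refine ⟨ofRowLen a ha k, ?_, ?_⟩
    · rw [mem_boxDiagrams, ← rowLen_eq_zero_iff, rowLen_ofRowLen ha hk, rowLen_ofRowLen ha hk]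
      refine ⟨hk, ?_⟩
      by_cases h0 : 0 < k
      · rw [haval 0 h0]
        have := (p ⟨0, h0⟩).2
        omega
      · have : a 0 = 0 := dif_neg h0
        omega
    · funext i
      apply Fin.ext
      simp only
      rw [shiftedRow, rowLen_ofRowLen ha hk, haval i i.2]
      have := hge i i.2
      simp only [Fin.eta] at this ⊢
      omega
  · intro μ hμ
    rfl

/-! ### Andréief's identity -/

section Gram

variable {k R : ℕ}

theorem det_eq_zero_of_not_injective (u : Fin k → Fin R → ℝ) {p : Fin k → Fin R}
    (hp : ¬ Function.Injective p) : (Matrix.of fun i j => u j (p i)).det = 0 := by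
  rw [Function.Injective] at hp
  push Not at hp
  obtain ⟨i, j, hij, hne⟩ := hp
  exact Matrix.det_zero_of_row_eq hne (by
    funext l
    simp [hij])

/-- A symmetric function which vanishes on the sequences with a repeated entry. -/
theorem sum_eq_factorial_mul_sum_strictAnti (Ψ : (Fin k → Fin R) → ℝ)
    (hsymm : ∀ (p : Fin k → Fin R) (σ : Equiv.Perm (Fin k)), Ψ (p ∘ σ) = Ψ p)
    (hinj : ∀ p, ¬ Function.Injective p → Ψ p = 0) :
    ∑ p, Ψ p = (k.factorial : ℝ) * ∑ p : Fin k → Fin R with StrictAnti p, Ψ p := by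
  classical
  -- Each injective sequence is a rearrangement of exactly one strictly decreasing sequence, by
  -- exactly one permutation.
  have h1 : ∑ x ∈ (univ : Finset (Equiv.Perm (Fin k))) ×ˢ
      (univ.filter fun p : Fin k → Fin R => StrictAnti p), Ψ (x.2 ∘ x.1) =
      ∑ p : Fin k → Fin R with Function.Injective p, Ψ p := by
    refine sum_bij (fun x _ => x.2 ∘ x.1) ?_ ?_ ?_ ?_
    · rintro ⟨σ, p⟩ hx
      simp only [mem_product, mem_filter, mem_univ, true_and] at hx ⊢
      exact hx.injective.comp σ.injective
    · rintro ⟨σ, p⟩ hx ⟨τ, q⟩ hy hxy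
      simp only [mem_product, mem_filter, mem_univ, true_and] at hx hy hxy
      have e1 : (p ∘ σ) ∘ (σ⁻¹ : Equiv.Perm (Fin k)) = p := by
        funext i
        simp
      have e2 : (p ∘ σ) ∘ (τ⁻¹ : Equiv.Perm (Fin k)) = q := by
        rw [hxy]
        funext i
        simp
      have hpq : p = q := by
        have := Tuple.unique_antitone (f := p ∘ σ) (σ := σ⁻¹) (τ := τ⁻¹)
          (by rw [e1]; exact hx.antitone) (by rw [e2]; exact hy.antitone)
        rwa [e1, e2] at this
      subst hpq
      rw [Prod.mk.injEq]
      refine ⟨?_, rfl⟩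
      ext i
      exact congrArg Fin.val (hx.injective (congrFun hxy i))
    · intro p hp
      simp only [mem_filter, mem_univ, true_and] at hp
      set τ : Equiv.Perm (Fin k) := Fin.revPerm.trans (Tuple.sort p) with hτ
      have hanti : Antitone (p ∘ τ) := by
        intro i j hij
        exact Tuple.monotone_sort p (Fin.rev_le_rev.2 hij)
      refine ⟨(τ⁻¹, p ∘ τ), ?_, ?_⟩
      · simp only [mem_product, mem_filter, mem_univ, true_and]
        exact hanti.strictAnti_of_injective (hp.comp τ.injective)
      · funext i
        simp
    · intro x _
      rfl
  have h2 : ∑ p, Ψ p = ∑ p : Fin k → Fin R with Function.Injective p, Ψ p := by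
    rw [sum_filter]
    refine sum_congr rfl fun p _ => ?_
    split_ifs with h
    · rfl
    · exact hinj p h
  rw [h2, ← h1, sum_product]
  simp only [hsymm, sum_const, card_univ, Fintype.card_perm, Fintype.card_fin, nsmul_eq_mul]

theorem prod_comp_perm (ω : Fin R → ℝ) (p : Fin k → Fin R) (σ : Equiv.Perm (Fin k)) :
    ∏ i, ω ((p ∘ σ) i) = ∏ i, ω (p i) :=
  Equiv.prod_comp σ (fun i => ω (p i))

theorem det_comp_perm (u : Fin k → Fin R → ℝ) (p : Fin k → Fin R) (σ : Equiv.Perm (Fin k)) :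
    (Matrix.of fun i j => u j ((p ∘ σ) i)).det =
      (Equiv.Perm.sign σ : ℤ) * (Matrix.of fun i j => u j (p i)).det :=
  Matrix.det_permute σ (Matrix.of fun i j => u j (p i))

/-- Multilinearity: in the Leibniz formula of the Gram determinant each product of sums becomes a
sum over all `p`. -/
theorem sum_prod_mul_det (ω : Fin R → ℝ) (u : Fin k → Fin R → ℝ) :
    ∑ p : Fin k → Fin R, (∏ i, ω (p i) * u i (p i)) * (Matrix.of fun i j => u j (p i)).det =
      (Matrix.of fun i j => ∑ x, ω x * u i x * u j x).det := by
  rw [← Matrix.det_transpose (Matrix.of fun i j => ∑ x, ω x * u i x * u j x), Matrix.det_apply']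
  simp only [Matrix.transpose_apply, Matrix.of_apply, prod_univ_sum, Fintype.piFinset_univ]
  simp only [mul_sum]
  rw [sum_comm]
  refine sum_congr rfl fun p _ => ?_
  rw [← Matrix.det_transpose, Matrix.det_apply', mul_sum]
  refine sum_congr rfl fun σ _ => ?_
  simp only [Matrix.transpose_apply, Matrix.of_apply, prod_mul_distrib]
  ring

/-- Andréief's identity, for finitely many points. -/
theorem sum_strictAnti_det_sq (ω : Fin R → ℝ) (u : Fin k → Fin R → ℝ) :
    ∑ p : Fin k → Fin R with StrictAnti p,
        (∏ i, ω (p i)) * (Matrix.of fun i j => u j (p i)).det ^ 2 =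
      (Matrix.of fun i j => ∑ x, ω x * u i x * u j x).det := by
  have hk : (k.factorial : ℝ) ≠ 0 := Nat.cast_ne_zero.2 k.factorial_ne_zero
  have hsign : ∀ σ : Equiv.Perm (Fin k),
      ((Equiv.Perm.sign σ : ℤ) : ℝ) * ((Equiv.Perm.sign σ : ℤ) : ℝ) = 1 := by
    intro σ
    rw [← Int.cast_mul, Int.units_coe_mul_self, Int.cast_one]
  apply mul_left_cancel₀ hk
  rw [← sum_eq_factorial_mul_sum_strictAnti
    (fun p => (∏ i, ω (p i)) * (Matrix.of fun i j => u j (p i)).det ^ 2)]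
  · rw [← sum_prod_mul_det]
    -- One of the two determinants is expanded and the sign of `σ` is absorbed into the other. After
    -- reindexing by `σ`, all `k!` permutations contribute the same sum.
    have h1 : ∀ p : Fin k → Fin R, (∏ i, ω (p i)) * (Matrix.of fun i j => u j (p i)).det ^ 2 =
        ∑ σ : Equiv.Perm (Fin k), (∏ i, ω ((p ∘ σ) i) * u i ((p ∘ σ) i)) *
          (Matrix.of fun i j => u j ((p ∘ σ) i)).det := by
      intro p
      have : (Matrix.of fun i j => u j (p i)).det ^ 2 =
          (Matrix.of fun i j => u j (p i)).det *
          ∑ σ : Equiv.Perm (Fin k), ((Equiv.Perm.sign σ : ℤ) : ℝ) * ∏ i, u i (p (σ i)) := by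
        rw [sq]
        congr 1
        rw [Matrix.det_apply']
        rfl
      rw [this, mul_sum, mul_sum]
      refine sum_congr rfl fun σ _ => ?_
      rw [det_comp_perm, prod_mul_distrib, prod_comp_perm]
      simp only [Function.comp_apply]
      ring
    rw [sum_congr rfl (fun p _ => h1 p), sum_comm]
    have h2 : ∀ σ : Equiv.Perm (Fin k),
        ∑ p : Fin k → Fin R, (∏ i, ω ((p ∘ σ) i) * u i ((p ∘ σ) i)) *
          (Matrix.of fun i j => u j ((p ∘ σ) i)).det =
        ∑ p : Fin k → Fin R, (∏ i, ω (p i) * u i (p i)) *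
          (Matrix.of fun i j => u j (p i)).det := by
      intro σ
      exact Equiv.sum_comp (Equiv.arrowCongr σ.symm (Equiv.refl (Fin R)))
        (fun p : Fin k → Fin R => (∏ i, ω (p i) * u i (p i)) *
          (Matrix.of fun i j => u j (p i)).det)
    rw [sum_congr rfl (fun σ _ => h2 σ), sum_const, card_univ, Fintype.card_perm,
      Fintype.card_fin, nsmul_eq_mul]
  · intro p σ
    rw [det_comp_perm, mul_pow, sq ((Equiv.Perm.sign σ : ℤ) : ℝ), hsign, one_mul, prod_comp_perm]
  · intro p hp
    rw [det_eq_zero_of_not_injective u hp]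
    ring

end Gram

/-! ### Chebyshev-type polynomials and the Vandermonde determinant -/

open Polynomial in
/-- The monic polynomials with `P_1 = X + c` and `P_{j+2} = X P_{j+1} - P_j`. -/
noncomputable def recPoly (c : ℝ) : ℕ → ℝ[X]
  | 0 => 1
  | 1 => X + C c
  | j + 2 => X * recPoly c (j + 1) - recPoly c j

open Polynomial in
theorem recPoly_monic_natDegree (c : ℝ) (j : ℕ) :
    (recPoly c j).Monic ∧ (recPoly c j).natDegree = j := by
  induction j using Nat.twoStepInduction with
  | zero => exact ⟨monic_one, natDegree_one⟩
  | one => exact ⟨monic_X_add_C c, natDegree_X_add_C c⟩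
  | more j h1 h2 =>
    rw [recPoly]
    have hX : (X * recPoly c (j + 1)).Monic := monic_X.mul h2.1
    have hdeg : (X * recPoly c (j + 1)).natDegree = j + 2 := by
      rw [monic_X.natDegree_mul h2.1, natDegree_X, h2.2]
      ring
    have hlt : (recPoly c j).degree < (X * recPoly c (j + 1)).degree := by
      rw [degree_eq_natDegree h1.1.ne_zero, degree_eq_natDegree hX.ne_zero, hdeg, h1.2]
      exact_mod_cast (by omega : j < j + 2)
    refine ⟨hX.sub_of_left hlt, ?_⟩
    rw [natDegree_sub_eq_left_of_natDegree_lt, hdeg]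
    rw [hdeg, h1.2]
    omega

/-- The ratios `u j / u 0` will be Chebyshev polynomials of the second, third and fourth kind, for
`c = 0, -1, 1`. Without division, nothing is needed about zeros of `u 0`. -/
theorem eval_recPoly {c y : ℝ} {u : ℕ → ℝ} (h1 : u 1 = (y + c) * u 0)
    (h2 : ∀ j, u (j + 2) = y * u (j + 1) - u j) (j : ℕ) :
    u j = u 0 * (recPoly c j).eval y := by
  induction j using Nat.twoStepInduction with
  | zero => simp [recPoly]
  | one => simp [recPoly, h1, mul_comm]
  | more j ih1 ih2 =>
    rw [h2, ih1, ih2, recPoly]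
    simp
    ring

theorem prod_univ_Ioi_eq (k : ℕ) (F : ℕ → ℕ → ℝ) :
    ∏ i : Fin k, ∏ j ∈ Ioi i, F i j = ∏ i ∈ range k, ∏ j ∈ Ico (i + 1) k, F i j := by
  rw [← Fin.prod_univ_eq_prod_range (fun i => ∏ j ∈ Ico (i + 1) k, F i j)]
  refine prod_congr rfl fun i _ => ?_
  refine prod_bij (fun j _ => (j : ℕ)) ?_ ?_ ?_ ?_
  · intro j hj
    rw [mem_Ioi, Fin.lt_def] at hj
    rw [mem_Ico]
    exact ⟨hj, j.2⟩
  · intro a _ b _ hab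
    exact Fin.ext hab
  · intro j hj
    rw [mem_Ico] at hj
    exact ⟨⟨j, hj.2⟩, mem_Ioi.2 (Fin.lt_def.2 hj.1), rfl⟩
  · intro j _
    rfl

/-- The sum over the diagrams in a box of squared Vandermonde determinants is a Gram determinant. -/
theorem sum_boxDiagrams_eq_det (k n : ℕ) (ω y : ℕ → ℝ) (c : ℝ) (u : ℕ → ℕ → ℝ)
    (h1 : ∀ x, u 1 x = (y x + c) * u 0 x)
    (h2 : ∀ j x, u (j + 2) x = y x * u (j + 1) x - u j x) :
    ∑ μ ∈ boxDiagrams k n, (∏ i ∈ range k, (ω (shiftedRow k μ i) *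
        u 0 (shiftedRow k μ i) ^ 2)) *
        ∏ i ∈ range k, ∏ j ∈ Ico (i + 1) k,
          (y (shiftedRow k μ i) - y (shiftedRow k μ j)) ^ 2 =
      (Matrix.of fun i j : Fin k => ∑ x ∈ range (n + k), ω x * u i x * u j x).det := by
  have hsum := sum_boxDiagrams k n (fun p => (∏ i, (ω (p i) * u 0 (p i) ^ 2)) *
    ∏ i, ∏ j ∈ Ioi i, (y (p i) - y (p j)) ^ 2)
  have hl : ∀ μ : YoungDiagram, (∏ i ∈ range k, (ω (shiftedRow k μ i) *
        u 0 (shiftedRow k μ i) ^ 2)) *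
        ∏ i ∈ range k, ∏ j ∈ Ico (i + 1) k,
          (y (shiftedRow k μ i) - y (shiftedRow k μ j)) ^ 2 =
      (∏ i : Fin k, (ω (shiftedRow k μ i) * u 0 (shiftedRow k μ i) ^ 2)) *
        ∏ i : Fin k, ∏ j ∈ Ioi i,
          (y (shiftedRow k μ i) - y (shiftedRow k μ j)) ^ 2 := by
    intro μ
    rw [prod_univ_Ioi_eq k (fun i j => (y (shiftedRow k μ i) -
      y (shiftedRow k μ j)) ^ 2), Fin.prod_univ_eq_prod_range (fun i =>
      ω (shiftedRow k μ i) * u 0 (shiftedRow k μ i) ^ 2)]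
  rw [sum_congr rfl (fun μ _ => hl μ), hsum]
  have hgram := sum_strictAnti_det_sq (k := k) (R := n + k) (fun x => ω x) (fun j x => u j x)
  have hr : (Matrix.of fun i j : Fin k => ∑ x ∈ range (n + k), ω x * u i x * u j x) =
      Matrix.of fun i j : Fin k => ∑ x : Fin (n + k), ω x * u i x * u j x := by
    ext i j
    simp only [Matrix.of_apply]
    rw [Fin.sum_univ_eq_sum_range (fun x => ω x * u i x * u j x)]
  rw [hr, ← hgram]
  refine sum_congr rfl fun p _ => ?_
  -- Once `u 0` is taken out of each row, the entries are values of monic polynomials of degrees `0,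
  -- …, k - 1`, so the determinant is Vandermonde's.
  have hdet : (Matrix.of fun i j : Fin k => u j (p i)).det =
      (∏ i, u 0 (p i)) * ∏ i : Fin k, ∏ j ∈ Ioi i, (y (p j) - y (p i)) := by
    rw [← Matrix.det_vandermonde (fun i : Fin k => y (p i)),
      Matrix.det_eval_matrixOfPolynomials_eq_det_vandermonde (fun i : Fin k => y (p i))
        (fun j : Fin k => recPoly c j) (fun j => (recPoly_monic_natDegree c j).2)
        (fun j => (recPoly_monic_natDegree c j).1), ← Matrix.det_mul_column]
    congr 1
    ext i j
    simp only [Matrix.of_apply]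
    exact eval_recPoly (u := fun j => u j (p i)) (h1 _) (fun j => h2 j _) j
  rw [hdet, mul_pow, prod_mul_distrib, prod_pow, mul_assoc]
  congr 2
  rw [← prod_pow]
  refine prod_congr rfl fun i _ => ?_
  rw [← prod_pow]
  refine prod_congr rfl fun j _ => ?_
  ring

/-! ### Trigonometric sums over the nodes -/

open Real

/-- The number `4 sin²(nπ/ℓ)`. -/
noncomputable def sinSq (ℓ : ℕ) (n : ℤ) : ℝ := 4 * sin (n * π / ℓ) ^ 2

theorem sinSq_neg (ℓ : ℕ) (n : ℤ) : sinSq ℓ (-n) = sinSq ℓ n := by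
  rw [sinSq, sinSq]
  push_cast
  rw [show -(n : ℝ) * π / ℓ = -(n * π / ℓ) by ring, sin_neg, neg_sq]

theorem sin_int_mul_ne_zero {ℓ : ℕ} {n : ℤ} (h0 : n ≠ 0) (h1 : -ℓ < n) (h2 : n < ℓ) :
    sin (n * (π / ℓ)) ≠ 0 := by
  have hℓ : (0 : ℝ) < ℓ := by exact_mod_cast (by omega : 0 < (ℓ : ℤ))
  have hb : ∀ m : ℤ, 0 < m → m < ℓ → 0 < sin (m * (π / ℓ)) := by
    intro m hm hm'
    apply sin_pos_of_pos_of_lt_pi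
    · have : (0 : ℝ) < m := by exact_mod_cast hm
      positivity
    · have : (m : ℝ) < ℓ := by exact_mod_cast hm'
      rw [mul_div_assoc', div_lt_iff₀ hℓ, mul_comm]
      exact mul_lt_mul_of_pos_left this pi_pos
  rcases lt_or_gt_of_ne h0 with h | h
  · have := hb (-n) (by omega) (by omega)
    push_cast at this
    rw [neg_mul, sin_neg] at this
    linarith
  · exact (hb n h h2).ne'

theorem sinSq_ne_zero {ℓ : ℕ} {n : ℤ} (h0 : 0 < n) (h1 : n < ℓ) : sinSq ℓ n ≠ 0 := by
  rw [sinSq, mul_div_assoc]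
  have := sin_int_mul_ne_zero (ℓ := ℓ) h0.ne' (by omega) h1
  positivity

/-- The formula for a difference of cosines; it makes the pair product a squared Vandermonde
determinant. -/
theorem sinSq_mul_sinSq (ℓ : ℕ) (δ : ℤ) (a b : ℤ) :
    sinSq ℓ (a - b) * sinSq ℓ (a + b + δ) =
      (2 * cos ((2 * a + δ) * (π / ℓ)) - 2 * cos ((2 * b + δ) * (π / ℓ))) ^ 2 := by
  rw [sinSq, sinSq]
  push_cast
  rw [← mul_sub, cos_sub_cos,
    show ((2 * a + δ) * (π / ℓ) + (2 * b + δ) * (π / ℓ)) / 2 = ((a : ℝ) + b + δ) * π / ℓ by ring,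
    show ((2 * a + δ) * (π / ℓ) - (2 * b + δ) * (π / ℓ)) / 2 = ((a : ℝ) - b) * π / ℓ by ring]
  ring

theorem sinSq_two_mul (ℓ : ℕ) (n : ℤ) :
    sinSq ℓ (2 * n) = sinSq ℓ n * (2 * cos (n * (π / ℓ))) ^ 2 := by
  rw [sinSq, sinSq]
  push_cast
  rw [show 2 * (n : ℝ) * π / ℓ = 2 * (n * (π / ℓ)) by ring, sin_two_mul, mul_div_assoc]
  ring

theorem two_mul_sin_mul_sum_cos_odd (φ : ℝ) (R : ℕ) :
    2 * sin φ * ∑ x ∈ range R, cos ((2 * x + 1) * φ) = sin (2 * R * φ) := by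
  induction R with
  | zero => simp
  | succ R ih =>
    rw [sum_range_succ, mul_add, ih]
    push_cast
    rw [show 2 * ((R : ℝ) + 1) * φ = (2 * R + 1) * φ + φ by ring,
      show 2 * (R : ℝ) * φ = (2 * R + 1) * φ - φ by ring, sin_add, sin_sub]
    ring

theorem two_mul_sin_mul_sum_cos_even (φ : ℝ) (R : ℕ) :
    2 * sin φ * ∑ x ∈ range R, cos (2 * x * φ) = sin ((2 * R - 1) * φ) + sin φ := by
  induction R with
  | zero => simp
  | succ R ih =>
    rw [sum_range_succ, mul_add, ih]
    push_cast
    rw [show (2 * ((R : ℝ) + 1) - 1) * φ = 2 * R * φ + φ by ring,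
      show (2 * (R : ℝ) - 1) * φ = 2 * R * φ - φ by ring, sin_add, sin_sub]
    ring

theorem cos_add_int_mul_two_pi' (a b : ℤ) : cos ((a + b) * π) = cos ((a - b) * π) := by
  rw [show ((a : ℝ) + b) * π = (a - b) * π + b * (2 * π) by ring, cos_add_int_mul_two_pi]

section Sums

variable {ℓ R : ℕ} {c : ℤ}

/-- For `0 < |c| < ℓ` the factor `sin(cπ/ℓ)` cancels from the telescoped sum. The value depends only
on the parity of `c`, which is the source of all orthogonality relations below. -/
theorem sum_cos_odd (hℓ : ℓ = 2 * R + 1) (h0 : c ≠ 0) (h1 : -ℓ < c) (h2 : c < ℓ) :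
    ∑ x ∈ range R, cos ((2 * x + 1) * (c * (π / ℓ))) = - cos (c * π) / 2 := by
  have hs := sin_int_mul_ne_zero h0 h1 h2
  have hℓ0 : (ℓ : ℝ) ≠ 0 := by
    rw [hℓ]
    positivity
  have h := two_mul_sin_mul_sum_cos_odd (c * (π / ℓ)) R
  have e : 2 * (R : ℝ) * (c * (π / ℓ)) = c * π - c * (π / ℓ) := by
    have : (2 : ℝ) * R = ℓ - 1 := by
      rw [hℓ]
      push_cast
      ring
    rw [this]
    field_simp
  rw [e, sin_sub, sin_int_mul_pi] at h
  have := mul_left_cancel₀ hs (a := sin (c * (π / ℓ)))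
    (b := 2 * ∑ x ∈ range R, cos ((2 * x + 1) * (c * (π / ℓ)))) (c := - cos (c * π)) (by linarith)
  linarith

theorem sum_cos_even_of_odd (hℓ : ℓ = 2 * R + 1) (h0 : c ≠ 0) (h1 : -ℓ < c) (h2 : c < ℓ) :
    ∑ x ∈ range R, cos (2 * (x + 1 : ℕ) * (c * (π / ℓ))) = - 1 / 2 := by
  have hs := sin_int_mul_ne_zero h0 h1 h2
  have hℓ0 : (ℓ : ℝ) ≠ 0 := by
    rw [hℓ]
    positivity
  have h := two_mul_sin_mul_sum_cos_even (c * (π / ℓ)) (R + 1)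
  have e : (2 * ((R + 1 : ℕ) : ℝ) - 1) * (c * (π / ℓ)) = c * π := by
    have : 2 * ((R + 1 : ℕ) : ℝ) - 1 = ℓ := by
      rw [hℓ]
      push_cast
      ring
    rw [this]
    field_simp
  rw [e, sin_int_mul_pi, sum_range_succ', Nat.cast_zero, mul_zero, zero_mul, cos_zero] at h
  have := mul_left_cancel₀ hs (a := sin (c * (π / ℓ)))
    (b := 2 * (∑ x ∈ range R, cos (2 * (x + 1 : ℕ) * (c * (π / ℓ))) + 1)) (c := 1) (by linarith)
  linarith

theorem sum_cos_even_of_even (hℓ : ℓ = 2 * R) (h0 : c ≠ 0) (h1 : -ℓ < c) (h2 : c < ℓ) :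
    ∑ x ∈ range R, cos (2 * x * (c * (π / ℓ))) = (1 - cos (c * π)) / 2 := by
  have hs := sin_int_mul_ne_zero h0 h1 h2
  have hℓ0 : (ℓ : ℝ) ≠ 0 := by exact_mod_cast (by omega : (ℓ : ℤ) ≠ 0)
  have h := two_mul_sin_mul_sum_cos_even (c * (π / ℓ)) R
  have e : (2 * (R : ℝ) - 1) * (c * (π / ℓ)) = c * π - c * (π / ℓ) := by
    have : (2 : ℝ) * R = ℓ := by
      rw [hℓ]
      push_cast
      ring
    rw [this]
    field_simp
  rw [e, sin_sub, sin_int_mul_pi] at h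
  have := mul_left_cancel₀ hs (a := sin (c * (π / ℓ)))
    (b := 2 * ∑ x ∈ range R, cos (2 * x * (c * (π / ℓ)))) (c := 1 - cos (c * π)) (by linarith)
  linarith

/-- The weight which is `1/2` at `a` and `1` elsewhere. -/
noncomputable def halfAt (a x : ℕ) : ℝ := if x = a then 1 / 2 else 1

theorem sum_halfAt {a : ℕ} (ha : a < R) (F : ℕ → ℝ) :
    ∑ x ∈ range R, halfAt a x * F x = ∑ x ∈ range R, F x - F a / 2 := by
  have : ∀ x, halfAt a x * F x = F x - if x = a then F x / 2 else 0 := by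
    intro x
    rw [halfAt]
    split_ifs <;> ring
  rw [sum_congr rfl (fun x _ => this x), sum_sub_distrib, sum_ite_eq', if_pos (mem_range.2 ha)]

/-- As in the trapezoidal rule, halving the end node gives for even `ℓ` the values known for odd
`ℓ`: here that of `sum_cos_odd`, and in `sum_halfAt_last_cos` that of `sum_cos_even_of_odd`. -/
theorem sum_halfAt_zero_cos (hℓ : ℓ = 2 * R) (h0 : c ≠ 0) (h1 : -ℓ < c) (h2 : c < ℓ) :
    ∑ x ∈ range R, halfAt 0 x * cos (2 * x * (c * (π / ℓ))) = - cos (c * π) / 2 := by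
  rw [sum_halfAt (by omega), sum_cos_even_of_even hℓ h0 h1 h2]
  simp
  ring

theorem sum_halfAt_last_cos (hℓ : ℓ = 2 * R) (h0 : c ≠ 0) (h1 : -ℓ < c) (h2 : c < ℓ) :
    ∑ x ∈ range R, halfAt (R - 1) x * cos (2 * (x + 1 : ℕ) * (c * (π / ℓ))) = - 1 / 2 := by
  have hR : 0 < R := by omega
  have hℓ0 : (ℓ : ℝ) ≠ 0 := by exact_mod_cast (by omega : (ℓ : ℤ) ≠ 0)
  rw [sum_halfAt (by omega), Nat.sub_add_cancel hR]
  have h := sum_cos_even_of_even hℓ h0 h1 h2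
  have h' := sum_range_succ' (fun x : ℕ => cos (2 * x * (c * (π / ℓ)))) R
  rw [sum_range_succ, h, Nat.cast_zero, mul_zero, zero_mul, cos_zero] at h'
  have e : 2 * (R : ℝ) * (c * (π / ℓ)) = c * π := by
    have : (2 : ℝ) * R = ℓ := by
      rw [hℓ]
      push_cast
      ring
    rw [this]
    field_simp
  rw [e] at h' ⊢
  linarith

end Sums

/-! ### Evaluation of the Gram determinants -/

theorem det_of_eq_ite {k : ℕ} {M : Fin k → Fin k → ℝ} {d : ℝ}
    (h : ∀ i j, M i j = if i = j then d else 0) : (Matrix.of M).det = d ^ k := by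
  have : Matrix.of M = Matrix.diagonal fun _ => d := by
    ext i j
    rw [Matrix.of_apply, h, Matrix.diagonal_apply]
  rw [this, Matrix.det_diagonal, prod_const, card_univ, Fintype.card_fin]

theorem sin_add_eq (t φ : ℝ) : sin (t + φ) = 2 * cos φ * sin t - sin (t - φ) := by
  rw [sin_add, sin_sub]
  ring

theorem cos_add_eq (t φ : ℝ) : cos (t + φ) = 2 * cos φ * cos t - cos (t - φ) := by
  rw [cos_add, cos_sub]
  ring

/-- The product of the `(y(p_i) - y(p_j))²`. -/
def diffProd (k : ℕ) (y : ℕ → ℝ) (μ : YoungDiagram) : ℝ :=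
  ∏ i ∈ range k, ∏ j ∈ Ico (i + 1) k, (y (shiftedRow k μ i) - y (shiftedRow k μ j)) ^ 2

section Odd

variable {ℓ k n : ℕ}

/-- Type `B`. A product of two sines is a difference of cosines of frequencies `a - b` and `a + b +
2`. These have equal parity, so off the diagonal the sums cancel; on it they give `2(n + k) + 1 =
ℓ`. -/
theorem sum_box_sin_odd (hℓ : ℓ = 2 * (n + k) + 1) :
    ∑ μ ∈ boxDiagrams k n, (∏ i ∈ range k, sinSq ℓ (2 * shiftedRow k μ i + 1)) *
      diffProd k (fun x => 2 * cos ((2 * x + 1) * (π / ℓ))) μ = (ℓ : ℝ) ^ k := by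
  have key := sum_boxDiagrams_eq_det k n (fun _ => 1) (fun x => 2 * cos ((2 * x + 1) * (π / ℓ))) 0
    (fun j x => 2 * sin ((j + 1) * ((2 * x + 1) * (π / ℓ)))) (fun x => by
      rw [show ((1 : ℕ) + 1 : ℝ) * ((2 * x + 1) * (π / ℓ)) =
        2 * ((2 * x + 1) * (π / ℓ)) by push_cast; ring, sin_two_mul]
      push_cast
      rw [zero_add, one_mul]
      ring) (fun j x => by
      rw [show ((j + 2 : ℕ) + 1 : ℝ) * ((2 * x + 1) * (π / ℓ)) =
        ((j + 1 : ℕ) + 1) * ((2 * x + 1) * (π / ℓ)) + (2 * x + 1) * (π / ℓ) by push_cast; ring,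
        sin_add_eq, show ((j + 1 : ℕ) + 1 : ℝ) * ((2 * x + 1) * (π / ℓ)) - (2 * x + 1) * (π / ℓ) =
        (j + 1) * ((2 * x + 1) * (π / ℓ)) by push_cast; ring]
      ring)
  rw [det_of_eq_ite (d := ℓ)] at key
  · rw [← key]
    refine sum_congr rfl fun μ _ => ?_
    rw [diffProd]
    congr 1
    refine prod_congr rfl fun i _ => ?_
    rw [sinSq]
    push_cast
    rw [show (2 * (shiftedRow k μ i : ℝ) + 1) * π / ℓ =
      (0 + 1) * ((2 * (shiftedRow k μ i : ℝ) + 1) * (π / ℓ)) by ring]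
    ring
  · intro a b
    have e : ∀ x : ℕ, 1 * (2 * sin (((a : ℕ) + 1) * ((2 * x + 1) * (π / ℓ)))) *
        (2 * sin (((b : ℕ) + 1) * ((2 * x + 1) * (π / ℓ)))) =
        2 * cos ((2 * x + 1) * (((a - b : ℤ) : ℝ) * (π / ℓ))) -
        2 * cos ((2 * x + 1) * (((a + b + 2 : ℤ) : ℝ) * (π / ℓ))) := by
      intro x
      push_cast
      rw [show (2 * (x : ℝ) + 1) * (((a : ℕ) - (b : ℕ)) * (π / ℓ)) =
        ((a : ℕ) + 1) * ((2 * x + 1) * (π / ℓ)) - ((b : ℕ) + 1) * ((2 * x + 1) * (π / ℓ)) by ring,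
        show (2 * (x : ℝ) + 1) * (((a : ℕ) + (b : ℕ) + 2) * (π / ℓ)) =
        ((a : ℕ) + 1) * ((2 * x + 1) * (π / ℓ)) + ((b : ℕ) + 1) * ((2 * x + 1) * (π / ℓ)) by ring,
        cos_sub, cos_add]
      ring
    have ha := a.2
    have hb := b.2
    rw [sum_congr rfl (fun x _ => e x), sum_sub_distrib, ← mul_sum, ← mul_sum,
      sum_cos_odd (c := (a + b + 2 : ℤ)) (by omega) (by omega) (by omega) (by omega)]
    split_ifs with hab
    · subst hab
      rw [show cos ((((a : ℕ) + (a : ℕ) + 2 : ℤ) : ℝ) * π) = 1 by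
        rw [show (((a : ℕ) + (a : ℕ) + 2 : ℤ) : ℝ) * π = ((a : ℕ) + 1 : ℕ) * (2 * π) by
          push_cast
          ring, cos_nat_mul_two_pi]]
      simp
      rw [hℓ]
      push_cast
      ring
    · have hne : (a : ℕ) ≠ b := fun h => hab (Fin.ext h)
      rw [sum_cos_odd (c := (a - b : ℤ)) (by omega) (by omega) (by omega) (by omega),
        show ((a + b + 2 : ℤ) : ℝ) = ((a + 1 : ℤ) : ℝ) + ((b + 1 : ℤ) : ℝ) by push_cast; ring,
        cos_add_int_mul_two_pi',
        show ((a + 1 : ℤ) : ℝ) - ((b + 1 : ℤ) : ℝ) = ((a - b : ℤ) : ℝ) by push_cast; ring]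
      ring

theorem sin_rec_start (ψ : ℝ) : sin (3 * ψ) = (2 * cos (2 * ψ) + 1) * sin ψ := by
  rw [show 3 * ψ = ψ + 2 * ψ by ring, sin_add_eq, show ψ - 2 * ψ = -ψ by ring, sin_neg]
  ring

theorem cos_rec_start (ψ : ℝ) : cos (3 * ψ) = (2 * cos (2 * ψ) + -1) * cos ψ := by
  rw [show 3 * ψ = ψ + 2 * ψ by ring, cos_add_eq, show ψ - 2 * ψ = -ψ by ring, cos_neg]
  ring

/-- Type `C`, with the functions `sin((2j + 1)ψ)`. The weight `ω` is left free in order to cover odd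
`ℓ`, the halved end node and the alternating sum. -/
theorem sum_box_sin_eq_det (ℓ k n : ℕ) (ω : ℕ → ℝ) :
    ∑ μ ∈ boxDiagrams k n, (∏ i ∈ range k, (ω (shiftedRow k μ i) *
      sinSq ℓ (shiftedRow k μ i + 1))) *
      diffProd k (fun x => 2 * cos ((2 * x + 2) * (π / ℓ))) μ =
    (Matrix.of fun a b : Fin k => 2 * (∑ x ∈ range (n + k), ω x *
        cos (2 * (x + 1 : ℕ) * (((a - b : ℤ) : ℝ) * (π / ℓ))) - ∑ x ∈ range (n + k), ω x *
        cos (2 * (x + 1 : ℕ) * (((a + b + 1 : ℤ) : ℝ) * (π / ℓ))))).det := by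
  have key := sum_boxDiagrams_eq_det k n ω (fun x => 2 * cos ((2 * x + 2) * (π / ℓ))) 1
    (fun j x => 2 * sin ((2 * j + 1) * ((x + 1) * (π / ℓ)))) (fun x => by
      rw [show (2 * (1 : ℕ) + 1 : ℝ) * ((x + 1) * (π / ℓ)) =
        3 * ((x + 1) * (π / ℓ)) by push_cast; ring, sin_rec_start,
        show 2 * (((x : ℝ) + 1) * (π / ℓ)) = (2 * x + 2) * (π / ℓ) by ring]
      push_cast
      rw [mul_zero, zero_add, one_mul]
      ring) (fun j x => by
      rw [show (2 * (j + 2 : ℕ) + 1 : ℝ) * ((x + 1) * (π / ℓ)) =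
        (2 * (j + 1 : ℕ) + 1) * ((x + 1) * (π / ℓ)) + (2 * x + 2) * (π / ℓ) by push_cast; ring,
        sin_add_eq, show (2 * (j + 1 : ℕ) + 1 : ℝ) * ((x + 1) * (π / ℓ)) - (2 * x + 2) * (π / ℓ) =
        (2 * j + 1) * ((x + 1) * (π / ℓ)) by push_cast; ring]
      ring)
  have hM : (Matrix.of fun a b : Fin k => ∑ x ∈ range (n + k),
      ω x * (2 * sin ((2 * (a : ℕ) + 1) * ((x + 1) * (π / ℓ)))) *
        (2 * sin ((2 * (b : ℕ) + 1) * ((x + 1) * (π / ℓ))))) =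
      Matrix.of fun a b : Fin k => 2 * (∑ x ∈ range (n + k), ω x *
        cos (2 * (x + 1 : ℕ) * (((a - b : ℤ) : ℝ) * (π / ℓ))) - ∑ x ∈ range (n + k), ω x *
        cos (2 * (x + 1 : ℕ) * (((a + b + 1 : ℤ) : ℝ) * (π / ℓ)))) := by
    ext a b
    rw [Matrix.of_apply, Matrix.of_apply, ← sum_sub_distrib, mul_sum]
    refine sum_congr rfl fun x _ => ?_
    push_cast
    rw [show 2 * ((x : ℝ) + 1) * (((a : ℕ) - (b : ℕ)) * (π / ℓ)) =
      (2 * (a : ℕ) + 1) * ((x + 1) * (π / ℓ)) - (2 * (b : ℕ) + 1) * ((x + 1) * (π / ℓ)) by ring,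
      show 2 * ((x : ℝ) + 1) * (((a : ℕ) + (b : ℕ) + 1) * (π / ℓ)) =
      (2 * (a : ℕ) + 1) * ((x + 1) * (π / ℓ)) + (2 * (b : ℕ) + 1) * ((x + 1) * (π / ℓ)) by ring,
      cos_sub, cos_add]
    ring
  rw [← hM, ← key]
  refine sum_congr rfl fun μ _ => ?_
  rw [diffProd]
  congr 1
  refine prod_congr rfl fun i _ => ?_
  rw [sinSq]
  push_cast
  rw [show ((shiftedRow k μ i : ℝ) + 1) * π / ℓ =
    (2 * 0 + 1) * (((shiftedRow k μ i : ℝ) + 1) * (π / ℓ)) by ring]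
  ring

/-- Type `D`, with the functions `cos((2j + 1)ψ)`. -/
theorem sum_box_cos_eq_det (ℓ k n : ℕ) (ω : ℕ → ℝ) :
    ∑ μ ∈ boxDiagrams k n, (∏ i ∈ range k, (ω (shiftedRow k μ i) *
      (2 * cos (shiftedRow k μ i * (π / ℓ))) ^ 2)) *
      diffProd k (fun x => 2 * cos (2 * x * (π / ℓ))) μ =
    (Matrix.of fun a b : Fin k => 2 * (∑ x ∈ range (n + k), ω x *
        cos (2 * x * (((a - b : ℤ) : ℝ) * (π / ℓ))) + ∑ x ∈ range (n + k), ω x *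
        cos (2 * x * (((a + b + 1 : ℤ) : ℝ) * (π / ℓ))))).det := by
  have key := sum_boxDiagrams_eq_det k n ω (fun x => 2 * cos (2 * x * (π / ℓ))) (-1)
    (fun j x => 2 * cos ((2 * j + 1) * (x * (π / ℓ)))) (fun x => by
      rw [show (2 * (1 : ℕ) + 1 : ℝ) * (x * (π / ℓ)) =
        3 * (x * (π / ℓ)) by push_cast; ring, cos_rec_start,
        show 2 * ((x : ℝ) * (π / ℓ)) = 2 * x * (π / ℓ) by ring]
      push_cast
      rw [mul_zero, zero_add, one_mul]
      ring) (fun j x => by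
      rw [show (2 * (j + 2 : ℕ) + 1 : ℝ) * (x * (π / ℓ)) =
        (2 * (j + 1 : ℕ) + 1) * (x * (π / ℓ)) + 2 * x * (π / ℓ) by push_cast; ring,
        cos_add_eq, show (2 * (j + 1 : ℕ) + 1 : ℝ) * (x * (π / ℓ)) - 2 * x * (π / ℓ) =
        (2 * j + 1) * (x * (π / ℓ)) by push_cast; ring]
      ring)
  have hM : (Matrix.of fun a b : Fin k => ∑ x ∈ range (n + k),
      ω x * (2 * cos ((2 * (a : ℕ) + 1) * (x * (π / ℓ)))) *
        (2 * cos ((2 * (b : ℕ) + 1) * (x * (π / ℓ))))) =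
      Matrix.of fun a b : Fin k => 2 * (∑ x ∈ range (n + k), ω x *
        cos (2 * x * (((a - b : ℤ) : ℝ) * (π / ℓ))) + ∑ x ∈ range (n + k), ω x *
        cos (2 * x * (((a + b + 1 : ℤ) : ℝ) * (π / ℓ)))) := by
    ext a b
    rw [Matrix.of_apply, Matrix.of_apply, ← sum_add_distrib, mul_sum]
    refine sum_congr rfl fun x _ => ?_
    push_cast
    rw [show 2 * (x : ℝ) * (((a : ℕ) - (b : ℕ)) * (π / ℓ)) =
      (2 * (a : ℕ) + 1) * (x * (π / ℓ)) - (2 * (b : ℕ) + 1) * (x * (π / ℓ)) by ring,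
      show 2 * (x : ℝ) * (((a : ℕ) + (b : ℕ) + 1) * (π / ℓ)) =
      (2 * (a : ℕ) + 1) * (x * (π / ℓ)) + (2 * (b : ℕ) + 1) * (x * (π / ℓ)) by ring,
      cos_sub, cos_add]
    ring
  rw [← hM, ← key]
  refine sum_congr rfl fun μ _ => ?_
  rw [diffProd]
  congr 1
  refine prod_congr rfl fun i _ => ?_
  push_cast
  rw [show (2 * 0 + 1 : ℝ) * ((shiftedRow k μ i : ℝ) * (π / ℓ)) =
    (shiftedRow k μ i : ℝ) * (π / ℓ) by ring]

theorem sum_box_sin_of_odd (hℓ : ℓ = 2 * (n + k) + 1) :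
    ∑ μ ∈ boxDiagrams k n, (∏ i ∈ range k, sinSq ℓ (shiftedRow k μ i + 1)) *
      diffProd k (fun x => 2 * cos ((2 * x + 2) * (π / ℓ))) μ = (ℓ : ℝ) ^ k := by
  have key := sum_box_sin_eq_det ℓ k n (fun _ => 1)
  simp only [one_mul] at key
  rw [key]
  refine det_of_eq_ite fun a b => ?_
  have ha := a.2
  have hb := b.2
  rw [sum_cos_even_of_odd (c := (a + b + 1 : ℤ)) hℓ (by omega) (by omega) (by omega)]
  split_ifs with hab
  · subst hab
    simp
    rw [hℓ]
    push_cast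
    ring
  · have hne : (a : ℕ) ≠ b := fun h => hab (Fin.ext h)
    rw [sum_cos_even_of_odd (c := (a - b : ℤ)) hℓ (by omega) (by omega) (by omega)]
    ring

theorem sum_box_sin_of_even (hn : 0 < n) (hℓ : ℓ = 2 * (n + k)) :
    ∑ μ ∈ boxDiagrams k n, (∏ i ∈ range k, (halfAt (n + k - 1) (shiftedRow k μ i) *
      sinSq ℓ (shiftedRow k μ i + 1))) *
      diffProd k (fun x => 2 * cos ((2 * x + 2) * (π / ℓ))) μ = (ℓ : ℝ) ^ k := by
  rw [sum_box_sin_eq_det]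
  refine det_of_eq_ite fun a b => ?_
  have ha := a.2
  have hb := b.2
  rw [sum_halfAt_last_cos (c := (a + b + 1 : ℤ)) hℓ (by omega) (by omega) (by omega)]
  split_ifs with hab
  · subst hab
    rw [sum_halfAt (by omega)]
    simp
    rw [hℓ]
    push_cast
    ring
  · have hne : (a : ℕ) ≠ b := fun h => hab (Fin.ext h)
    rw [sum_halfAt_last_cos (c := (a - b : ℤ)) hℓ (by omega) (by omega) (by omega)]
    ring

/-- The frequencies `a - b` and `a + b + 1` have opposite parity, so their sums `-cos(cπ)/2` cancel
under the plus sign of the Gram matrix. -/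
theorem sum_box_cos_of_even (hn : 0 < n) (hℓ : ℓ = 2 * (n + k)) :
    ∑ μ ∈ boxDiagrams k n, (∏ i ∈ range k, (halfAt 0 (shiftedRow k μ i) *
      (2 * cos (shiftedRow k μ i * (π / ℓ))) ^ 2)) *
      diffProd k (fun x => 2 * cos (2 * x * (π / ℓ))) μ = (ℓ : ℝ) ^ k := by
  rw [sum_box_cos_eq_det]
  refine det_of_eq_ite fun a b => ?_
  have ha := a.2
  have hb := b.2
  rw [sum_halfAt_zero_cos (c := (a + b + 1 : ℤ)) hℓ (by omega) (by omega) (by omega),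
    show ((a + b + 1 : ℤ) : ℝ) = ((a + 1 : ℤ) : ℝ) + (b : ℤ) by push_cast; ring,
    cos_add_int_mul_two_pi',
    show (((a + 1 : ℤ) : ℝ) - (b : ℤ)) * π = ((a - b : ℤ) : ℝ) * π + π by push_cast; ring,
    cos_add_pi]
  split_ifs with hab
  · subst hab
    rw [sum_halfAt (by omega)]
    simp
    rw [hℓ]
    push_cast
    ring
  · have hne : (a : ℕ) ≠ b := fun h => hab (Fin.ext h)
    rw [sum_halfAt_zero_cos (c := (a - b : ℤ)) hℓ (by omega) (by omega) (by omega)]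
    ring

/-- The sign `(-1)^x` reflects the frequency `c` to `R - c`; the alternating sums thus reduce to the
previous ones. -/
theorem neg_one_pow_mul_cos {R : ℕ} (hR : 0 < R) (x : ℕ) (c : ℤ) :
    (-1) ^ x * cos (2 * x * (c * (π / (2 * R : ℕ)))) =
      cos (2 * x * (((R - c : ℤ) : ℝ) * (π / (2 * R : ℕ)))) := by
  have hR' : (R : ℝ) ≠ 0 := by positivity
  push_cast
  rw [show 2 * (x : ℝ) * ((R - c) * (π / (2 * R))) = x * π - 2 * x * (c * (π / (2 * R))) by
    field_simp, cos_nat_mul_pi_sub]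

/-- In row `0` of the Gram matrix the frequencies are `-b` and `b + 1`. Their reflections lie
strictly between `0` and `ℓ`, so both sums are `1/2` and the row is zero. -/
theorem sum_box_sin_alternating (hk : 0 < k) (hn : 0 < n) (hℓ : ℓ = 2 * (n + k)) :
    ∑ μ ∈ boxDiagrams k n, (∏ i ∈ range k, ((-1) ^ (shiftedRow k μ i) *
      halfAt (n + k - 1) (shiftedRow k μ i) * sinSq ℓ (shiftedRow k μ i + 1))) *
      diffProd k (fun x => 2 * cos ((2 * x + 2) * (π / ℓ))) μ = 0 := by
  rw [sum_box_sin_eq_det ℓ k n (fun x => (-1) ^ x * halfAt (n + k - 1) x)]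
  apply Matrix.det_eq_zero_of_row_eq_zero ⟨0, hk⟩
  intro b
  have hb := b.2
  have h : ∀ c : ℤ, 0 < (n + k : ℕ) - c → (n + k : ℕ) - c < ℓ →
      ∑ x ∈ range (n + k), (-1) ^ x * halfAt (n + k - 1) x *
        cos (2 * (x + 1 : ℕ) * ((c : ℝ) * (π / ℓ))) = 1 / 2 := by
    intro c hc hc'
    have := sum_halfAt_last_cos (c := (n + k : ℕ) - c) hℓ (by omega) (by omega) (by omega)
    rw [← neg_inj, ← sum_neg_distrib, show -(1 / 2 : ℝ) = -1 / 2 by ring, ← this]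
    refine sum_congr rfl fun x _ => ?_
    rw [hℓ, ← neg_one_pow_mul_cos (by omega), pow_succ]
    ring
  rw [Matrix.of_apply, h _ (by simp; omega) (by simp; omega),
    h _ (by simp; omega) (by simp; omega)]
  ring

/-- In row `0` the reflected frequencies are `R + b` and `R - b - 1` with `R = n + k`. They have
opposite parity, so their sums cancel. -/
theorem sum_box_cos_alternating (hk : 0 < k) (hn : 0 < n) (hℓ : ℓ = 2 * (n + k)) :
    ∑ μ ∈ boxDiagrams k n, (∏ i ∈ range k, ((-1) ^ (shiftedRow k μ i) *
      halfAt 0 (shiftedRow k μ i) * (2 * cos (shiftedRow k μ i * (π / ℓ))) ^ 2)) *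
      diffProd k (fun x => 2 * cos (2 * x * (π / ℓ))) μ = 0 := by
  rw [sum_box_cos_eq_det ℓ k n (fun x => (-1) ^ x * halfAt 0 x)]
  apply Matrix.det_eq_zero_of_row_eq_zero ⟨0, hk⟩
  intro b
  have hb := b.2
  have h : ∀ c : ℤ, 0 < (n + k : ℕ) - c → (n + k : ℕ) - c < ℓ →
      ∑ x ∈ range (n + k), (-1) ^ x * halfAt 0 x * cos (2 * x * ((c : ℝ) * (π / ℓ))) =
        - cos (((n + k : ℕ) - c : ℤ) * π) / 2 := by
    intro c hc hc'
    rw [← sum_halfAt_zero_cos (c := (n + k : ℕ) - c) hℓ (by omega) (by omega) (by omega)]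
    refine sum_congr rfl fun x _ => ?_
    rw [hℓ, ← neg_one_pow_mul_cos (by omega)]
    ring
  rw [Matrix.of_apply, h _ (by simp; omega) (by simp; omega),
    h _ (by simp; omega) (by simp; omega)]
  have e1 : (((n + k : ℕ) - (((⟨0, hk⟩ : Fin k) : ℕ) - (b : ℕ) : ℤ) : ℤ) : ℝ) * π =
      ((n + k : ℕ) + (b : ℕ) : ℝ) * π := by
    push_cast
    ring
  have e2 : (((n + k : ℕ) - (((⟨0, hk⟩ : Fin k) : ℕ) + (b : ℕ) + 1 : ℤ) : ℤ) : ℝ) * π =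
      ((n + k : ℕ) - (b : ℕ) : ℝ) * π - π := by
    push_cast
    ring
  have e3 := cos_add_int_mul_two_pi' (n + k : ℕ) (b : ℕ)
  rw [Int.cast_natCast, Int.cast_natCast] at e3
  rw [e1, e2, cos_sub_pi, e3]
  ring

end Odd

/-! ### The sums of the weights -/

theorem sinSq_natCast_sub (ℓ : ℕ) (hℓ : 0 < ℓ) (n : ℤ) : sinSq ℓ (ℓ - n) = sinSq ℓ n := by
  have hℓ' : (ℓ : ℝ) ≠ 0 := by positivity
  rw [sinSq, sinSq]
  push_cast
  rw [show ((ℓ : ℝ) - n) * π / ℓ = π - n * π / ℓ by field_simp, sin_pi_sub]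

theorem hook_pos {μ : YoungDiagram} {c : ℕ × ℕ} (hc : c ∈ μ.cells) : 0 < hook μ c := by
  obtain ⟨i, j⟩ := c
  rw [YoungDiagram.mem_cells] at hc
  have h1 := YoungDiagram.mem_iff_lt_rowLen.1 hc
  have h2 := YoungDiagram.mem_iff_lt_colLen.1 hc
  simp only [hook]
  omega

theorem hook_lt {μ : YoungDiagram} {c : ℕ × ℕ} (hc : c ∈ μ.cells) :
    hook μ c < μ.rowLen 0 + μ.colLen 0 := by
  obtain ⟨i, j⟩ := c
  rw [YoungDiagram.mem_cells] at hc
  have h1 := YoungDiagram.mem_iff_lt_rowLen.1 hc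
  have h3 := μ.rowLen_anti 0 i (Nat.zero_le _)
  have h4 := μ.colLen_anti 0 j (Nat.zero_le _)
  simp only [hook]
  omega

theorem pairProd_eq_diffProd (ℓ k : ℕ) (δ : ℤ) (μ : YoungDiagram) :
    pairProd (sinSq ℓ) k δ (fun i => rowBead μ i + k) =
      diffProd k (fun x => 2 * cos ((2 * x + δ) * (π / ℓ))) μ := by
  rw [pairProd, diffProd]
  refine prod_congr rfl fun i hi => prod_congr rfl fun j hj => ?_
  rw [mem_range] at hi
  rw [mem_Ico] at hj
  rw [sinSq_mul_sinSq, rowBead_add_eq_shiftedRow μ hi, rowBead_add_eq_shiftedRow μ hj.2]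
  rfl

theorem card_eq_sum_rowLen (μ : YoungDiagram) {k : ℕ} (hk : μ.colLen 0 ≤ k) :
    μ.card = ∑ i ∈ range k, μ.rowLen i := by
  have := sum_cells μ hk (fun _ => 1)
  simp only [sum_const, card_range, nsmul_eq_mul, mul_one] at this
  rw [YoungDiagram.card]
  exact_mod_cast this

theorem sum_even_card (s : Finset YoungDiagram) (W : YoungDiagram → ℝ) :
    ∑ μ ∈ s with Even μ.card, W μ =
      (∑ μ ∈ s, W μ + ∑ μ ∈ s, (-1) ^ μ.card * W μ) / 2 := by
  rw [sum_filter, ← sum_add_distrib, sum_div]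
  refine sum_congr rfl fun μ _ => ?_
  split_ifs with h
  · rw [h.neg_one_pow]
    ring
  · rw [(Nat.not_even_iff_odd.1 h).neg_one_pow]
    ring

/-- If the alternating sum vanishes, the even diagrams in a box contribute one half. -/
theorem sum_boxDiagrams_even_card {k n : ℕ} (V : ℕ → ℝ) (D : YoungDiagram → ℝ) {a : ℝ}
    (h1 : ∑ μ ∈ boxDiagrams k n, (∏ i ∈ range k, V (shiftedRow k μ i)) * D μ = a)
    (h2 : ∑ μ ∈ boxDiagrams k n,
      (∏ i ∈ range k, ((-1) ^ shiftedRow k μ i * V (shiftedRow k μ i))) * D μ = 0) :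
    ∑ μ ∈ boxDiagrams k n with Even μ.card,
      (∏ i ∈ range k, V (shiftedRow k μ i)) * D μ = a / 2 := by
  have h3 : ∑ μ ∈ boxDiagrams k n,
      (-1) ^ μ.card * ((∏ i ∈ range k, V (shiftedRow k μ i)) * D μ) = 0 := by
    -- The number of boxes and the sum of the shifted rows differ by the size of the staircase,
    -- which gives a sign independent of `μ`.
    have : ∀ μ ∈ boxDiagrams k n,
        (-1) ^ μ.card * ((∏ i ∈ range k, V (shiftedRow k μ i)) * D μ) =
        (∏ i ∈ range k, (-1 : ℝ) ^ (k - 1 - i)) *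
        ((∏ i ∈ range k, ((-1) ^ shiftedRow k μ i * V (shiftedRow k μ i))) * D μ) := by
      intro μ hμ
      rw [card_eq_sum_rowLen μ (mem_boxDiagrams.1 hμ).1, ← prod_pow_eq_pow_sum,
        ← mul_assoc, ← mul_assoc, ← prod_mul_distrib, ← prod_mul_distrib]
      congr 1
      refine prod_congr rfl fun i _ => ?_
      have hsq : (-1 : ℝ) ^ (k - 1 - i) * (-1) ^ (k - 1 - i) = 1 := by
        rw [← mul_pow]
        simp
      rw [shiftedRow, pow_add]
      linear_combination (-(-1) ^ μ.rowLen i * V (μ.rowLen i + (k - 1 - i))) * hsq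
    rw [sum_congr rfl this, ← mul_sum, h2, mul_zero]
  rw [sum_even_card, h1, h3, add_zero]

/-- The sum of the weights for `N = 2k + 1`. -/
theorem sum_gWeight_odd {ℓ k n : ℕ} (hn : 0 < n) (hℓ : ℓ = 2 * (n + k) + 1) :
    (∑ μ ∈ colDiagrams (2 * k + 1) n with Even μ.card, gWeight (sinSq ℓ) (2 * k + 1) μ) *
      ((∏ i ∈ range k, ∏ j ∈ Ico i k, sinSq ℓ (2 * k - 1 - i - j)) *
        ∏ i ∈ range k, gFactorial (sinSq ℓ) (k - 1 - i)) = (ℓ : ℝ) ^ k := by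
  have hg : ∀ m : ℤ, 0 < m → m < ℓ → sinSq ℓ m ≠ 0 := fun m => sinSq_ne_zero
  have hhook : ∀ μ ∈ colDiagrams (2 * k + 1) n, ∀ c ∈ μ.cells, sinSq ℓ (hook μ c) ≠ 0 := by
    intro μ hμ c hc
    refine hg _ (hook_pos hc) ((hook_lt hc).trans_le ?_)
    have := mem_colDiagrams.1 hμ
    omega
  rw [sum_colDiagrams_odd _ hn fun μ hμ => gWeight_flipCol (by push_cast; ring) hμ
    (hhook μ hμ) (hhook _ (flipCol_mem hn hμ)), sum_mul, ← sum_box_sin_odd hℓ]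
  refine sum_congr rfl fun μ hμ => ?_
  have hμ' := mem_boxDiagrams.1 hμ
  rw [gWeight_odd _ hg μ hμ'.1 (by omega), pairProd_eq_diffProd, mul_comm]
  congr 1
  · refine prod_congr rfl fun i hi => ?_
    rw [rowBead_add_eq_shiftedRow μ (mem_range.1 hi)]
  · rw [Int.cast_one]

/-- Only the last shifted row can be the node `0`, and it is so when row `k` is empty. These are the
diagrams that `sum_colDiagrams_even` counts twice. -/
theorem prod_halfAt_zero {k : ℕ} (μ : YoungDiagram) (hμ : μ.colLen 0 ≤ k + 1) :
    ∏ i ∈ range (k + 1), halfAt 0 (shiftedRow (k + 1) μ i) =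
      if μ.colLen 0 < k + 1 then 1 / 2 else 1 := by
  have h1 : ∀ i ∈ range k, halfAt 0 (shiftedRow (k + 1) μ i) = 1 := by
    intro i hi
    rw [mem_range] at hi
    rw [halfAt, if_neg]
    rw [shiftedRow]
    omega
  rw [prod_range_succ, prod_congr rfl h1, prod_const_one, one_mul, halfAt, shiftedRow]
  have h2 := rowLen_eq_zero_iff μ k
  refine if_congr ?_ rfl rfl
  omega

theorem prod_halfAt_last {k n : ℕ} (hk : 0 < k) (μ : YoungDiagram) (hμ : μ.rowLen 0 ≤ n) :
    ∏ i ∈ range k, halfAt (n + k - 1) (shiftedRow k μ i) =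
      if μ.rowLen 0 < n then 1 else 1 / 2 := by
  obtain ⟨k, rfl⟩ := Nat.exists_eq_succ_of_ne_zero hk.ne'
  have h1 : ∀ i ∈ range k, halfAt (n + (k + 1) - 1) (shiftedRow (k + 1) μ (i + 1)) = 1 := by
    intro i hi
    rw [mem_range] at hi
    have := μ.rowLen_anti 0 (i + 1) (Nat.zero_le _)
    rw [halfAt, if_neg]
    rw [shiftedRow]
    omega
  rw [Nat.succ_eq_add_one, prod_range_succ', prod_congr rfl h1, prod_const_one, one_mul, halfAt,
    shiftedRow]
  split_ifs <;> first | rfl | omega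

/-- The sum of the weights for `N = 2k`. -/
theorem sum_gWeight_even {ℓ k n : ℕ} (hn : 0 < n) (hℓ : ℓ = 2 * (n + (k + 1))) :
    (∑ μ ∈ colDiagrams (2 * (k + 1)) n with Even μ.card, gWeight (sinSq ℓ) (2 * (k + 1)) μ) *
      ((∏ i ∈ range k, ∏ j ∈ Ico i (k + 1), sinSq ℓ (2 * k - i - j)) *
        ∏ i ∈ range k, gFactorial (sinSq ℓ) (k - 1 - i)) = (ℓ : ℝ) ^ (k + 1) / 2 := by
  have hg : ∀ m : ℤ, 0 < m → m < ℓ → sinSq ℓ m ≠ 0 := fun m => sinSq_ne_zero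
  have hhook : ∀ μ ∈ colDiagrams (2 * (k + 1)) n, ∀ c ∈ μ.cells, sinSq ℓ (hook μ c) ≠ 0 := by
    intro μ hμ c hc
    refine hg _ (hook_pos hc) ((hook_lt hc).trans_le ?_)
    have := mem_colDiagrams.1 hμ
    omega
  rw [sum_colDiagrams_even _ hn fun μ hμ => gWeight_flipCol (by push_cast; ring) hμ
    (hhook μ hμ) (hhook _ (flipCol_mem hn hμ)), sum_mul]
  rw [← sum_boxDiagrams_even_card (fun x => halfAt 0 x * (2 * cos (x * (π / ℓ))) ^ 2) _
    (sum_box_cos_of_even hn hℓ) (by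
      rw [← sum_box_cos_alternating (Nat.succ_pos k) hn hℓ]
      refine sum_congr rfl fun μ _ => ?_
      congr 1
      refine prod_congr rfl fun i _ => ?_
      ring)]
  refine sum_congr rfl fun μ hμ => ?_
  have hμ' := mem_boxDiagrams.1 (mem_filter.1 hμ).1
  have hbead : ∀ i < k + 1, rowBead μ i + ((k : ℤ) + 1) = shiftedRow (k + 1) μ i := by
    intro i hi
    rw [← rowBead_add_eq_shiftedRow μ hi]
    push_cast
    ring
  have hpair : pairProd (sinSq ℓ) (k + 1) 0 (fun i => rowBead μ i + (k + 1)) =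
      diffProd (k + 1) (fun x => 2 * cos (2 * x * (π / ℓ))) μ := by
    have := pairProd_eq_diffProd ℓ (k + 1) 0 μ
    push_cast at this
    simpa using this
  have hne : ∀ i < k + 1, 0 < shiftedRow (k + 1) μ i → sinSq ℓ (shiftedRow (k + 1) μ i) ≠ 0 := by
    intro i hi hpos
    refine hg _ (by exact_mod_cast hpos) ?_
    have := μ.rowLen_anti 0 i (Nat.zero_le _)
    rw [shiftedRow]
    omega
  have hsingle : ∀ m ≤ k + 1, ∏ i ∈ range m, sinSq ℓ (rowBead μ i + ((k : ℤ) + 1)) =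
      ∏ i ∈ range m, sinSq ℓ (shiftedRow (k + 1) μ i) := by
    intro m hm
    refine prod_congr rfl fun i hi => ?_
    rw [hbead i ((mem_range.1 hi).trans_le hm)]
  have hdouble : ∀ m ≤ k + 1, ∏ i ∈ range m, sinSq ℓ (2 * (rowBead μ i + ((k : ℤ) + 1))) =
      (∏ i ∈ range m, sinSq ℓ (shiftedRow (k + 1) μ i)) *
        ∏ i ∈ range m, (2 * cos (shiftedRow (k + 1) μ i * (π / ℓ))) ^ 2 := by
    intro m hm
    rw [← prod_mul_distrib]
    refine prod_congr rfl fun i hi => ?_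
    rw [hbead i ((mem_range.1 hi).trans_le hm), sinSq_two_mul]
    push_cast
    ring
  rw [prod_mul_distrib, prod_halfAt_zero μ hμ'.1]
  by_cases hlt : μ.colLen 0 < k + 1
  · have key := gWeight_even_of_lt _ hg μ (k := k) (by omega) (by omega)
    rw [hpair, hdouble k (by omega), hsingle k (by omega)] at key
    have hP : ∏ i ∈ range k, sinSq ℓ (shiftedRow (k + 1) μ i) ≠ 0 := by
      refine prod_ne_zero_iff.2 fun i hi => ?_
      rw [mem_range] at hi
      refine hne i (by omega) ?_
      rw [shiftedRow]
      omega
    have h0 : shiftedRow (k + 1) μ k = 0 := by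
      have := (rowLen_eq_zero_iff μ k).2 (by omega)
      rw [shiftedRow]
      omega
    -- The node `0` contributes `(1/2)(2 cos 0)² = 2`, in agreement with the double count.
    rw [if_pos hlt, if_pos hlt, prod_range_succ, h0, Nat.cast_zero, zero_mul, cos_zero]
    apply mul_right_cancel₀ hP
    linear_combination 2 * key
  · have key := gWeight_even_of_eq _ hg μ (k := k) (by omega) (by omega)
    rw [hpair, hdouble (k + 1) le_rfl, hsingle (k + 1) le_rfl] at key
    have hP : ∏ i ∈ range (k + 1), sinSq ℓ (shiftedRow (k + 1) μ i) ≠ 0 := by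
      refine prod_ne_zero_iff.2 fun i hi => ?_
      rw [mem_range] at hi
      refine hne i hi ?_
      have := rowLen_eq_zero_iff μ i
      rw [shiftedRow]
      omega
    rw [if_neg hlt, if_neg hlt]
    apply mul_right_cancel₀ hP
    linear_combination key

/-- On the shifted columns the flip is `x₀ ↦ ℓ - 2 - x₀`, and the symmetry `n ↦ ℓ - n` of `sinSq`
exchanges the two factors of each pair containing `x₀`. This is read off the closed formula, so its
constant must be nonzero. -/
theorem gWeight_neg_flipCol {ℓ k T : ℕ} (hk : 0 < k) (hT : ℓ = 2 * k + T)
    (hZ : (∏ i ∈ range k, ∏ j ∈ Ico (i + 1) k, sinSq ℓ (2 * k - i - j)) *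
        ∏ j ∈ range k, gFactorial (sinSq ℓ) (k - j) ≠ 0)
    {μ : YoungDiagram} (hμ : μ ∈ colDiagrams T k) :
    gWeight (sinSq ℓ) (-(2 * k)) (flipCol T μ) = gWeight (sinSq ℓ) (-(2 * k)) μ := by
  have hg : ∀ m : ℤ, 0 < m → m < ℓ → sinSq ℓ m ≠ 0 := fun m => sinSq_ne_zero
  have hℓ : 0 < ℓ := by omega
  have h1 := mem_colDiagrams.1 hμ
  have h2 := mem_colDiagrams.1 (flipCol_mem hk hμ)
  apply mul_right_cancel₀ hZ
  rw [gWeight_neg _ hg (sinSq_neg ℓ) _ h2.2 (by omega),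
    gWeight_neg _ hg (sinSq_neg ℓ) _ h1.2 (by omega)]
  have hx0 : rowBead (flipCol T μ).transpose 0 + k =
      ℓ - 2 - (rowBead μ.transpose 0 + k) := by
    rw [rowBead, rowBead, YoungDiagram.rowLen_transpose, YoungDiagram.rowLen_transpose,
      colLen_flipCol hμ]
    omega
  have hx : ∀ j, 0 < j → rowBead (flipCol T μ).transpose j = rowBead μ.transpose j := by
    intro j hj
    rw [rowBead, rowBead, YoungDiagram.rowLen_transpose, YoungDiagram.rowLen_transpose,
      flipCol, colLen_setCol_of_pos (by omega) hj]
  rw [pairProd, pairProd]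
  congr 1
  · refine prod_congr rfl fun i _ => prod_congr rfl fun j hj => ?_
    rw [mem_Ico] at hj
    rcases Nat.eq_zero_or_pos i with rfl | hi
    · rw [hx0, hx j (by omega), mul_comm (sinSq ℓ (rowBead μ.transpose 0 + k - _))]
      congr 1
      · rw [← sinSq_natCast_sub ℓ hℓ (_ + 2)]
        congr 1
        ring
      · rw [← sinSq_natCast_sub ℓ hℓ (_ - _)]
        congr 1
        ring
    · rw [hx i hi, hx j (by omega)]
  · refine prod_congr rfl fun i _ => ?_
    rcases Nat.eq_zero_or_pos i with rfl | hi
    · rw [hx0, ← sinSq_natCast_sub ℓ hℓ (_ + 1)]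
      congr 1
      ring
    · rw [hx i hi]

theorem sum_boxDiagrams_transpose (h w : ℕ) (F : YoungDiagram → ℝ) :
    ∑ μ ∈ boxDiagrams h w, F μ = ∑ μ ∈ boxDiagrams w h, F μ.transpose := by
  refine sum_nbij' YoungDiagram.transpose YoungDiagram.transpose ?_ ?_ ?_ ?_ ?_
  · intro μ hμ
    rw [mem_boxDiagrams] at hμ ⊢
    simpa using hμ.symm
  · intro μ hμ
    rw [mem_boxDiagrams] at hμ ⊢
    simpa using hμ.symm
  · intro μ _
    exact YoungDiagram.transpose_transpose μ
  · intro μ _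
    exact YoungDiagram.transpose_transpose μ
  · intro μ _
    rw [YoungDiagram.transpose_transpose]

theorem card_transpose (μ : YoungDiagram) : μ.transpose.card = μ.card := by
  have := sum_hook_transpose μ (fun _ => 1)
  simp only [sum_const, nsmul_eq_mul, mul_one] at this
  exact_mod_cast this

theorem gWeight_neg_transpose {ℓ k h : ℕ} (hℓ : h + k ≤ ℓ) {μ : YoungDiagram}
    (hμ : μ ∈ boxDiagrams k h) :
    gWeight (sinSq ℓ) (-(2 * k)) μ.transpose *
        ((∏ i ∈ range k, ∏ j ∈ Ico (i + 1) k, sinSq ℓ (2 * k - i - j)) *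
        ∏ j ∈ range k, gFactorial (sinSq ℓ) (k - j)) =
      (∏ i ∈ range k, sinSq ℓ (shiftedRow k μ i + 1)) *
        diffProd k (fun x => 2 * cos ((2 * x + 2) * (π / ℓ))) μ := by
  have hg : ∀ m : ℤ, 0 < m → m < ℓ → sinSq ℓ m ≠ 0 := fun m => sinSq_ne_zero
  have hμ' := mem_boxDiagrams.1 hμ
  rw [gWeight_neg _ hg (sinSq_neg ℓ) μ.transpose (by simpa using hμ'.1)
    (by rw [YoungDiagram.colLen_transpose]; omega), YoungDiagram.transpose_transpose,
    pairProd_eq_diffProd, mul_comm]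
  congr 1
  · refine prod_congr rfl fun i hi => ?_
    rw [rowBead_add_eq_shiftedRow μ (mem_range.1 hi)]

/-- The sum of the weights for `N = -2k`. -/
theorem sum_gWeight_neg {ℓ k T : ℕ} (hk : 0 < k) (hT0 : 0 < T) (hT : ℓ = 2 * k + T)
    (hZ : (∏ i ∈ range k, ∏ j ∈ Ico (i + 1) k, sinSq ℓ (2 * k - i - j)) *
        ∏ j ∈ range k, gFactorial (sinSq ℓ) (k - j) ≠ 0) :
    (∑ μ ∈ colDiagrams T k with Even μ.card, gWeight (sinSq ℓ) (-(2 * k)) μ) *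
      ((∏ i ∈ range k, ∏ j ∈ Ico (i + 1) k, sinSq ℓ (2 * k - i - j)) *
        ∏ j ∈ range k, gFactorial (sinSq ℓ) (k - j)) = (ℓ : ℝ) ^ k := by
  rcases Nat.even_or_odd' T with ⟨h, hh | hh⟩
  · subst hh
    rw [sum_colDiagrams_even _ hk fun μ hμ => gWeight_neg_flipCol hk hT hZ hμ, sum_filter,
      sum_boxDiagrams_transpose, ← sum_filter]
    simp only [card_transpose, YoungDiagram.colLen_transpose]
    have hn : 0 < h := by omega
    have hℓ : ℓ = 2 * (h + k) := by omega
    have key := sum_boxDiagrams_even_card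
      (fun x => halfAt (h + k - 1) x * sinSq ℓ (x + 1)) _
      (sum_box_sin_of_even hn hℓ) (by
        rw [← sum_box_sin_alternating hk hn hℓ]
        refine sum_congr rfl fun μ _ => ?_
        congr 1
        refine prod_congr rfl fun i _ => ?_
        ring)
    -- The multiplicity `2` or `1` is twice the product of the `halfAt`; this `2` makes up for the
    -- half lost to the parity condition.
    rw [show (ℓ : ℝ) ^ k = 2 * ((ℓ : ℝ) ^ k / 2) by ring, ← key, sum_mul, mul_sum]
    refine sum_congr rfl fun μ hμ => ?_
    have hμ' := (mem_filter.1 hμ).1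
    rw [mul_assoc, gWeight_neg_transpose (by omega) hμ', prod_mul_distrib,
      prod_halfAt_last hk μ (mem_boxDiagrams.1 hμ').2]
    split_ifs <;> ring
  · subst hh
    rw [sum_colDiagrams_odd _ hk fun μ hμ => gWeight_neg_flipCol hk hT hZ hμ,
      sum_boxDiagrams_transpose, sum_mul, ← sum_box_sin_of_odd (n := h) (by omega)]
    exact sum_congr rfl fun μ hμ => gWeight_neg_transpose (by omega) hμ

/-! ### The constants as products over roots -/

section RootProducts

variable (g : ℤ → ℝ)

/-- The product of the `g(j - i) g(c - i - j)` over `i < j < k`. -/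
def pairFactor (k : ℕ) (c : ℤ) : ℝ :=
  ∏ i ∈ range k, ∏ j ∈ Ico (i + 1) k, g (j - i) * g (c - i - j)

theorem pairFactor_eq (k : ℕ) (c : ℤ) :
    pairFactor g k c = (∏ i ∈ range k, ∏ j ∈ Ico (i + 1) k, g (c - i - j)) *
      ∏ i ∈ range k, gFactorial g (k - 1 - i) := by
  rw [pairFactor, ← prod_mul_distrib]
  refine prod_congr rfl fun i _ => ?_
  rw [prod_mul_distrib, mul_comm]
  congr 1
  rw [prod_Ico_eq_prod_range, gFactorial, show k - (i + 1) = k - 1 - i by omega]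
  refine prod_congr rfl fun u _ => ?_
  congr 1
  push_cast
  ring

theorem pairFactor_ne_zero {ℓ k : ℕ} {c : ℤ} (hg : ∀ m : ℤ, 0 < m → m < ℓ → g m ≠ 0)
    (h1 : 2 * (k : ℤ) ≤ c + 1) (h2 : c < ℓ) : pairFactor g k c ≠ 0 := by
  refine prod_ne_zero_iff.2 fun i hi => prod_ne_zero_iff.2 fun j hj => ?_
  rw [mem_range] at hi
  rw [mem_Ico] at hj
  exact mul_ne_zero (hg _ (by omega) (by omega)) (hg _ (by omega) (by omega))

/-- The substitution `j ↦ j + 1` passes between the constants of the weights and the root products,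
up to one boundary factor. -/
theorem prod_Ico_shift {i k : ℕ} (hi : i ≤ k) (c : ℤ) :
    ∏ j ∈ Ico i k, g (c - 1 - i - j) =
      (∏ j ∈ Ico (i + 1) k, g (c - i - j)) * if i = k then 1 else g (c - i - k) := by
  split_ifs with h
  · subst h
    simp
  · rw [← prod_Ico_succ_top (f := fun j : ℕ => g (c - i - j)) (by omega),
      ← prod_Ico_add' (fun j : ℕ => g (c - i - j))]
    refine prod_congr rfl fun j _ => ?_
    congr 1
    push_cast
    ring

theorem prod_prod_Ico_shift (k : ℕ) :
    ∏ i ∈ range k, ∏ j ∈ Ico i k, g (2 * k - 1 - i - j) =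
      (∏ i ∈ range k, ∏ j ∈ Ico (i + 1) k, g (2 * k - i - j)) * ∏ i ∈ range k, g (k - i) := by
  rw [← prod_mul_distrib]
  refine prod_congr rfl fun i hi => ?_
  rw [mem_range] at hi
  rw [prod_Ico_shift g hi.le, if_neg hi.ne]
  congr 2
  ring

/-- The denominator for type `B`. -/
theorem pairFactor_mul_short (k : ℕ) :
    pairFactor g k (2 * k) * ∏ i ∈ range k, g (k - i) =
      (∏ i ∈ range k, ∏ j ∈ Ico i k, g (2 * k - 1 - i - j)) *
        ∏ i ∈ range k, gFactorial g (k - 1 - i) := by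
  rw [pairFactor_eq, prod_prod_Ico_shift]
  ring

/-- The denominator for type `C`. -/
theorem pairFactor_mul_long (k : ℕ) :
    pairFactor g k (2 * k - 1) * ∏ i ∈ range k, g (2 * k - 1 - 2 * i) =
      (∏ i ∈ range k, ∏ j ∈ Ico (i + 1) k, g (2 * k - i - j)) *
        ∏ j ∈ range k, gFactorial g (k - j) := by
  have h1 : (∏ i ∈ range k, ∏ j ∈ Ico (i + 1) k, g (2 * k - 1 - i - j)) *
      ∏ i ∈ range k, g (2 * k - 1 - 2 * i) =
      ∏ i ∈ range k, ∏ j ∈ Ico i k, g (2 * k - 1 - i - j) := by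
    rw [← prod_mul_distrib]
    refine prod_congr rfl fun i hi => ?_
    rw [prod_eq_prod_Ico_succ_bot (mem_range.1 hi), mul_comm]
    congr 2
    ring
  have h2 : ∏ j ∈ range k, gFactorial g (k - j) =
      (∏ i ∈ range k, gFactorial g (k - 1 - i)) * ∏ i ∈ range k, g (k - i) := by
    rw [← prod_mul_distrib]
    refine prod_congr rfl fun i hi => ?_
    rw [mem_range] at hi
    rw [show k - i = k - 1 - i + 1 by omega, gFactorial_succ]
    congr 2
    omega
  rw [pairFactor_eq, h2]
  linear_combination (∏ i ∈ range k, gFactorial g (k - 1 - i)) * (h1.trans (prod_prod_Ico_shift g k))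

/-- The denominator for type `D`. -/
theorem pairFactor_succ (k : ℕ) :
    pairFactor g (k + 1) (2 * k + 1) =
      (∏ i ∈ range k, ∏ j ∈ Ico i (k + 1), g (2 * k - i - j)) *
        ∏ i ∈ range k, gFactorial g (k - 1 - i) := by
  rw [pairFactor_eq, prod_range_succ, prod_range_succ, Ico_self, prod_empty,
    show gFactorial g (k + 1 - 1 - k) = 1 by simp [gFactorial], mul_one, mul_one,
    ← prod_mul_distrib, ← prod_mul_distrib]
  refine prod_congr rfl fun i hi => ?_
  rw [mem_range] at hi
  have h := prod_Ico_shift g (i := i) (k := k + 1) (by omega) (2 * k + 1)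
  rw [if_neg (by omega)] at h
  rw [show k + 1 - 1 - i = k - 1 - i + 1 by omega, gFactorial_succ, ← mul_assoc, mul_right_comm]
  congr 1
  rw [show ((k - 1 - i : ℕ) : ℤ) + 1 = 2 * k + 1 - i - (k + 1 : ℕ) by push_cast; omega, ← h]
  refine prod_congr rfl fun j _ => ?_
  congr 1
  ring

end RootProducts

/-! ### The positive roots -/

section Roots

variable {k : ℕ}

/-- The pairs `i < j` in `Fin k`. -/
def indexPairs (k : ℕ) : Finset ((_ : Fin k) × Fin k) := univ.sigma fun i => Ioi i

theorem mem_indexPairs {p : (_ : Fin k) × Fin k} : p ∈ indexPairs k ↔ p.1 < p.2 := by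
  simp [indexPairs]

/-- The vectors `φ_i - φ_j` with `i < j`. -/
noncomputable def diffRoots (k : ℕ) : Finset (Fin k → ℝ) :=
  (indexPairs k).image fun p => phi p.1 - phi p.2

/-- The vectors `φ_i + φ_j` with `i < j`. -/
noncomputable def sumRoots (k : ℕ) : Finset (Fin k → ℝ) :=
  (indexPairs k).image fun p => phi p.1 + phi p.2

/-- The vectors `c φ_i`. -/
noncomputable def axisRoots (k : ℕ) (c : ℝ) : Finset (Fin k → ℝ) :=
  univ.image fun i => c • phi i

theorem prod_diffRoots (f : (Fin k → ℝ) → ℝ) :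
    ∏ α ∈ diffRoots k, f α = ∏ i : Fin k, ∏ j ∈ Ioi i, f (phi i - phi j) := by
  rw [diffRoots, prod_image, indexPairs, prod_sigma]
  rintro ⟨i, j⟩ hp ⟨i', j'⟩ hp' h
  rw [mem_coe, mem_indexPairs] at hp hp'
  simp only at hp hp' h
  have h1 := congrFun h i
  have h2 := congrFun h j
  simp only [phi, Pi.sub_apply, Pi.single_apply, hp.ne, hp.ne', if_true, if_false] at h1 h2
  have e1 : i = i' := by
    by_contra hne
    rw [if_neg hne] at h1
    split_ifs at h1 <;> norm_num at h1
  have e2 : j = j' := by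
    by_contra hne
    rw [if_neg hne] at h2
    split_ifs at h2 <;> norm_num at h2
  rw [e1, e2]

theorem prod_sumRoots (f : (Fin k → ℝ) → ℝ) :
    ∏ α ∈ sumRoots k, f α = ∏ i : Fin k, ∏ j ∈ Ioi i, f (phi i + phi j) := by
  rw [sumRoots, prod_image, indexPairs, prod_sigma]
  rintro ⟨i, j⟩ hp ⟨i', j'⟩ hp' h
  rw [mem_coe, mem_indexPairs] at hp hp'
  simp only at hp hp' h
  have h1 := congrFun h i
  have h2 := congrFun h j
  simp only [phi, Pi.add_apply, Pi.single_apply, hp.ne, hp.ne', if_true, if_false] at h1 h2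
  have e1 : i = i' ∨ i = j' := by
    by_contra! hne
    rw [if_neg hne.1, if_neg hne.2] at h1
    norm_num at h1
  have e2 : j = i' ∨ j = j' := by
    by_contra! hne
    rw [if_neg hne.1, if_neg hne.2] at h2
    norm_num at h2
  have : i = i' ∧ j = j' := by omega
  rw [this.1, this.2]

theorem prod_axisRoots {c : ℝ} (hc : 0 < c) (f : (Fin k → ℝ) → ℝ) :
    ∏ α ∈ axisRoots k c, f α = ∏ i : Fin k, f (c • phi i) := by
  rw [axisRoots, prod_image]
  intro i _ i' _ h
  have h1 := congrFun h i
  simp only [phi, Pi.smul_apply, Pi.single_apply, if_true, smul_eq_mul] at h1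
  by_contra hne
  rw [if_neg hne] at h1
  linarith

theorem disjoint_diffRoots_sumRoots : Disjoint (diffRoots k) (sumRoots k) := by
  rw [disjoint_left]
  intro α h h'
  simp only [diffRoots, sumRoots, mem_image, mem_indexPairs] at h h'
  obtain ⟨⟨i, j⟩, hp, rfl⟩ := h
  obtain ⟨⟨i', j'⟩, hp', h⟩ := h'
  have h1 := congrFun h j
  simp only at hp
  simp only [phi, Pi.add_apply, Pi.sub_apply, Pi.single_apply, hp.ne', if_true, if_false] at h1
  split_ifs at h1 <;> norm_num at h1

theorem disjoint_axisRoots {c : ℝ} (hc : 0 < c) :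
    Disjoint (diffRoots k ∪ sumRoots k) (axisRoots k c) := by
  rw [disjoint_left]
  intro α h h'
  simp only [diffRoots, sumRoots, axisRoots, mem_union, mem_image, mem_indexPairs, mem_univ,
    true_and] at h h'
  obtain ⟨a, rfl⟩ := h'
  obtain ⟨⟨i, j⟩, hp, h⟩ | ⟨⟨i, j⟩, hp, h⟩ := h
  · have h1 := congrFun h j
    simp only at hp
    simp only [phi, Pi.smul_apply, Pi.sub_apply, Pi.single_apply, hp.ne', if_true, if_false,
      smul_eq_mul] at h1
    split_ifs at h1 <;> linarith
  · have h1 := congrFun h i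
    have h2 := congrFun h j
    simp only at hp
    simp only [phi, Pi.smul_apply, Pi.add_apply, Pi.single_apply, hp.ne, hp.ne', if_true, if_false,
      smul_eq_mul] at h1 h2
    have e1 : i = a := by
      by_contra hne
      rw [if_neg hne] at h1
      norm_num at h1
    have e2 : j = a := by
      by_contra hne
      rw [if_neg hne] at h2
      norm_num at h2
    exact hp.ne (e1.trans e2.symm)

theorem exists_pair_iff (α : Fin k → ℝ) :
    (∃ i j, i < j ∧ (α = phi i - phi j ∨ α = phi i + phi j)) ↔ α ∈ diffRoots k ∪ sumRoots k := by
  simp only [diffRoots, sumRoots, mem_union, mem_image, mem_indexPairs]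
  constructor
  · rintro ⟨i, j, hij, rfl | rfl⟩
    · exact Or.inl ⟨⟨i, j⟩, hij, rfl⟩
    · exact Or.inr ⟨⟨i, j⟩, hij, rfl⟩
  · rintro (⟨p, hp, rfl⟩ | ⟨p, hp, rfl⟩)
    · exact ⟨p.1, p.2, hp, Or.inl rfl⟩
    · exact ⟨p.1, p.2, hp, Or.inr rfl⟩

theorem posRoots_of_pos_odd {N : ℤ} (h0 : 0 < N) (h1 : Odd N) :
    posRoots N = ↑((diffRoots (rk N) ∪ sumRoots (rk N)) ∪ axisRoots (rk N) 1) := by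
  ext α
  rw [mem_coe, mem_union, ← exists_pair_iff]
  simp [posRoots, axisRoots, h0, h1, h0.not_gt, eq_comm]

theorem posRoots_of_pos_even {N : ℤ} (h0 : 0 < N) (h1 : Even N) :
    posRoots N = ↑(diffRoots (rk N) ∪ sumRoots (rk N)) := by
  ext α
  rw [mem_coe, ← exists_pair_iff]
  simp [posRoots, h1, h0.not_gt]

theorem posRoots_of_neg {N : ℤ} (h0 : N < 0) (h1 : Even N) :
    posRoots N = ↑((diffRoots (rk N) ∪ sumRoots (rk N)) ∪ axisRoots (rk N) 2) := by
  ext α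
  rw [mem_coe, mem_union, ← exists_pair_iff]
  simp [posRoots, axisRoots, h0, h1, h0.not_gt, eq_comm]

/-- The factor of the root `α`. -/
noncomputable def rootFactor (N : ℤ) (ℓ : ℕ) (α : Fin (rk N) → ℝ) : ℝ :=
  1 / (4 * sin ((α ⬝ᵥ rhoCheck N) * π / ℓ) ^ 2)

theorem rootFactor_eq {N : ℤ} {ℓ : ℕ} {α : Fin (rk N) → ℝ} {m : ℤ} (h : α ⬝ᵥ rhoCheck N = m) :
    rootFactor N ℓ α = (sinSq ℓ m)⁻¹ := by
  rw [rootFactor, sinSq, h, one_div]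

theorem phi_dotProduct (i : Fin k) (v : Fin k → ℝ) : phi i ⬝ᵥ v = v i :=
  single_one_dotProduct i v

/-- With indices from `0`, `ρ̌` pairs with `φ_i - φ_j` to `j - i` and with `φ_i + φ_j` to `|N| - 1 -
i - j`. -/
theorem prod_pairRoots (N : ℤ) (ℓ : ℕ) :
    ∏ α ∈ diffRoots (rk N) ∪ sumRoots (rk N), rootFactor N ℓ α =
      (pairFactor (sinSq ℓ) (rk N) (|N| - 1))⁻¹ := by
  rw [prod_union disjoint_diffRoots_sumRoots, prod_diffRoots, prod_sumRoots, ← prod_mul_distrib,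
    pairFactor, ← prod_univ_Ioi_eq (rk N) (fun i j => sinSq ℓ (j - i) * sinSq ℓ (|N| - 1 - i - j)),
    ← prod_inv_distrib]
  refine prod_congr rfl fun i _ => ?_
  rw [← prod_mul_distrib, ← prod_inv_distrib]
  refine prod_congr rfl fun j _ => ?_
  rw [mul_inv, rootFactor_eq (m := (j : ℕ) - (i : ℕ)),
    rootFactor_eq (m := |N| - 1 - (i : ℕ) - (j : ℕ))]
  · rw [add_dotProduct, phi_dotProduct, phi_dotProduct, rhoCheck, rhoCheck]
    push_cast
    ring
  · rw [sub_dotProduct, phi_dotProduct, phi_dotProduct, rhoCheck, rhoCheck]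
    push_cast
    ring

theorem prod_axisRootFactors {N : ℤ} (ℓ : ℕ) {c : ℝ} (hc : 0 < c) (m : ℕ → ℤ)
    (hm : ∀ i : ℕ, c * ((|(N : ℝ)| + 1) / 2 - ((i : ℝ) + 1)) = m i) :
    ∏ α ∈ axisRoots (rk N) c, rootFactor N ℓ α = (∏ i ∈ range (rk N), sinSq ℓ (m i))⁻¹ := by
  rw [prod_axisRoots hc, ← Fin.prod_univ_eq_prod_range (fun i => sinSq ℓ (m i)), ← prod_inv_distrib]
  refine prod_congr rfl fun i _ => rootFactor_eq ?_
  rw [smul_dotProduct, phi_dotProduct, smul_eq_mul, rhoCheck, hm]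

end Roots

/-! ### From `q`-numbers to sines, and assembly -/

section Weights

/-- The squared differences of the powers of `q`. -/
theorem zpow_sub_zpow_neg_sq {ℓ : ℕ} {q : ℂ}
    (hq : q ^ 2 = Complex.exp (2 * π * Complex.I / ℓ) ∨
      q ^ 2 = Complex.exp (-(2 * π * Complex.I / ℓ))) (n : ℤ) :
    (q ^ n - q ^ (-n)) ^ 2 = -(sinSq ℓ n : ℂ) := by
  have hq0 : q ≠ 0 := by
    rintro rfl
    rcases hq with h | h <;> exact Complex.exp_ne_zero _ (by rw [← h]; simp)
  -- The sum is symmetric under inversion of `q²`, so both choices of the sign in `hq` give the same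
  -- cosine.
  have hcos : (q ^ 2) ^ n + (q ^ 2) ^ (-n) = 2 * Complex.cos (2 * (n * π / ℓ)) := by
    rw [Complex.two_cos]
    rcases hq with h | h
    · rw [h, ← Complex.exp_int_mul, ← Complex.exp_int_mul]
      push_cast
      congr 2 <;> ring
    · rw [h, ← Complex.exp_int_mul, ← Complex.exp_int_mul, add_comm]
      push_cast
      congr 2 <;> ring
  have h1 : q ^ n * q ^ (-n) = 1 := by rw [← zpow_add₀ hq0, add_neg_cancel, zpow_zero]
  have h2 : (q ^ 2) ^ n = (q ^ n) ^ 2 := by rw [← zpow_natCast, ← zpow_natCast, zpow_comm]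
  have h3 : (q ^ 2) ^ (-n) = (q ^ (-n)) ^ 2 := by rw [← zpow_natCast, ← zpow_natCast, zpow_comm]
  rw [h2, h3, Complex.cos_two_mul] at hcos
  have h4 := Complex.sin_sq_add_cos_sq ((n : ℂ) * π / ℓ)
  rw [sinSq]
  push_cast
  linear_combination hcos - 2 * h1 + 4 * h4

/-- In each quotient the minus signs and the common denominators `sinSq ℓ 1` cancel; the latter are
nonzero because `1 < ℓ`. -/
theorem dWeight_sq {ℓ : ℕ} (hℓ : 1 < ℓ) {q : ℂ}
    (hq : q ^ 2 = Complex.exp (2 * π * Complex.I / ℓ) ∨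
      q ^ 2 = Complex.exp (-(2 * π * Complex.I / ℓ))) (N : ℤ) (μ : YoungDiagram) :
    dWeight N q μ ^ 2 = (gWeight (sinSq ℓ) N μ : ℂ) := by
  have h1 : (q - q⁻¹) ^ 2 = -(sinSq ℓ 1 : ℂ) := by
    simpa using zpow_sub_zpow_neg_sq hq 1
  have h2 : (sinSq ℓ 1 : ℂ) ≠ 0 := by
    exact_mod_cast sinSq_ne_zero one_pos (by exact_mod_cast hℓ)
  rw [dWeight, gWeight, ← prod_pow]
  push_cast
  refine prod_congr rfl fun c _ => ?_
  rw [div_pow, qNum, qNum, div_pow, div_pow, zpow_sub_zpow_neg_sq hq, zpow_sub_zpow_neg_sq hq, h1,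
    neg_div_neg_eq, neg_div_neg_eq, div_div_div_cancel_right₀ h2]

theorem evenDiagrams_of_pos {N : ℤ} {ℓ T w : ℕ} (h0 : 0 < N) (hT : N = T)
    (hw : (ℓ : ℤ) - N = 2 * w) :
    evenDiagrams N ℓ = ↑((colDiagrams T w).filter fun μ => Even μ.card) := by
  ext μ
  rw [mem_coe, mem_filter, mem_colDiagrams]
  simp only [evenDiagrams, diagrams, Set.mem_ofPred_eq, if_pos h0]
  rw [if_pos (by rw [hw]; exact even_two_mul _)]
  refine and_congr_left fun _ => ?_
  omega

theorem evenDiagrams_of_neg {N : ℤ} {ℓ T k : ℕ} (h0 : N < 0) (hk : N = -(2 * k))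
    (hT : (ℓ : ℤ) = 2 * k + T) :
    evenDiagrams N ℓ = ↑((colDiagrams T k).filter fun μ => Even μ.card) := by
  ext μ
  rw [mem_coe, mem_filter, mem_colDiagrams]
  simp only [evenDiagrams, diagrams, Set.mem_ofPred_eq, if_neg h0.not_gt]
  rw [if_pos (by rw [hk]; exact (even_two_mul _).neg), abs_of_neg h0]
  refine and_congr_left fun _ => ?_
  omega

/-- Reduction of the identity to finite sums and products of real numbers. -/
theorem finsum_dWeight_sq {N : ℤ} {ℓ : ℕ} (hℓ : 1 < ℓ) {q : ℂ}
    (hq : q ^ 2 = Complex.exp (2 * π * Complex.I / ℓ) ∨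
      q ^ 2 = Complex.exp (-(2 * π * Complex.I / ℓ)))
    {S : Finset YoungDiagram} {R : Finset (Fin (rk N) → ℝ)} (hS : evenDiagrams N ℓ = ↑S)
    (hR : posRoots N = ↑R) {Z : ℝ} (hZ : Z ≠ 0) (hRZ : ∏ α ∈ R, rootFactor N ℓ α = Z⁻¹)
    (hsum : (∑ μ ∈ S, gWeight (sinSq ℓ) N μ) * Z = (ℓ : ℝ) ^ rk N / bConst N) :
    (evenDiagrams N ℓ).Finite ∧ (posRoots N).Finite ∧
      ∑ᶠ μ ∈ evenDiagrams N ℓ, dWeight N q μ ^ 2 =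
        (((ℓ : ℝ) ^ rk N / bConst N *
          ∏ᶠ α ∈ posRoots N, 1 / (4 * sin ((α ⬝ᵥ rhoCheck N) * π / ℓ) ^ 2) : ℝ) : ℂ) := by
  rw [hS, hR]
  refine ⟨S.finite_toSet, R.finite_toSet, ?_⟩
  rw [finsum_mem_coe_finset, finprod_mem_coe_finset, sum_congr rfl fun μ _ => dWeight_sq hℓ hq N μ,
    ← Complex.ofReal_sum]
  congr 1
  change _ = _ * ∏ α ∈ R, rootFactor N ℓ α
  rw [hRZ, ← hsum, mul_assoc, mul_inv_cancel₀ hZ, mul_one]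

end Weights

end SquareSum

theorem proposition3p3 (N : ℤ) (ℓ : ℕ) (hN : 1 < |N|) (hℓ : |N| < (ℓ : ℤ))
    (hcase : (0 < N ∧ Even ((ℓ : ℤ) - N)) ∨ (N < 0 ∧ Even N))
    (q : ℂ) (hq : q ^ 2 = Complex.exp (2 * Real.pi * Complex.I / ℓ) ∨
      q ^ 2 = Complex.exp (-(2 * Real.pi * Complex.I / ℓ))) :
    (SquareSum.evenDiagrams N ℓ).Finite ∧ (SquareSum.posRoots N).Finite ∧
      ∑ᶠ μ ∈ SquareSum.evenDiagrams N ℓ, SquareSum.dWeight N q μ ^ 2 =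
        (((ℓ : ℝ) ^ SquareSum.rk N / SquareSum.bConst N *
          ∏ᶠ α ∈ SquareSum.posRoots N,
            1 / (4 * Real.sin ((α ⬝ᵥ SquareSum.rhoCheck N) * Real.pi / ℓ) ^ 2) : ℝ) : ℂ) := by
  have hℓ1 : 1 < ℓ := by omega
  have hg : ∀ m : ℤ, 0 < m → m < ℓ → SquareSum.sinSq ℓ m ≠ 0 := fun m => SquareSum.sinSq_ne_zero
  have hpair : SquareSum.pairFactor (SquareSum.sinSq ℓ) (SquareSum.rk N) (|N| - 1) ≠ 0 :=
    SquareSum.pairFactor_ne_zero _ hg (by rw [SquareSum.rk, Int.abs_eq_natAbs]; omega) (by omega)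
  obtain ⟨h0, hev⟩ | ⟨h0, hev⟩ := hcase
  · obtain ⟨w, hw⟩ := hev
    rw [abs_of_pos h0] at hN hℓ hpair
    obtain ⟨n, rfl⟩ := Int.eq_ofNat_of_zero_le (show 0 ≤ w by omega)
    rcases Int.even_or_odd N with hpar | hpar
    -- Type `D`: the formulas for even `N > 0` are indexed by the rank minus one.
    · obtain ⟨k, hk⟩ : ∃ k, SquareSum.rk N = k + 1 :=
        Nat.exists_eq_succ_of_ne_zero (by rw [SquareSum.rk]; omega)
      have hNk : N = 2 * (k + 1) := by
        obtain ⟨t, ht⟩ := hpar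
        rw [SquareSum.rk] at hk
        omega
      refine SquareSum.finsum_dWeight_sq hℓ1 hq
        (SquareSum.evenDiagrams_of_pos (T := 2 * (k + 1)) (w := n) h0 (by push_cast; omega)
          (by omega))
        (SquareSum.posRoots_of_pos_even h0 hpar) hpair ?_ ?_
      · rw [SquareSum.prod_pairRoots, abs_of_pos h0]
      · rw [hk, show N - 1 = 2 * k + 1 by omega, SquareSum.pairFactor_succ,
          SquareSum.bConst, if_pos ⟨h0, hpar⟩, hNk,
          SquareSum.sum_gWeight_even (n := n) (by omega) (by omega)]
        norm_num
    -- Type `B`: the short roots `φ_i` pair with `ρ̌` to `k - i`, where `k` is the rank.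
    · have hNk : N = 2 * SquareSum.rk N + 1 := by
        obtain ⟨t, ht⟩ := hpar
        rw [SquareSum.rk]
        omega
      have haxis : ∏ i ∈ Finset.range (SquareSum.rk N), SquareSum.sinSq ℓ (SquareSum.rk N - i) ≠ 0 :=
        Finset.prod_ne_zero_iff.2 fun i hi => by
          rw [Finset.mem_range] at hi
          exact hg _ (by omega) (by omega)
      refine SquareSum.finsum_dWeight_sq hℓ1 hq
        (SquareSum.evenDiagrams_of_pos (T := 2 * SquareSum.rk N + 1) (w := n) h0
          (by push_cast; omega) (by omega))
        (SquareSum.posRoots_of_pos_odd h0 hpar) (mul_ne_zero hpair haxis) ?_ ?_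
      · rw [Finset.prod_union (SquareSum.disjoint_axisRoots one_pos), SquareSum.prod_pairRoots,
          abs_of_pos h0, mul_inv, SquareSum.prod_axisRootFactors ℓ one_pos
            (fun i => (SquareSum.rk N : ℤ) - i)]
        intro i
        rw [abs_of_pos (by exact_mod_cast h0)]
        have : (N : ℝ) = 2 * SquareSum.rk N + 1 := by exact_mod_cast hNk
        rw [this]
        push_cast
        ring
      · rw [show N - 1 = 2 * SquareSum.rk N by omega, SquareSum.pairFactor_mul_short,
          SquareSum.bConst, if_neg (fun h => (Int.not_even_iff_odd.2 hpar) h.2)]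
        have := SquareSum.sum_gWeight_odd (ℓ := ℓ) (k := SquareSum.rk N) (n := n) (by omega)
          (by omega)
        rw [← hNk] at this
        rw [this]
        norm_num
  · rw [abs_of_neg h0] at hN hℓ hpair
    have hNk : N = -(2 * SquareSum.rk N) := by
      obtain ⟨t, ht⟩ := hev
      rw [SquareSum.rk]
      omega
    -- Type `C`: `T = ℓ - |N|` bounds the first two columns, and the long roots `2φ_i` pair with
    -- `ρ̌` to `2k - 1 - 2i`.
    obtain ⟨T, hT⟩ := Int.eq_ofNat_of_zero_le (show 0 ≤ (ℓ : ℤ) + N by omega)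
    have haxis : ∏ i ∈ Finset.range (SquareSum.rk N),
        SquareSum.sinSq ℓ (2 * SquareSum.rk N - 1 - 2 * i) ≠ 0 :=
      Finset.prod_ne_zero_iff.2 fun i hi => by
        rw [Finset.mem_range] at hi
        exact hg _ (by omega) (by omega)
    have hZ := mul_ne_zero hpair haxis
    refine SquareSum.finsum_dWeight_sq hℓ1 hq
      (SquareSum.evenDiagrams_of_neg (T := T) (k := SquareSum.rk N) h0 hNk (by omega))
      (SquareSum.posRoots_of_neg h0 hev) hZ ?_ ?_
    · rw [Finset.prod_union (SquareSum.disjoint_axisRoots two_pos), SquareSum.prod_pairRoots,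
        abs_of_neg h0, mul_inv, SquareSum.prod_axisRootFactors ℓ two_pos
          (fun i => 2 * (SquareSum.rk N : ℤ) - 1 - 2 * i)]
      intro i
      rw [abs_of_neg (by exact_mod_cast h0)]
      have : (N : ℝ) = -(2 * SquareSum.rk N) := by exact_mod_cast hNk
      rw [this]
      push_cast
      ring
    · rw [show -N - 1 = 2 * SquareSum.rk N - 1 by omega, SquareSum.pairFactor_mul_long] at hZ ⊢
      rw [SquareSum.bConst, if_neg (fun h => h0.not_gt h.1)]
      have := SquareSum.sum_gWeight_neg (ℓ := ℓ) (k := SquareSum.rk N) (T := T) (by omega)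
        (by omega) (by omega) hZ
      rw [← hNk] at this
      rw [this]
      norm_num
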